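/- Let $n\ge 0$ and let $(f_t)_{t\in[0,1]}$ be a family of polynomials $f_t:\mathbb{C}^{n+1}\to\mathbb{C}$, jointly continuous in $(t,z)$, such that every $f_t$ has an isolated singularity at $0$ (that is, $f_t(0)=0$, $df_t(0)=0$, and $f_t^{-1}(0)$ has no other singular point near $0$) and such that the singularity type of $f_t$ (the germ of the hypersurface $f_t=0$ at $0$ up to biholomorphism) is the same for all $t\ne 0$. Put $f=f_0$. Let $\theta=\frac12\sum_j(x_j\,dy_j-y_j\,dx_j)$ and $\omega=d\theta$ on $\mathbb{C}^{n+1}$, and let $B_r$ and $S_r$ be the closed ball and the sphere of radius $r$ around $0$. Let $\varepsilon>0$ be a Milnor radius of $f$: $f^{-1}(0)\cap B_\varepsilon\setminus\{0\}$ consists of regular points of $f$ and is transverse to $S_r$ for all $0<r\le\varepsilon$. Let $0<\varepsilon'<\varepsilon$ and $C\in\mathbb{R}$. Let $\mathcal{B}$ be the set of smooth functions $\beta:\mathbb{C}^{n+1}\to[0,1]$ with $\beta=0$ on $B_{\varepsilon'}$, $\beta(z)=1$ for $(\varepsilon'+\varepsilon)/2<|z|\le\varepsilon$ and $|d\beta|\le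 C$ on $B_\varepsilon$. Then there are $\delta_0,\eta_0>0$ such that the following holds for all $0<\eta<\eta_0$ with $\eta\le 1$, with $g=f_\eta$, and for all $\delta\in\mathbb{C}$ with $0<|\delta|<\delta_0$ that are regular values of $g|_{B_\varepsilon}$. For $\beta\in\mathcal{B}$ put $\tilde g_\beta=g+(f-g)\beta$, $M_g=g^{-1}(\delta)\cap B_\varepsilon$ and $M_{\tilde g_\beta}=\tilde g_\beta^{-1}(\delta)\cap B_\varepsilon$. 1. $(M_g,\theta|_{M_g})$ and, for every $\beta\in\mathcal{B}$, $(M_{\tilde g_\beta},\theta|_{M_{\tilde g_\beta}})$ are Liouville domains: compact smooth manifolds of dimension $2n$ with boundary in $S_\varepsilon$, on which $\omega=d\theta$ is symplectic, and whose Liouville vector field is strictly outward pointing along the boundary. 2. For all $\beta_1,\beta_2\in\mathcal{B}$, $M_{\tilde g_{\beta_1}}$ and $M_{\tilde g_{\beta_2}}$ are exact symplectomorphic: there is a diffeomorphism $\Psi:M_{\tilde g_{\beta_1}}\to M_{\tilde g_{\beta_2}}$ with $\Psi^*\theta-\theta=dG$ for a smooth function $G$. 3. For every $\beta\in\mathcal{B}$,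 the Liouville completions $(N,\lambda)$ of $M_{\tilde g_\beta}$ and $(N',\lambda')$ of $M_g$ (obtained by gluing the cylindrical ends $(\partial M\times[0,\infty),e^t\theta|_{\partial M})$ to the domains $M$ along Liouville collars) exist and are exact symplectomorphic: there is a diffeomorphism $\psi:N\to N'$ with $\psi^*\lambda'-\lambda=dG$ for a smooth function $G$. -/

import Mathlib

open scoped ContDiff Manifold Topology

noncomputable section

namespace MilnorFibers

/-- The complex vector space `ℂ^{n+1}` with its Hermitian norm. -/
abbrev Cn (n : ℕ) : Type := EuclideanSpace ℂ (Fin (n + 1))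

/-- Polynomials in `n + 1` complex variables. -/
abbrev Poly (n : ℕ) : Type := MvPolynomial (Fin (n + 1)) ℂ

/-- The function `ℂ^{n+1} → ℂ` defined by a polynomial. -/
def polyFun {n : ℕ} (p : Poly n) (z : Cn n) : ℂ := MvPolynomial.eval (fun i => z i) p

/-- The partial derivative `∂p/∂z_i`, as a function. -/
def partialFun {n : ℕ} (p : Poly n) (i : Fin (n + 1)) (z : Cn n) : ℂ :=
  polyFun (MvPolynomial.pderiv i p) z

/-! ### Isolated singularities and adjacency -/

/-- `p(0) = 0`, all first partial derivatives vanish at `0`, and near `0` there is no other singular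
point on the zero locus of `p`. -/
def HasIsolatedSingularity {n : ℕ} (p : Poly n) : Prop :=
  polyFun p 0 = 0 ∧ (∀ i, partialFun p i 0 = 0) ∧
    ∀ᶠ z in 𝓝[≠] (0 : Cn n), polyFun p z = 0 → ∃ i, partialFun p i z ≠ 0

/-- The germs at `0` of the hypersurfaces `p = 0` and `q = 0` are analytically isomorphic:
`p ∘ φ = u q` near `0` for a biholomorphic germ `φ` fixing `0` and a holomorphic unit `u`. -/
def SameSingularityType {n : ℕ} (p q : Poly n) : Prop :=
  ∃ (φ : OpenPartialHomeomorph (Cn n) (Cn n)) (u : Cn n → ℂ),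
    (0 : Cn n) ∈ φ.source ∧ φ 0 = 0 ∧
    DifferentiableOn ℂ φ φ.source ∧ DifferentiableOn ℂ φ.symm φ.target ∧
    AnalyticAt ℂ u 0 ∧ u 0 ≠ 0 ∧
    ∀ᶠ z in 𝓝 (0 : Cn n), polyFun p (φ z) = u z * polyFun q z

/-- A family of polynomials `f_t`, `t ∈ [0,1]`, continuous in `(t, z)`, with isolated singularities
at `0`, such that the singularity type of `f_t` is the same for all `t ≠ 0`. It exhibits the
singularity of `f_0` as adjacent to the one of `f_t`, `t ≠ 0`. -/
structure IsAdjacency {n : ℕ} (f : ℝ → Poly n) : Prop where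
  continuousOn : ContinuousOn (fun x : ℝ × Cn n => polyFun (f x.1) x.2) (Set.Icc 0 1 ×ˢ Set.univ)
  isolated : ∀ t ∈ Set.Icc (0 : ℝ) 1, HasIsolatedSingularity (f t)
  sameType : ∀ s ∈ Set.Ioc (0 : ℝ) 1, ∀ t ∈ Set.Ioc (0 : ℝ) 1, SameSingularityType (f s) (f t)

/-- `ε` is a Milnor radius of `p`: in the closed ball of radius `ε`, the zero locus of `p` is smooth
away from `0` and transverse to all the spheres around `0` (some tangent vector of the zero locus
is not tangent to the sphere). -/
def IsMilnorRadius {n : ℕ} (p : Poly n) (ε : ℝ) : Prop :=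
  0 < ε ∧ ∀ z : Cn n, 0 < ‖z‖ → ‖z‖ ≤ ε → polyFun p z = 0 →
    (∃ i, partialFun p i z ≠ 0) ∧
    ∃ v : Cn n, ∑ i, partialFun p i z * v i = 0 ∧ (inner ℂ z v).re ≠ 0

/-- `δ` is a regular value of the restriction of `p` to the closed ball of radius `ε`. -/
def IsRegularLevel {n : ℕ} (p : Poly n) (δ : ℂ) (ε : ℝ) : Prop :=
  ∀ z : Cn n, ‖z‖ ≤ ε → polyFun p z = δ → ∃ i, partialFun p i z ≠ 0

/-! ### The modification -/

/-- Bump functions on the ball of radius `ε`: smooth with values in `[0,1]`, equal to `0` up to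
radius `ε'` and to `1` from radius `(ε' + ε) / 2` on, with derivative bounded by `C`. -/
structure IsBump {n : ℕ} (ε ε' C : ℝ) (β : Cn n → ℝ) : Prop where
  smooth : ContDiff ℝ ∞ β
  mem_Icc : ∀ z, β z ∈ Set.Icc (0 : ℝ) 1
  eq_zero : ∀ z, ‖z‖ ≤ ε' → β z = 0
  eq_one : ∀ z, (ε' + ε) / 2 < ‖z‖ → ‖z‖ ≤ ε → β z = 1
  bound : ∀ z, ‖z‖ ≤ ε → ‖fderiv ℝ β z‖ ≤ C

/-- The modified function `g + (f - g) β`. -/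
def modified {n : ℕ} (f g : Poly n) (β : Cn n → ℝ) (z : Cn n) : ℂ :=
  polyFun g z + (polyFun f z - polyFun g z) * (β z : ℂ)

/-! ### Level sets in a ball as exact symplectic manifolds with boundary -/

/-- For a function `h` and a level `δ`, the part `h⁻¹(δ) ∩ B_ε` of the level set in the closed ball of
radius `ε`. Its boundary consists of the points of norm `ε`. -/
def fiber {n : ℕ} (h : Cn n → ℂ) (δ : ℂ) (ε : ℝ) : Set (Cn n) := {z | ‖z‖ ≤ ε ∧ h z = δ}

/-- The boundary `h⁻¹(δ) ∩ S_ε`. -/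
def fiberBoundary {n : ℕ} (h : Cn n → ℂ) (δ : ℂ) (ε : ℝ) : Set (Cn n) := {z | ‖z‖ = ε ∧ h z = δ}

/-- The tangent space at `z` of the level set of `h` through `z`. -/
def fiberTangent {n : ℕ} (h : Cn n → ℂ) (z : Cn n) : Submodule ℝ (Cn n) :=
  LinearMap.ker (fderiv ℝ h z : Cn n →ₗ[ℝ] ℂ)

/-- The standard primitive `½ ∑ (x_j dy_j - y_j dx_j)` of the symplectic form of `ℂ^{n+1}`. -/
def stdPrimitive {n : ℕ} (z v : Cn n) : ℝ := (inner ℂ z v).im / 2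

/-- The standard symplectic form `∑ dx_j ∧ dy_j` of `ℂ^{n+1}`. -/
def stdSymplectic {n : ℕ} (v w : Cn n) : ℝ := (inner ℂ v w).im

theorem stdPrimitive_eq {n : ℕ} (z v : Cn n) :
    stdPrimitive z v = (∑ j, ((z j).re * (v j).im - (z j).im * (v j).re)) / 2 := by
  simp only [stdPrimitive, PiLp.inner_apply, Complex.im_sum]
  congr 1
  refine Finset.sum_congr rfl fun j _ => ?_
  simp [Complex.mul_im]
  ring

theorem stdSymplectic_eq {n : ℕ} (v w : Cn n) :
    stdSymplectic v w = ∑ j, ((v j).re * (w j).im - (v j).im * (w j).re) := by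
  have h := stdPrimitive_eq v w
  simp only [stdPrimitive] at h
  simp only [stdSymplectic]
  linarith

/-- The exterior derivative of the standard primitive is the standard symplectic form. -/
theorem deriv_stdPrimitive {n : ℕ} (z v w : Cn n) :
    deriv (fun s : ℝ => stdPrimitive (z + s • v) w) 0
      - deriv (fun s : ℝ => stdPrimitive (z + s • w) v) 0 = stdSymplectic v w := by
  have key : ∀ a b : Cn n,
      deriv (fun s : ℝ => stdPrimitive (z + s • a) b) 0 = stdSymplectic a b / 2 := by
    intro a b
    have : (fun s : ℝ => stdPrimitive (z + s • a) b)
        = fun s : ℝ => stdPrimitive z b + s * (stdSymplectic a b / 2) := by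
      funext s
      simp only [stdPrimitive_eq, stdSymplectic_eq, Finset.sum_div, Finset.mul_sum,
        ← Finset.sum_add_distrib]
      refine Finset.sum_congr rfl fun j _ => ?_
      simp
      ring
    rw [this]
    simp
  have anti : stdSymplectic w v = - stdSymplectic v w := by
    simp only [stdSymplectic_eq, ← Finset.sum_neg_distrib]
    refine Finset.sum_congr rfl fun j _ => ?_
    ring
  rw [key, key, anti]
  ring

/-- `h⁻¹(δ) ∩ B_ε` is a Liouville domain: it is a smooth submanifold of `ℂ^{n+1}` (of real dimension
`2n`) on which the exact form `ω = dθ` is symplectic, with boundary in the sphere `S_ε`, and the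
Liouville vector field `X` (`ι_X ω = θ` on the level set) points strictly outwards along the boundary.
In particular the level set is transverse to `S_ε`. -/
structure IsLiouvilleDomain {n : ℕ} (h : Cn n → ℂ) (δ : ℂ) (ε : ℝ) : Prop where
  smooth : ∃ U : Set (Cn n), IsOpen U ∧ fiber h δ ε ⊆ U ∧ ContDiffOn ℝ ∞ h U
  regular : ∀ z ∈ fiber h δ ε, Function.Surjective (fderiv ℝ h z)
  symplectic : ∀ z ∈ fiber h δ ε, ∀ v ∈ fiberTangent h z,
    (∀ w ∈ fiberTangent h z, stdSymplectic v w = 0) → v = 0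
  outward : ∀ z ∈ fiberBoundary h δ ε, ∀ X ∈ fiberTangent h z,
    (∀ w ∈ fiberTangent h z, stdSymplectic X w = stdPrimitive z w) → 0 < (inner ℂ z X).re

/-- An exact symplectomorphism between `h₁⁻¹(δ) ∩ B_ε` and `h₂⁻¹(δ) ∩ B_ε`: mutually inverse smooth maps
`Ψ`, `Φ` (smooth maps on a submanifold are restrictions of smooth maps on a neighbourhood) and a
smooth function `G` with `Ψ^* θ = θ + dG` on the tangent spaces of the first level set. -/
def FibersExactSymplectomorphic {n : ℕ} (h₁ h₂ : Cn n → ℂ) (δ : ℂ) (ε : ℝ) : Prop :=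
  ∃ (Ψ Φ : Cn n → Cn n) (G : Cn n → ℝ) (U₁ U₂ : Set (Cn n)),
    IsOpen U₁ ∧ fiber h₁ δ ε ⊆ U₁ ∧ IsOpen U₂ ∧ fiber h₂ δ ε ⊆ U₂ ∧
    ContDiffOn ℝ ∞ Ψ U₁ ∧ ContDiffOn ℝ ∞ G U₁ ∧ ContDiffOn ℝ ∞ Φ U₂ ∧
    Set.MapsTo Ψ (fiber h₁ δ ε) (fiber h₂ δ ε) ∧ Set.MapsTo Φ (fiber h₂ δ ε) (fiber h₁ δ ε) ∧
    Set.InvOn Φ Ψ (fiber h₁ δ ε) (fiber h₂ δ ε) ∧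
    ∀ z ∈ fiber h₁ δ ε, ∀ v ∈ fiberTangent h₁ z,
      stdPrimitive (Ψ z) (fderiv ℝ Ψ z v) = stdPrimitive z v + fderiv ℝ G z v

/-! ### Exact symplectic manifolds and Liouville completions -/

/-- The coordinate expression of a 1-form in the preferred chart at `x₀`. -/
def coordForm {d : ℕ} {N : Type} [TopologicalSpace N] [ChartedSpace (EuclideanSpace ℝ (Fin d)) N]
    (lam : (x : N) → TangentSpace 𝓘(ℝ, EuclideanSpace ℝ (Fin d)) x →L[ℝ] ℝ) (x₀ : N)
    (y : EuclideanSpace ℝ (Fin d)) : EuclideanSpace ℝ (Fin d) →L[ℝ] ℝ :=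
  (lam ((chartAt (EuclideanSpace ℝ (Fin d)) x₀).symm y)).comp
    (mfderiv 𝓘(ℝ, EuclideanSpace ℝ (Fin d)) 𝓘(ℝ, EuclideanSpace ℝ (Fin d))
      (chartAt (EuclideanSpace ℝ (Fin d)) x₀).symm y)

/-- An exact symplectic manifold of dimension `d` without boundary: a smooth manifold with a smooth
1-form `lam` whose exterior derivative is nondegenerate. -/
structure ExactSymplecticManifold (d : ℕ) where
  carrier : Type
  [top : TopologicalSpace carrier]
  [t2 : T2Space carrier]
  [secondCountable : SecondCountableTopology carrier]
  [charted : ChartedSpace (EuclideanSpace ℝ (Fin d)) carrier]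
  [manifold : IsManifold 𝓘(ℝ, EuclideanSpace ℝ (Fin d)) ∞ carrier]
  lam : (x : carrier) → TangentSpace 𝓘(ℝ, EuclideanSpace ℝ (Fin d)) x →L[ℝ] ℝ
  lam_smooth : ∀ x₀ : carrier,
    ContDiffOn ℝ ∞ (coordForm lam x₀) (chartAt (EuclideanSpace ℝ (Fin d)) x₀).target
  symplectic : ∀ x₀ : carrier, ∀ y ∈ (chartAt (EuclideanSpace ℝ (Fin d)) x₀).target,
    ∀ v : EuclideanSpace ℝ (Fin d),
      (∀ w : EuclideanSpace ℝ (Fin d),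
        fderiv ℝ (coordForm lam x₀) y v w - fderiv ℝ (coordForm lam x₀) y w v = 0) → v = 0

attribute [instance] ExactSymplecticManifold.top ExactSymplecticManifold.t2
  ExactSymplecticManifold.secondCountable ExactSymplecticManifold.charted
  ExactSymplecticManifold.manifold

/-- A diffeomorphism `ψ` with `ψ^* lam' = lam + dG` for a smooth function `G`. -/
def ExactSymplectomorphic {d : ℕ} (N N' : ExactSymplecticManifold d) : Prop :=
  ∃ (ψ : Diffeomorph 𝓘(ℝ, EuclideanSpace ℝ (Fin d)) 𝓘(ℝ, EuclideanSpace ℝ (Fin d))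
      N.carrier N'.carrier ∞) (G : N.carrier → ℝ),
    ContMDiff 𝓘(ℝ, EuclideanSpace ℝ (Fin d)) 𝓘(ℝ, ℝ) ∞ G ∧
    ∀ (x : N.carrier) (v : TangentSpace 𝓘(ℝ, EuclideanSpace ℝ (Fin d)) x),
      mfderiv 𝓘(ℝ, EuclideanSpace ℝ (Fin d)) 𝓘(ℝ, ℝ) G x v
        = (N'.lam (ψ x)
            (mfderiv 𝓘(ℝ, EuclideanSpace ℝ (Fin d)) 𝓘(ℝ, EuclideanSpace ℝ (Fin d)) ψ x v)
          - N.lam x v : ℝ)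

/-- `N` is the Liouville completion of the domain `M = h⁻¹(δ) ∩ B_ε`, with boundary `∂M`: it is the union
of `M`, embedded by `ι` with `ι^* lam = θ`, and of the cylindrical end `∂M × [0,∞)` with the form
`e^t θ|_∂M`, glued along a collar: `κ` embeds `∂M × (-c,∞)` with `κ^* lam = e^t θ|_∂M`, and
`κ(p,0) = ι(p)`, and `κ(p,t)` lies in `ι(M)` exactly when `t ≤ 0`. -/
def IsLiouvilleCompletion {n : ℕ} (h : Cn n → ℂ) (δ : ℂ) (ε : ℝ)
    (N : ExactSymplecticManifold (2 * n)) : Prop :=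
  ∃ (ι : Cn n → N.carrier) (κ : Cn n × ℝ → N.carrier) (c : ℝ)
    (U : Set (Cn n)) (W : Set (Cn n × ℝ)),
    0 < c ∧
    IsOpen U ∧ fiber h δ ε ⊆ U ∧
    IsOpen W ∧ fiberBoundary h δ ε ×ˢ Set.Ioi (-c) ⊆ W ∧
    ContMDiffOn 𝓘(ℝ, Cn n) 𝓘(ℝ, EuclideanSpace ℝ (Fin (2 * n))) ∞ ι U ∧
    ContMDiffOn 𝓘(ℝ, Cn n × ℝ) 𝓘(ℝ, EuclideanSpace ℝ (Fin (2 * n))) ∞ κ W ∧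
    Set.InjOn ι (fiber h δ ε) ∧
    Set.InjOn κ (fiberBoundary h δ ε ×ˢ Set.Ioi (-c)) ∧
    (∀ z ∈ fiber h δ ε, ∀ v ∈ fiberTangent h z,
      N.lam (ι z) (mfderiv 𝓘(ℝ, Cn n) 𝓘(ℝ, EuclideanSpace ℝ (Fin (2 * n))) ι z v)
        = stdPrimitive z v) ∧
    (∀ p ∈ fiberBoundary h δ ε, ∀ t : ℝ, -c < t →
      ∀ v ∈ fiberTangent h p, (inner ℂ p v).re = 0 → ∀ s : ℝ,
        N.lam (κ (p, t))
          (mfderiv 𝓘(ℝ, Cn n × ℝ) 𝓘(ℝ, EuclideanSpace ℝ (Fin (2 * n))) κ (p, t)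
            ((v, s) : Cn n × ℝ))
          = Real.exp t * stdPrimitive p v) ∧
    (∀ p ∈ fiberBoundary h δ ε, κ (p, 0) = ι p) ∧
    (∀ p ∈ fiberBoundary h δ ε, ∀ t : ℝ, -c < t → (κ (p, t) ∈ ι '' fiber h δ ε ↔ t ≤ 0)) ∧
    ι '' fiber h δ ε ∪ κ '' (fiberBoundary h δ ε ×ˢ Set.Ici 0) = Set.univ

end MilnorFibers

end

/-! Everything rests on one open condition on pairs `(z, L)`, with `L` a real-linear map to `ℂ`: `L`
is onto with symplectic kernel, and the Liouville vector of that kernel at `z` points away from the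
origin (`IsConvexAt`). If `L` is complex linear and nonzero, its kernel is complex, hence
symplectic, and the Liouville vector is half the orthogonal projection of `z` to the kernel.
Transversality to the sphere then makes it point outwards (`radial_complex_pos`). So the Milnor
radius condition gives convexity along `f = 0` in the shell `ε' ≤ |z| ≤ ε`.

By compactness, convexity persists up to a radius `R > ε`, for small values of `f` and for `L` close
to `df` (`exists_forall_mem_of_near`). Uniform convergence of `f_η` to `f` is also convergence of
derivatives, by Cauchy's estimate. Hence all functions `g + (f - g)γ` have convex `δ`-levels in the
shell, uniformly over the weights `γ` with a given derivative bound
(`IsAdjacency.exists_isConvexAt`). In the ball of radius `ε'` such a function is `g`, and there the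
regularity of `δ` suffices. This yields part 1. Since only jets on `B_ε` matter, each `β` may be
replaced by a weight which, outside `B_ε`, is a cutoff independent of `β`
(`exists_isWeight_extension`).

For part 2, two weights are joined by a segment, and the levels are moved by symplectic parallel
transport, that is, by the lift of the variation to the symplectic complements of the tangent spaces
(`exists_parallelTransport`). The transport changes `θ` by an exact form and is the identity where
the weights agree.

For part 3, the completion is realized inside `ℂ^{n+1}`: it is the level in the open ball of radius
`R`, with `θ` multiplied by a function of `|z|²` that equals `1` up to a radius between `ε` and `R`.
The Liouville field of this form extends by zero across the sphere of radius `R`, so its flow is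
complete, and it sweeps out the cylindrical end (`isLiouvilleCompletion_weightedLevel`). In these
models the weight of `β` can be compared with the weight `0`, which gives `g`: the two agree from
the radius on where the form starts to change, so the parallel transport is an exact
symplectomorphism for the multiplied forms as well (`IsTransport.exactSymplectomorphic`). -/

open scoped ContDiff Manifold Topology

noncomputable section

/-! ### Smooth global flows of vector fields, by the implicit function theorem on spaces of curves.
-/

namespace SmoothFlow

open unitInterval

/-! ### Superposition operators on spaces of continuous curves -/

section Superposition

variable {E F : Type} [NormedAddCommGroup E] [NormedSpace ℝ E] [NormedAddCommGroup F]
  [NormedSpace ℝ F]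

/-- Pointwise application of a curve of linear maps to a curve of vectors. -/
def pointwiseApply : C(I, E →L[ℝ] F) →L[ℝ] C(I, E) →L[ℝ] C(I, F) :=
  LinearMap.mkContinuous₂
    (LinearMap.mk₂ ℝ (fun (A : C(I, E →L[ℝ] F)) (γ : C(I, E)) =>
      (⟨fun t => A t (γ t), by fun_prop⟩ : C(I, F)))
      (fun _ _ _ => by ext; simp) (fun _ _ _ => by ext; simp)
      (fun _ _ _ => by ext; simp) (fun _ _ _ => by ext; simp)) 1 (by
    intro A γ
    refine (ContinuousMap.norm_le _ (by positivity)).2 fun t => ?_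
    rw [one_mul]
    exact ((A t).le_opNorm _).trans
      (mul_le_mul (A.norm_coe_le_norm t) (γ.norm_coe_le_norm t) (norm_nonneg _) (by positivity)))

@[simp] theorem pointwiseApply_apply (A : C(I, E →L[ℝ] F)) (γ : C(I, E)) (t : I) :
    pointwiseApply A γ t = A t (γ t) := rfl

/-- The mean value inequality is applied on each segment from `γ t` to `γ t + η t`. It is uniform in
`t` because `γ ↦ v' ∘ γ` is continuous for the sup norm. -/
theorem hasFDerivAt_comp {v : C(E, F)} {v' : C(E, E →L[ℝ] F)}
    (h : ∀ x, HasFDerivAt v (v' x) x) (γ : C(I, E)) :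
    HasFDerivAt (fun γ : C(I, E) => v.comp γ) (pointwiseApply (v'.comp γ)) γ := by
  rw [hasFDerivAt_iff_isLittleO_nhds_zero, Asymptotics.isLittleO_iff]
  intro c hc
  obtain ⟨r, hr, H⟩ := (Metric.continuousAt_iff (α := C(I, E))
    (β := C(I, E →L[ℝ] F)) (f := v'.comp) (a := γ)).1
    (ContinuousMap.continuous_postcomp (X := I) v').continuousAt c hc
  filter_upwards [Metric.ball_mem_nhds (0 : C(I, E)) hr] with η hη
  rw [mem_ball_zero_iff] at hη
  rw [ContinuousMap.norm_le _ (by positivity)]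
  intro t
  have key : ‖v (γ t + η t) - v (γ t) - v' (γ t) (γ t + η t - γ t)‖
      ≤ c * ‖γ t + η t - γ t‖ := by
    refine Convex.norm_image_sub_le_of_norm_hasFDerivWithin_le' (s := segment ℝ (γ t) (γ t + η t))
      (f' := v') (fun x _ => (h x).hasFDerivWithinAt) ?_ (convex_segment _ _)
      (left_mem_segment _ _ _) (right_mem_segment _ _ _)
    rw [segment_eq_image']
    rintro _ ⟨s, hs, rfl⟩
    have h1 : dist (γ + s • η) γ < r := by
      rw [dist_eq_norm, add_sub_cancel_left, norm_smul, Real.norm_eq_abs, abs_of_nonneg hs.1]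
      exact (mul_le_of_le_one_left (norm_nonneg _) hs.2).trans_lt hη
    have h2 := (ContinuousMap.dist_lt_iff hc).1 (H h1) t
    rw [dist_eq_norm] at h2
    simpa using h2.le
  simp only [add_sub_cancel_left] at key
  exact key.trans (mul_le_mul_of_nonneg_left (η.norm_coe_le_norm t) hc.le)

/-- The derivative of superposition with `v` is superposition with `v'` followed by a bounded linear
map, so one order of smoothness is gained at a time. The target changes to `E →L[ℝ] F` in the
induction, hence `F` is quantified inside. -/
theorem contDiff_nat_comp {E : Type} [NormedAddCommGroup E] [NormedSpace ℝ E] (n : ℕ) :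
    ∀ {F : Type} [NormedAddCommGroup F] [NormedSpace ℝ F] (v : C(E, F)), ContDiff ℝ n v →
      ContDiff ℝ n (fun γ : C(I, E) => v.comp γ) := by
  induction n with
  | zero =>
    intro F _ _ v _
    exact contDiff_zero.2 (ContinuousMap.continuous_postcomp v)
  | succ n ih =>
    intro F _ _ v hv
    obtain ⟨v', hv', h⟩ := contDiff_succ_iff_hasFDerivAt.1 (by exact_mod_cast hv)
    have := contDiff_succ_iff_hasFDerivAt.2
      ⟨fun γ => pointwiseApply ((⟨v', hv'.continuous⟩ : C(E, E →L[ℝ] F)).comp γ),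
        (ContinuousLinearMap.contDiff (𝕜 := ℝ) (E := C(I, E →L[ℝ] F))
          (F := C(I, E) →L[ℝ] C(I, F)) pointwiseApply).comp (ih ⟨v', hv'.continuous⟩ hv'),
        fun γ => hasFDerivAt_comp (v := v) (v' := ⟨v', hv'.continuous⟩) h γ⟩
    exact_mod_cast this

theorem contDiff_comp {v : C(E, F)} (hv : ContDiff ℝ ∞ v) :
    ContDiff ℝ ∞ (fun γ : C(I, E) => v.comp γ) :=
  contDiff_infty.2 fun n => contDiff_nat_comp n v (contDiff_infty.1 hv n)

end Superposition

section Integral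

variable {E : Type} [NormedAddCommGroup E] [NormedSpace ℝ E]

/-- The primitive of a curve which vanishes at `0`. -/
def primitive : C(I, E) →L[ℝ] C(I, E) :=
  LinearMap.mkContinuous
    { toFun := fun γ => ⟨fun t => ∫ τ in (0 : ℝ)..t, Set.IccExtend zero_le_one γ τ, by
        have : Continuous fun t : ℝ => ∫ τ in (0 : ℝ)..t, Set.IccExtend zero_le_one γ τ :=
          intervalIntegral.continuous_primitive
            (fun a b => (γ.continuous.Icc_extend').intervalIntegrable a b) 0
        exact this.comp continuous_subtype_val⟩
      map_add' := fun γ η => by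
        ext t
        simp only [ContinuousMap.coe_mk, ContinuousMap.add_apply]
        rw [← intervalIntegral.integral_add
          ((γ.continuous.Icc_extend').intervalIntegrable _ _)
          ((η.continuous.Icc_extend').intervalIntegrable _ _)]
        rfl
      map_smul' := fun c γ => by
        ext t
        simp only [ContinuousMap.coe_mk, ContinuousMap.smul_apply, RingHom.id_apply]
        rw [← intervalIntegral.integral_smul]
        rfl } 1 (by
    intro γ
    rw [ContinuousMap.norm_le _ (by positivity)]
    intro t
    simp only [LinearMap.coe_mk, AddHom.coe_mk, ContinuousMap.coe_mk]
    refine (intervalIntegral.norm_integral_le_of_norm_le_const (C := ‖γ‖)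
      fun τ _ => γ.norm_coe_le_norm _).trans ?_
    rw [sub_zero, abs_of_nonneg t.2.1, one_mul]
    exact mul_le_of_le_one_right (norm_nonneg _) t.2.2)

theorem primitive_apply (γ : C(I, E)) (t : I) :
    primitive γ t = ∫ τ in (0 : ℝ)..t, Set.IccExtend zero_le_one γ τ := rfl

theorem norm_primitive_apply_le (γ : C(I, E)) : ‖primitive γ‖ ≤ ‖γ‖ := by
  refine (ContinuousMap.norm_le _ (by positivity)).2 fun t => ?_
  refine (intervalIntegral.norm_integral_le_of_norm_le_const (C := ‖γ‖)
    fun τ _ => γ.norm_coe_le_norm _).trans ?_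
  rw [sub_zero, abs_of_nonneg t.2.1]
  exact mul_le_of_le_one_right (norm_nonneg _) t.2.2

end Integral

/-! ### Global flows -/

/-- `Φ` is the smooth global flow of the autonomous vector field `v`. -/
structure IsFlow {E : Type} [NormedAddCommGroup E] [NormedSpace ℝ E] (v : E → E)
    (Φ : ℝ → E → E) : Prop where
  smooth : ContDiff ℝ ∞ (fun p : ℝ × E => Φ p.1 p.2)
  zero : ∀ x, Φ 0 x = x
  hasDerivAt : ∀ t x, HasDerivAt (fun s => Φ s x) (v (Φ t x)) t
  unique : ∀ γ : ℝ → E, (∀ t, HasDerivAt γ (v (γ t)) t) → ∀ t, γ t = Φ t (γ 0)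

section Existence

variable {E : Type} [NormedAddCommGroup E] [NormedSpace ℝ E] [CompleteSpace E]

theorem exists_integralCurve_Icc {v : E → E} {K : NNReal} {M : ℝ} (hK : LipschitzWith K v)
    (hM : ∀ x, ‖v x‖ ≤ M) (x : E) {T : ℝ} (hT : 0 < T) :
    ∃ γ : ℝ → E, γ 0 = x ∧ ∀ t ∈ Set.Ioo (-T) T, HasDerivAt γ (v (γ t)) t := by
  have hM0 : 0 ≤ M := (norm_nonneg _).trans (hM x)
  have hmem : (0 : ℝ) ∈ Set.Icc (-T) T := ⟨by linarith, hT.le⟩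
  -- The bound `M` is global, so a ball of radius `M * T` contains the curve up to time `T`, and the
  -- time of existence is not restricted.
  have P : IsPicardLindelof (fun _ : ℝ => v) (⟨0, hmem⟩ : Set.Icc (-T) T) x
      (M.toNNReal * T.toNNReal) 0 M.toNNReal K :=
    { lipschitzOnWith := fun _ _ => hK.lipschitzOnWith
      continuousOn := fun _ _ => continuousOn_const
      norm_le := fun _ _ y _ => by simpa [hM0] using hM y
      mul_max_le := by simp [hT.le, hM0] }
  obtain ⟨γ, h0, h⟩ := P.exists_eq_forall_mem_Icc_hasDerivWithinAt₀
  exact ⟨γ, h0, fun t ht => (h t ⟨ht.1.le, ht.2.le⟩).hasDerivAt (Icc_mem_nhds ht.1 ht.2)⟩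

theorem exists_integralCurve {v : E → E} {K : NNReal} {M : ℝ} (hK : LipschitzWith K v)
    (hM : ∀ x, ‖v x‖ ≤ M) (x : E) :
    ∃ γ : ℝ → E, γ 0 = x ∧ ∀ t, HasDerivAt γ (v (γ t)) t := by
  choose γ h0 h using fun T : ℕ =>
    exists_integralCurve_Icc hK hM x (T := (T : ℝ) + 1) (by positivity)
  have hagree : ∀ (m k : ℕ), m ≤ k → ∀ t ∈ Set.Ioo (-((m : ℝ) + 1)) ((m : ℝ) + 1),
      γ m t = γ k t := by
    intro m k hmk
    have hmk' : (m : ℝ) ≤ k := by exact_mod_cast hmk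
    refine ODE_solution_unique_of_mem_Ioo (v := fun _ => v) (s := fun _ => Set.univ) (t₀ := 0)
      (fun _ _ => hK.lipschitzOnWith) ⟨by linarith [m.cast_nonneg (α := ℝ)], by positivity⟩
      (fun t ht => ⟨h m t ht, Set.mem_univ _⟩)
      (fun t ht => ⟨h k t ⟨by linarith [ht.1], by linarith [ht.2]⟩, Set.mem_univ _⟩)
      ((h0 m).trans (h0 k).symm)
  have hmem : ∀ t : ℝ, t ∈ Set.Ioo (-((⌈|t|⌉₊ : ℝ) + 1)) ((⌈|t|⌉₊ : ℝ) + 1) := fun t => by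
    have := Nat.le_ceil |t|
    constructor <;> linarith [neg_abs_le t, le_abs_self t]
  -- At time `t` the curve with index `⌈|t|⌉₊` is used, which is defined beyond `|t|`; by uniqueness
  -- the choice of a larger index is immaterial.
  refine ⟨fun t => γ ⌈|t|⌉₊ t, by simpa using h0 _, fun t => ?_⟩
  refine (h _ t (hmem t)).congr_of_eventuallyEq ?_
  filter_upwards [Ioo_mem_nhds (hmem t).1 (hmem t).2] with s hs
  rcases le_total ⌈|s|⌉₊ ⌈|t|⌉₊ with hle | hle
  · exact hagree _ _ hle s (hmem s)
  · exact (hagree _ _ hle s hs).symm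

/-- Rescaled to `[0, 1]`, the orbit is the unique zero `γ` of `γ - x - τ ∫ v ∘ γ`, a smooth map on
the space of curves. Its derivative in `γ` is `1 - A` with `‖A‖ ≤ |τ| K < 1`, invertible by the
Neumann series, so the orbit depends smoothly on `(τ, x)`. -/
theorem contDiffAt_flow_small {v : E → E} (hv : ContDiff ℝ ∞ v) {K : NNReal}
    (hK : LipschitzWith K v) {Φ : ℝ → E → E} (h0 : ∀ x, Φ 0 x = x)
    (hΦ : ∀ t x, HasDerivAt (fun s => Φ s x) (v (Φ t x)) t) (τ : ℝ) (hτ : |τ| * K < 1) (x : E) :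
    ContDiffAt ℝ ∞ (fun p : ℝ × E => Φ p.1 p.2) (τ, x) := by
  set vc : C(E, E) := ⟨v, hv.continuous⟩ with hvc
  set v' : C(E, E →L[ℝ] E) := ⟨fderiv ℝ v, hv.continuous_fderiv (by simp)⟩ with hv'
  have hcont : ∀ x, Continuous fun s => Φ s x := fun x =>
    continuous_iff_continuousAt.2 fun t => (hΦ t x).continuousAt
  let orbit : ℝ × E → C(I, E) := fun p => ⟨fun t => Φ (p.1 * t) p.2,
    (hcont p.2).comp (continuous_const.mul continuous_subtype_val)⟩
  let Q : (ℝ × E) × C(I, E) → C(I, E) := fun q =>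
    q.2 - ContinuousLinearMap.const ℝ I q.1.2 - q.1.1 • primitive (vc.comp q.2)
  have hQ : ContDiff ℝ ∞ Q := by
    have h1 : ContDiff ℝ ∞ (fun q : (ℝ × E) × C(I, E) => vc.comp q.2) :=
      (contDiff_comp (v := vc) hv).comp contDiff_snd
    have h2 : ContDiff ℝ ∞ (fun q : (ℝ × E) × C(I, E) => primitive (vc.comp q.2)) :=
      (ContinuousLinearMap.contDiff (𝕜 := ℝ) (E := C(I, E)) (F := C(I, E)) primitive).comp h1
    have h3 : ContDiff ℝ ∞ (fun q : (ℝ × E) × C(I, E) =>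
        ContinuousLinearMap.const ℝ I q.1.2) :=
      (ContinuousLinearMap.contDiff (𝕜 := ℝ) (E := E) (F := C(I, E))
        (ContinuousLinearMap.const ℝ I)).comp (contDiff_snd.comp contDiff_fst)
    exact (contDiff_snd.sub h3).sub ((contDiff_fst.comp contDiff_fst).smul h2)
  have horbit : ∀ p, Q (p, orbit p) = 0 := by
    intro p
    ext t
    have hd : ∀ s : ℝ, HasDerivAt (fun s => Φ (p.1 * s) p.2) (p.1 • v (Φ (p.1 * s) p.2)) s := by
      intro s
      have := (hΦ (p.1 * s) p.2).scomp s ((hasDerivAt_id s).const_mul p.1)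
      simpa [Function.comp_def] using this
    have hint := intervalIntegral.integral_eq_sub_of_hasDerivAt (a := 0) (b := (t : ℝ))
      (fun s _ => hd s) (((hv.continuous.comp ((hcont p.2).comp
        (continuous_const.mul continuous_id))).const_smul p.1).intervalIntegrable _ _)
    have hcongr : ∫ s in (0 : ℝ)..t, Set.IccExtend zero_le_one (vc.comp (orbit p)) s
        = ∫ s in (0 : ℝ)..t, v (Φ (p.1 * s) p.2) := by
      refine intervalIntegral.integral_congr fun s hs => ?_
      rw [Set.uIcc_of_le t.2.1] at hs
      have hs' : s ∈ Set.Icc (0 : ℝ) 1 := ⟨hs.1, hs.2.trans t.2.2⟩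
      simp only [Set.IccExtend_of_mem _ _ hs']
      rfl
    simp only [intervalIntegral.integral_smul, mul_zero, h0] at hint
    change Φ (p.1 * t) p.2 - p.2 - p.1 • primitive (vc.comp (orbit p)) t = 0
    rw [primitive_apply, hcongr, hint]
    simp
  -- Global uniqueness of zeros identifies the implicit function with the orbit, without any a
  -- priori closeness.
  have hunique : ∀ p γ, Q (p, γ) = 0 → γ = orbit p := by
    intro p γ hγ
    have hγt : ∀ t : I, γ t = p.2 + p.1 • ∫ s in (0 : ℝ)..t,
        Set.IccExtend zero_le_one (vc.comp γ) s := by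
      intro t
      have : γ t - p.2 - p.1 • primitive (vc.comp γ) t = 0 := congrArg (fun γ => γ t) hγ
      rw [primitive_apply, sub_sub, sub_eq_zero] at this
      exact this
    set g : ℝ → E := fun s => p.2 + p.1 • ∫ s in (0 : ℝ)..s,
        Set.IccExtend zero_le_one (vc.comp γ) s with hg
    have hgd : ∀ s, HasDerivAt g (p.1 • Set.IccExtend zero_le_one (vc.comp γ) s) s := by
      intro s
      have hc : Continuous (Set.IccExtend zero_le_one (vc.comp γ)) :=
        (vc.comp γ).continuous.Icc_extend'
      exact ((hc.integral_hasStrictDerivAt 0 s).hasDerivAt.const_smul p.1).const_add _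
    have hd : ∀ s : ℝ, HasDerivAt (fun s => Φ (p.1 * s) p.2) (p.1 • v (Φ (p.1 * s) p.2)) s := by
      intro s
      have := (hΦ (p.1 * s) p.2).scomp s ((hasDerivAt_id s).const_mul p.1)
      simpa [Function.comp_def] using this
    have hL : LipschitzWith (‖p.1‖₊ * K) fun y => p.1 • v y :=
      (lipschitzWith_smul p.1).comp hK
    have hE := ODE_solution_unique_of_mem_Icc_right (v := fun _ y => p.1 • v y)
      (s := fun _ => Set.univ) (K := ‖p.1‖₊ * K) (f := g) (g := fun s => Φ (p.1 * s) p.2)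
      (a := 0) (b := 1) (fun _ _ => hL.lipschitzOnWith)
      (fun s _ => (hgd s).continuousAt.continuousWithinAt)
      (fun s hs => by
        have hs' : s ∈ Set.Icc (0 : ℝ) 1 := ⟨hs.1, hs.2.le⟩
        have := (hgd s).hasDerivWithinAt (s := Set.Ici s)
        rw [Set.IccExtend_of_mem _ _ hs'] at this
        have e : g s = γ ⟨s, hs'⟩ := (hγt ⟨s, hs'⟩).symm
        rw [e]
        exact this)
      (fun _ _ => Set.mem_univ _)
      (fun s _ => (hd s).continuousAt.continuousWithinAt)
      (fun s _ => (hd s).hasDerivWithinAt) (fun _ _ => Set.mem_univ _)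
      (by simp [hg, h0])
    ext t
    rw [hγt t]
    exact hE t.2
  set p₀ : ℝ × E := (τ, x)
  set A : C(I, E) →L[ℝ] C(I, E) := τ • primitive.comp (pointwiseApply (v'.comp (orbit p₀))) with hA
  have hAn : ‖A‖ < 1 := by
    refine lt_of_le_of_lt (ContinuousLinearMap.opNorm_le_bound _ (by positivity) fun η => ?_) hτ
    change ‖τ • primitive (pointwiseApply (v'.comp (orbit p₀)) η)‖ ≤ _
    rw [norm_smul, Real.norm_eq_abs, mul_assoc]
    refine mul_le_mul_of_nonneg_left ?_ (abs_nonneg _)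
    refine (norm_primitive_apply_le _).trans
      ((ContinuousMap.norm_le _ (by positivity)).2 fun t => ?_)
    exact ((v'.comp (orbit p₀) t).le_opNorm (η t)).trans
      (mul_le_mul (norm_fderiv_le_of_lipschitz ℝ hK) (η.norm_coe_le_norm t) (norm_nonneg _) K.2)
  have hfd : HasFDerivAt (fun γ => Q (p₀, γ)) (1 - A) (orbit p₀) := by
    have h1 := hasFDerivAt_comp (v := vc) (v' := v')
      (fun y => (hv.differentiable (by simp) y).hasFDerivAt) (orbit p₀)
    have h2 := ((ContinuousLinearMap.hasFDerivAt (𝕜 := ℝ) (E := C(I, E)) (F := C(I, E))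
      primitive).comp (orbit p₀) h1).const_smul τ
    exact ((hasFDerivAt_id (orbit p₀)).sub_const (ContinuousLinearMap.const ℝ I x)).sub h2
  have hinv : (fderiv ℝ Q (p₀, orbit p₀) ∘L
      ContinuousLinearMap.inr ℝ (ℝ × E) C(I, E)).IsInvertible := by
    have h1 : HasFDerivAt (fun γ => Q (p₀, γ)) (fderiv ℝ Q (p₀, orbit p₀) ∘L
        ContinuousLinearMap.inr ℝ (ℝ × E) C(I, E)) (orbit p₀) :=
      (hQ.differentiable (by simp) (p₀, orbit p₀)).hasFDerivAt.comp (orbit p₀)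
        (hasFDerivAt_prodMk_right p₀ (orbit p₀))
    rw [h1.unique hfd]
    exact ⟨ContinuousLinearEquiv.unitsEquiv ℝ _ (Units.oneSub A hAn), rfl⟩
  have hQ' : ContDiffAt ℝ ∞ Q (p₀, orbit p₀) := hQ.contDiffAt
  have hψ := hQ'.contDiffAt_implicitFunction (by simp) hinv
  have hev := hQ'.eventually_apply_implicitFunction (by simp) hinv
  have hor : ContDiffAt ℝ ∞ orbit p₀ := by
    refine hψ.congr_of_eventuallyEq ?_
    filter_upwards [hev] with p hp
    rw [horbit p₀] at hp
    exact (hunique p _ hp).symm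
  have heval : ContDiffAt ℝ ∞ (fun p => orbit p 1) p₀ :=
    (ContinuousLinearMap.contDiff (𝕜 := ℝ) (E := C(I, E)) (F := E)
      (ContinuousMap.evalCLM ℝ (1 : I))).contDiffAt.comp p₀ hor
  refine heval.congr_of_eventuallyEq (Filter.Eventually.of_forall fun p => ?_)
  change Φ p.1 p.2 = Φ (p.1 * ((1 : I) : ℝ)) p.2
  simp

/-- A smooth bounded Lipschitz vector field has a smooth global flow. -/
theorem exists_isFlow {v : E → E} (hv : ContDiff ℝ ∞ v) {K : NNReal} {M : ℝ}
    (hK : LipschitzWith K v) (hM : ∀ x, ‖v x‖ ≤ M) : ∃ Φ : ℝ → E → E, IsFlow v Φ := by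
  choose Φ' h0 h using exists_integralCurve hK hM
  have huniq : ∀ γ : ℝ → E, (∀ t, HasDerivAt γ (v (γ t)) t) → ∀ t, γ t = Φ' (γ 0) t := by
    intro γ hγ t
    have := ODE_solution_unique_univ (v := fun _ => v) (s := fun _ => Set.univ) (t₀ := 0)
      (fun _ => hK.lipschitzOnWith) (fun t => ⟨hγ t, Set.mem_univ _⟩)
      (fun t => ⟨h (γ 0) t, Set.mem_univ _⟩) (h0 (γ 0)).symm
    exact congrFun this t
  have hadd : ∀ s t x, Φ' x (s + t) = Φ' (Φ' x t) s := by
    intro s t x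
    have := huniq (fun s => Φ' x (s + t)) (fun s => (h x (s + t)).comp_add_const s t) s
    simpa using this
  refine ⟨fun t x => Φ' x t, ?_, h0, fun t x => h x t, huniq⟩
  have hsmall := contDiffAt_flow_small hv hK (Φ := fun t x => Φ' x t) h0 (fun t x => h x t)
  -- An arbitrary time `t` is reached by `m` steps of length `t / m`, each short enough for the
  -- local result.
  have hiter : ∀ (m : ℕ) (τ : ℝ) (x : E), |τ| * K < 1 →
      ContDiffAt ℝ ∞ (fun p : ℝ × E => Φ' p.2 (m * p.1)) (τ, x) := by
    intro m
    induction m with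
    | zero =>
      intro τ x _
      simp only [Nat.cast_zero, zero_mul, h0]
      exact contDiffAt_snd
    | succ m ih =>
      intro τ x hτ
      have : (fun p : ℝ × E => Φ' p.2 ((m + 1 : ℕ) * p.1))
          = (fun p : ℝ × E => Φ' p.2 p.1) ∘ fun p : ℝ × E => (p.1, Φ' p.2 (m * p.1)) := by
        funext p
        simp only [Function.comp]
        rw [← hadd]
        congr 1
        push_cast
        ring
      rw [this]
      exact ContDiffAt.comp (τ, x) (hsmall τ hτ _) (contDiffAt_fst.prodMk (ih τ x hτ))
  rw [contDiff_iff_contDiffAt]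
  rintro ⟨t, x⟩
  obtain ⟨m, hm⟩ := exists_nat_gt (|t| * K)
  have hm0 : 0 < (m : ℝ) := lt_of_le_of_lt (by positivity) hm
  have hlin : ContDiff ℝ ∞ (fun p : ℝ × E => (p.1 / (m : ℝ), p.2)) :=
    (contDiff_fst.div_const _).prodMk contDiff_snd
  have h1 : |t / m| * K < 1 := by
    rw [abs_div, abs_of_pos hm0, div_mul_eq_mul_div, div_lt_one hm0]
    exact hm
  have := ContDiffAt.comp (t, x) (hiter m (t / m) x h1) hlin.contDiffAt
  refine this.congr_of_eventuallyEq (Filter.Eventually.of_forall fun p => ?_)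
  simp only [Function.comp]
  rw [mul_div_cancel₀ _ hm0.ne']

end Existence

end SmoothFlow

namespace SmoothFlow

variable {E F : Type} [NormedAddCommGroup E] [NormedSpace ℝ E] [NormedAddCommGroup F]
  [NormedSpace ℝ F]

/-! ### Elementary properties of flows -/

namespace IsFlow

variable {v : E → E} {Φ : ℝ → E → E} (h : IsFlow v Φ)
include h

theorem add (s t : ℝ) (x : E) : Φ (s + t) x = Φ s (Φ t x) := by
  have := h.unique (fun s => Φ (s + t) x) (fun s => (h.hasDerivAt (s + t) x).comp_add_const s t) s
  simpa using this

theorem neg_apply (t : ℝ) (x : E) : Φ (-t) (Φ t x) = x := by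
  rw [← h.add, neg_add_cancel, h.zero]

theorem apply_neg (t : ℝ) (x : E) : Φ t (Φ (-t) x) = x := by
  rw [← h.add, add_neg_cancel, h.zero]

theorem eq_self_of_eq_zero {x : E} (hx : v x = 0) (t : ℝ) : Φ t x = x :=
  (h.unique (fun _ => x) (fun t => by simpa [hx] using hasDerivAt_const t x) t).symm

theorem contDiff_apply (t : ℝ) : ContDiff ℝ ∞ (Φ t) :=
  h.smooth.comp (contDiff_const.prodMk contDiff_id)

theorem continuous_left (x : E) : Continuous fun t => Φ t x :=
  continuous_iff_continuousAt.2 fun t => (h.hasDerivAt t x).continuousAt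

end IsFlow

/-! ### Cutoffs -/

theorem contDiff_smul_of_tsupport_subset {ξ : E → ℝ} {g : E → F} {O : Set E} (hO : IsOpen O)
    (hξ : ContDiff ℝ ∞ ξ) (hs : tsupport ξ ⊆ O) (hg : ContDiffOn ℝ ∞ g O) :
    ContDiff ℝ ∞ fun x => ξ x • g x := by
  rw [contDiff_iff_contDiffAt]
  intro x
  by_cases hx : x ∈ tsupport ξ
  · exact hξ.contDiffAt.smul (hg.contDiffAt (hO.mem_nhds (hs hx)))
  · refine contDiffAt_const (c := (0 : F)) |>.congr_of_eventuallyEq ?_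
    filter_upwards [(isClosed_tsupport ξ).isOpen_compl.mem_nhds hx] with y hy
    rw [image_eq_zero_of_notMem_tsupport hy, zero_smul]

theorem exists_cutoff [FiniteDimensional ℝ E] {K O : Set E} (hK : IsCompact K) (hO : IsOpen O)
    (hKO : K ⊆ O) : ∃ ξ : E → ℝ, ContDiff ℝ ∞ ξ ∧ HasCompactSupport ξ ∧ tsupport ξ ⊆ O ∧
      (∀ x ∈ K, ∀ᶠ y in 𝓝 x, ξ y = 1) ∧ ∀ x, ξ x ∈ Set.Icc (0 : ℝ) 1 := by
  obtain ⟨K', hK', hKK', hK'O⟩ := exists_compact_between hK hO hKO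
  obtain ⟨f, h1, h0, h01⟩ := exists_contMDiffMap_one_nhds_of_subset_interior (n := ⊤) 𝓘(ℝ, E)
    hK.isClosed hKK'
  have hsub : tsupport f ⊆ K' := closure_minimal
    (fun x hx => by_contra fun hx' => hx (h0 x hx')) hK'.isClosed
  exact ⟨f, f.contMDiff.contDiff, hK'.of_isClosed_subset (isClosed_tsupport _) hsub,
    hsub.trans hK'O, fun x hx => Filter.eventually_iff_exists_mem.2
      ((Filter.eventually_iff_exists_mem.1 h1).imp fun s hs =>
        ⟨nhds_le_nhdsSet hx hs.1, hs.2⟩), h01⟩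

/-- A vector field has a smooth global flow if, up to a constant, it is a compactly supported
function of a linear image of the point. -/
theorem exists_isFlow_const_add [CompleteSpace E] (T : E →L[ℝ] F) {w : F → E}
    (hw : ContDiff ℝ ∞ w) (hc : HasCompactSupport w) (c : E) :
    ∃ Φ : ℝ → E → E, IsFlow (fun x => c + w (T x)) Φ := by
  obtain ⟨K, hK⟩ := hw.lipschitzWith_of_hasCompactSupport hc (by simp)
  obtain ⟨M, hM⟩ := hc.exists_bound_of_continuous hw.continuous
  refine exists_isFlow (contDiff_const.add (hw.comp T.contDiff)) (K := 0 + K * ‖T‖₊)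
    (M := ‖c‖ + M) ((LipschitzWith.const c).add (hK.comp T.lipschitz))
    fun x => (norm_add_le _ _).trans (by gcongr; exact hM _)

theorem exists_isFlow_of_hasCompactSupport [CompleteSpace E] {w : E → E} (hw : ContDiff ℝ ∞ w)
    (hc : HasCompactSupport w) : ∃ Φ : ℝ → E → E, IsFlow w Φ := by
  simpa using exists_isFlow_const_add (ContinuousLinearMap.id ℝ E) hw hc 0

/-! ### Calculus in one variable -/

theorem hasDerivAt_prod_fst {γ : ℝ → E × F} {γ' : E × F} {t : ℝ} (h : HasDerivAt γ γ' t) :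
    HasDerivAt (fun t => (γ t).1) γ'.1 t :=
  (ContinuousLinearMap.fst ℝ E F).hasFDerivAt.comp_hasDerivAt t h

theorem hasDerivAt_prod_snd {γ : ℝ → E × F} {γ' : E × F} {t : ℝ} (h : HasDerivAt γ γ' t) :
    HasDerivAt (fun t => (γ t).2) γ'.2 t :=
  (ContinuousLinearMap.snd ℝ E F).hasFDerivAt.comp_hasDerivAt t h

/-- The derivative in `x` of a function of `(t, x)`, as a function of `t`. -/
theorem hasDerivAt_fderiv_apply {Q : ℝ → E → F} {W : ℝ → E → F}
    (hQ : ContDiff ℝ ∞ fun p : ℝ × E => Q p.1 p.2)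
    (hW : ∀ t x, HasDerivAt (fun t => Q t x) (W t x) t) (t : ℝ) (x w : E) :
    HasDerivAt (fun t => fderiv ℝ (Q t) x w) (fderiv ℝ (W t) x w) t := by
  set q : ℝ × E → F := fun p => Q p.1 p.2
  have hq : Differentiable ℝ q := hQ.differentiable (by simp)
  have hq' : Differentiable ℝ (fderiv ℝ q) :=
    (hQ.fderiv_right (m := ∞) (by simp)).differentiable (by simp)
  have e1 : ∀ s y, fderiv ℝ (Q s) y w = fderiv ℝ q (s, y) (0, w) := fun s y => by
    have : HasFDerivAt (Q s) _ y := (hq (s, y)).hasFDerivAt.comp y (hasFDerivAt_prodMk_right s y)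
    rw [this.fderiv]
    simp
  have e2 : ∀ s y, W s y = fderiv ℝ q (s, y) (1, 0) := fun s y => by
    have : HasDerivAt (fun t => Q t y) (fderiv ℝ q (s, y) (1, 0)) s :=
      HasFDerivAt.comp_hasDerivAt (f := fun t => (t, y)) s (hq (s, y)).hasFDerivAt
      ((hasDerivAt_id s).prodMk (hasDerivAt_const s y))
    exact (hW s y).unique this
  have e3 : fderiv ℝ (W t) x w = fderiv ℝ (fderiv ℝ q) (t, x) (0, w) (1, 0) := by
    have : HasFDerivAt (fun y => fderiv ℝ q (t, y) (1, 0)) _ x :=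
      ((hq' (t, x)).hasFDerivAt.comp x (hasFDerivAt_prodMk_right t x)).clm_apply
        (hasFDerivAt_const _ x)
    rw [show W t = fun y => fderiv ℝ q (t, y) (1, 0) from funext (e2 t), this.fderiv]
    simp
  have e4 : HasDerivAt (fun s => fderiv ℝ q (s, x) (0, w))
      (fderiv ℝ (fderiv ℝ q) (t, x) (1, 0) (0, w)) t := by
    have h1 : HasDerivAt (fun s => fderiv ℝ q (s, x)) _ t :=
      (hq' (t, x)).hasFDerivAt.comp_hasDerivAt t
        ((hasDerivAt_id t).prodMk (hasDerivAt_const t x))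
    simpa using h1.clm_apply (hasDerivAt_const t ((0, w) : ℝ × E))
  -- The derivatives in `t` and in `x` commute by symmetry of the second derivative.
  have hsymm : IsSymmSndFDerivAt ℝ q (t, x) :=
    hQ.contDiffAt.isSymmSndFDerivAt (by simpa using ENat.LEInfty.out)
  rw [e3, hsymm.eq]
  simpa only [e1] using e4

/-- The zero set in `[0, 1]` is closed, and it is open to the right since `u` is constant near each
zero. This serves for flows of cut off fields, which are controlled only near the level set they are
to preserve. -/
theorem eq_zero_of_locally_const {u u' : ℝ → F} (hu : ∀ t, HasDerivAt u (u' t) t) (h0 : u 0 = 0)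
    (h : ∀ t ∈ Set.Icc (0 : ℝ) 1, u t = 0 → ∀ᶠ s in 𝓝 t, u' s = 0) :
    ∀ t ∈ Set.Icc (0 : ℝ) 1, u t = 0 := by
  have hcont : Continuous u := continuous_iff_continuousAt.2 fun t => (hu t).continuousAt
  have : Set.Icc (0 : ℝ) 1 ⊆ {t | u t = 0} := by
    refine IsClosed.Icc_subset_of_forall_mem_nhdsWithin
      ((isClosed_singleton.preimage hcont).inter isClosed_Icc) h0 fun t ht => ?_
    refine mem_nhdsWithin_of_mem_nhds ?_
    obtain ⟨r, hr, hball⟩ := Metric.eventually_nhds_iff_ball.1 (h t ⟨ht.2.1, ht.2.2.le⟩ ht.1)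
    filter_upwards [Metric.ball_mem_nhds t hr] with s hs
    have := (Metric.isOpen_ball (x := t) (ε := r)).is_const_of_deriv_eq_zero
      (convex_ball t r).isPreconnected (fun x _ => (hu x).differentiableAt.differentiableWithinAt)
      (fun x hx => by simpa [(hu x).deriv] using hball x hx) hs (Metric.mem_ball_self hr)
    exact this.trans ht.1
  exact this

/-- The level `c` is a barrier: `y` cannot cross it downwards, so the sign condition on `y'` holds
for all positive times. -/
theorem lt_of_deriv_pos_above {y y' : ℝ → ℝ} {c : ℝ} (hy : ∀ t, HasDerivAt y (y' t) t)
    (h0 : c ≤ y 0) (h : ∀ t, 0 ≤ t → c ≤ y t → 0 < y' t) {t : ℝ} (ht : 0 < t) : y 0 < y t := by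
  have hcont : Continuous y := continuous_iff_continuousAt.2 fun t => (hy t).continuousAt
  have hge : ∀ s ∈ Set.Icc 0 t, c ≤ y s := by
    intro s hs
    have := image_le_of_deriv_right_lt_deriv_boundary' (f := fun s => -y s) (f' := fun s => -y' s)
      (B := fun _ => -c) (B' := fun _ => 0) (a := 0) (b := t) hcont.neg.continuousOn
      (fun s _ => (hy s).neg.hasDerivWithinAt) (neg_le_neg h0) continuousOn_const
      (fun s _ => hasDerivWithinAt_const _ _ _)
      (fun s hs hs' => by
        have := h s hs.1 (neg_le_neg_iff.1 hs'.le)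
        simpa using this) hs
    exact neg_le_neg_iff.1 this
  have := strictMonoOn_of_deriv_pos (convex_Icc 0 t) hcont.continuousOn (fun s hs => by
    rw [interior_Icc] at hs
    rw [(hy s).deriv]
    exact h s hs.1.le (hge s ⟨hs.1.le, hs.2.le⟩))
  exact this ⟨le_rfl, ht.le⟩ ⟨ht.le, le_rfl⟩ ht

theorem eq_exp_mul_of_deriv_eq_self {q : ℝ → ℝ} (hq : ∀ t, HasDerivAt q (q t) t) (t : ℝ) :
    q t = Real.exp t * q 0 := by
  have h : ∀ t, HasDerivAt (fun t => Real.exp (-t) * q t) 0 t := fun t => by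
    have := ((Real.hasDerivAt_exp (-t)).comp t (hasDerivAt_neg t)).mul (hq t)
    convert! this using 1
    simp
  have hc := is_const_of_deriv_eq_zero (fun t => (h t).differentiableAt) (fun t => (h t).deriv) t 0
  simp only [neg_zero, Real.exp_zero, one_mul] at hc
  rw [← hc, ← mul_assoc, ← Real.exp_add]
  simp

end SmoothFlow

/-! ### Kernels of real-linear maps to `ℂ`: symplectic complements and Liouville vectors. -/

namespace MilnorFibers

variable {n : ℕ}

/-! ### Symplectic linear algebra -/

/-- The standard symplectic form as a continuous bilinear map. -/
def omega : Cn n →L[ℝ] Cn n →L[ℝ] ℝ :=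
  LinearMap.mkContinuous₂ (LinearMap.mk₂ ℝ (stdSymplectic (n := n))
    (fun _ _ _ => by simp [stdSymplectic])
    (fun c v w => by
      rw [stdSymplectic, stdSymplectic, ← Complex.coe_smul, inner_smul_left]
      simp)
    (fun _ _ _ => by simp [stdSymplectic])
    (fun c v w => by
      rw [stdSymplectic, stdSymplectic, ← Complex.coe_smul, inner_smul_right]
      simp)) 1 (fun v w => by
    rw [one_mul]
    exact (Complex.abs_im_le_norm _).trans (norm_inner_le_norm v w))

theorem omega_apply (v w : Cn n) : omega v w = stdSymplectic v w := rfl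

theorem stdPrimitive_eq_omega (z v : Cn n) : stdPrimitive z v = omega z v / 2 := rfl

theorem omega_antisymm (v w : Cn n) : omega v w = -omega w v := by
  simp only [omega_apply, stdSymplectic]
  rw [← inner_conj_symm, Complex.conj_im]

theorem omega_self (v : Cn n) : omega v v = 0 := by
  have := omega_antisymm v v
  linarith

theorem omega_I_smul (v w : Cn n) : omega v (Complex.I • w) = (inner ℂ v w).re := by
  simp [omega_apply, stdSymplectic]

theorem eq_zero_of_omega_eq_zero {v : Cn n} (h : ∀ w, omega v w = 0) : v = 0 := by
  have := h (Complex.I • v)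
  rw [omega_I_smul] at this
  rw [← norm_eq_zero, ← sq_eq_zero_iff, ← inner_self_eq_norm_sq (𝕜 := ℂ)]
  exact this

/-- The vector representing a real linear form with respect to the symplectic form. -/
def dualVec : (Cn n →L[ℝ] ℝ) →L[ℝ] Cn n :=
  LinearMap.toContinuousLinearMap
    { toFun := fun l => WithLp.toLp 2 fun k =>
        (l (EuclideanSpace.single k Complex.I) : ℂ)
          - Complex.I * (l (EuclideanSpace.single k 1) : ℂ)
      map_add' := fun l m => by
        ext k
        simp
        ring
      map_smul' := fun c l => by
        ext k
        simp
        ring }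

theorem dualVec_apply (l : Cn n →L[ℝ] ℝ) (k : Fin (n + 1)) :
    dualVec l k = (l (EuclideanSpace.single k Complex.I) : ℂ)
          - Complex.I * (l (EuclideanSpace.single k 1) : ℂ) := rfl

theorem sum_single_re_im (v : Cn n) : v = ∑ k, ((v k).re • EuclideanSpace.single k (1 : ℂ)
    + (v k).im • EuclideanSpace.single k Complex.I) := by
  ext j
  simp only [WithLp.ofLp_sum, Finset.sum_apply, PiLp.add_apply, PiLp.smul_apply,
    PiLp.single_apply]
  rw [Finset.sum_eq_single j (fun b _ hb => by simp [hb.symm]) (by simp)]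
  simp

theorem omega_dualVec (l : Cn n →L[ℝ] ℝ) (v : Cn n) : omega (dualVec l) v = l v := by
  conv_rhs => rw [sum_single_re_im v]
  rw [omega_apply, stdSymplectic_eq, map_sum]
  refine Finset.sum_congr rfl fun k _ => ?_
  rw [dualVec_apply, map_add, map_smul, map_smul]
  simp
  ring

/-- The vector dual to the real part of `L`. -/
def dualRe : (Cn n →L[ℝ] ℂ) →L[ℝ] Cn n :=
  dualVec.comp (ContinuousLinearMap.compL ℝ (Cn n) ℂ ℝ Complex.reCLM)

/-- The vector dual to the imaginary part of `L`. -/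
def dualIm : (Cn n →L[ℝ] ℂ) →L[ℝ] Cn n :=
  dualVec.comp (ContinuousLinearMap.compL ℝ (Cn n) ℂ ℝ Complex.imCLM)

theorem omega_dualRe (L : Cn n →L[ℝ] ℂ) (v : Cn n) : omega (dualRe L) v = (L v).re :=
  omega_dualVec _ _

theorem omega_dualIm (L : Cn n →L[ℝ] ℂ) (v : Cn n) : omega (dualIm L) v = (L v).im :=
  omega_dualVec _ _

/-- The number whose nonvanishing expresses that `L` is onto with symplectic kernel. -/
def pfaffian (L : Cn n →L[ℝ] ℂ) : ℝ := omega (dualRe L) (dualIm L)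

/-- The right inverse of `L` with values in the symplectic complement of its kernel. -/
def lift (L : Cn n →L[ℝ] ℂ) (w : ℂ) : Cn n :=
  (pfaffian L)⁻¹ • (w.re • dualIm L - w.im • dualRe L)

@[simp] theorem lift_zero (L : Cn n →L[ℝ] ℂ) : lift L 0 = 0 := by simp [lift]

/-- The symplectic complement of the kernel is spanned by `dualRe L` and `dualIm L`. On it `L` is
read off from the values of `omega` on these two vectors, of which only `pfaffian L` can be nonzero
up to sign. -/
theorem apply_lift {L : Cn n →L[ℝ] ℂ} (h : pfaffian L ≠ 0) (w : ℂ) : L (lift L w) = w := by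
  have h1 : (L (dualIm L)).re = pfaffian L := (omega_dualRe L _).symm
  have h2 : (L (dualRe L)).im = -pfaffian L := by
    rw [← omega_dualIm, omega_antisymm, pfaffian]
  have h3 : (L (dualRe L)).re = 0 := by rw [← omega_dualRe, omega_self]
  have h4 : (L (dualIm L)).im = 0 := by rw [← omega_dualIm, omega_self]
  apply Complex.ext
  · simp [lift, h1, h3]
    field_simp
  · simp [lift, h2, h4]
    field_simp

theorem omega_lift {L : Cn n →L[ℝ] ℂ} {v : Cn n} (hv : L v = 0) (w : ℂ) :
    omega (lift L w) v = 0 := by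
  have h1 : omega (dualRe L) v = 0 := by rw [omega_dualRe, hv, Complex.zero_re]
  have h2 : omega (dualIm L) v = 0 := by rw [omega_dualIm, hv, Complex.zero_im]
  simp only [lift, map_smul, map_sub, smul_apply,
    sub_apply, h1, h2]
  simp

theorem surjective_of_pfaffian {L : Cn n →L[ℝ] ℂ} (h : pfaffian L ≠ 0) :
    Function.Surjective L := fun w => ⟨lift L w, apply_lift h w⟩

/-- Each `u` splits into `u - lift L (L u)`, in the kernel, and `lift L (L u)`, in its symplectic
complement. Hence `v` is orthogonal to everything. -/
theorem eq_zero_of_omega_ker {L : Cn n →L[ℝ] ℂ} (h : pfaffian L ≠ 0) {v : Cn n} (hv : L v = 0)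
    (hw : ∀ w, L w = 0 → omega v w = 0) : v = 0 := by
  refine eq_zero_of_omega_eq_zero fun u => ?_
  have h1 := hw (u - lift L (L u)) (by rw [map_sub, apply_lift h, sub_self])
  rw [map_sub, omega_antisymm v (lift L (L u)), omega_lift hv] at h1
  simpa using h1

/-- The Liouville vector at `z` of the kernel of `L`. -/
def liouville (z : Cn n) (L : Cn n →L[ℝ] ℂ) : Cn n := (1 / 2 : ℝ) • (z - lift L (L z))

theorem apply_liouville (z : Cn n) {L : Cn n →L[ℝ] ℂ} (h : pfaffian L ≠ 0) :
    L (liouville z L) = 0 := by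
  rw [liouville, map_smul, map_sub, apply_lift h, sub_self, smul_zero]

theorem omega_liouville (z : Cn n) {L : Cn n →L[ℝ] ℂ} {w : Cn n} (hw : L w = 0) :
    omega (liouville z L) w = stdPrimitive z w := by
  rw [liouville, map_smul, map_sub, smul_apply, sub_apply,
    omega_lift hw, stdPrimitive_eq_omega, sub_zero, smul_eq_mul]
  ring

theorem stdPrimitive_liouville (z : Cn n) {L : Cn n →L[ℝ] ℂ} (h : pfaffian L ≠ 0) :
    stdPrimitive z (liouville z L) = 0 := by
  rw [← omega_liouville z (apply_liouville z h), omega_self]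

theorem eq_liouville {z X : Cn n} {L : Cn n →L[ℝ] ℂ} (h : pfaffian L ≠ 0) (hX : L X = 0)
    (hw : ∀ w, L w = 0 → omega X w = stdPrimitive z w) : X = liouville z L := by
  rw [← sub_eq_zero]
  refine eq_zero_of_omega_ker h (by rw [map_sub, hX, apply_liouville z h, sub_self]) fun w hw' => ?_
  rw [map_sub, sub_apply, hw w hw', omega_liouville z hw', sub_self]

/-- The radial component of the Liouville vector. -/
def radial (z : Cn n) (L : Cn n →L[ℝ] ℂ) : ℝ := (inner ℂ z (liouville z L)).re

/-- For complex-linear maps the pfaffian is a sum of squares, so it is nonzero as soon as `L` is: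
smooth points of complex hypersurfaces are symplectic. -/
theorem pfaffian_complex (L : Cn n →L[ℂ] ℂ) :
    pfaffian (L.restrictScalars ℝ) = ∑ k, ‖L (EuclideanSpace.single k 1)‖ ^ 2 := by
  have hI : ∀ k, L (EuclideanSpace.single k Complex.I)
      = Complex.I * L (EuclideanSpace.single k 1) := fun k => by
    rw [← smul_eq_mul, ← map_smul]
    congr 1
    ext j
    simp
  rw [pfaffian, omega_apply, stdSymplectic_eq]
  refine Finset.sum_congr rfl fun k _ => ?_
  simp only [dualRe, dualIm, ContinuousLinearMap.comp_apply, dualVec_apply,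
    ContinuousLinearMap.compL_apply, ContinuousLinearMap.coe_restrictScalars', hI]
  rw [← Complex.normSq_eq_norm_sq, Complex.normSq_apply]
  simp
  ring

theorem pfaffian_complex_ne_zero {L : Cn n →L[ℂ] ℂ} {k : Fin (n + 1)}
    (h : L (EuclideanSpace.single k 1) ≠ 0) : pfaffian (L.restrictScalars ℝ) ≠ 0 := by
  rw [pfaffian_complex]
  refine (Finset.sum_pos' (fun _ _ => by positivity) ⟨k, Finset.mem_univ k, ?_⟩).ne'
  have := norm_pos_iff.2 h
  positivity

/-- The kernel is stable under multiplication by `i`, so the defining property of the Liouville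
vector `X` says that `X` is half the orthogonal projection of `z`. Then `Re ⟨z, X⟩ = 2 |X|²`, and `X
≠ 0` because `z` is not orthogonal to `v`. -/
theorem radial_complex_pos {L : Cn n →L[ℂ] ℂ} (h : pfaffian (L.restrictScalars ℝ) ≠ 0)
    {z v : Cn n} (hv : L v = 0) (hzv : (inner ℂ z v).re ≠ 0) :
    0 < radial z (L.restrictScalars ℝ) := by
  set X := liouville z (L.restrictScalars ℝ) with hX
  have key : ∀ w, L w = 0 → (inner ℂ X w).re = (inner ℂ z w).re / 2 := fun w hw => by
    have := omega_liouville z (L := L.restrictScalars ℝ) (w := Complex.I • w)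
      (by simp [hw])
    rwa [omega_I_smul, stdPrimitive_eq_omega, omega_I_smul] at this
  have h1 := key X (apply_liouville z h)
  have h2 : X ≠ 0 := by
    intro h0
    have := key v hv
    rw [h0, inner_zero_left, Complex.zero_re] at this
    exact hzv (by linarith)
  have h3 : (inner ℂ X X).re = ‖X‖ ^ 2 := inner_self_eq_norm_sq (𝕜 := ℂ) X
  have h4 := norm_pos_iff.2 h2
  rw [radial, ← hX]
  nlinarith

/-! ### Smoothness -/

theorem contDiff_pfaffian : ContDiff ℝ ∞ (pfaffian (n := n)) :=
  (omega.contDiff.comp dualRe.contDiff).clm_apply dualIm.contDiff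

theorem isOpen_pfaffian_ne_zero : IsOpen {L : Cn n →L[ℝ] ℂ | pfaffian L ≠ 0} :=
  isOpen_ne_fun contDiff_pfaffian.continuous continuous_const

theorem contDiffAt_lift {L : Cn n →L[ℝ] ℂ} (h : pfaffian L ≠ 0) (w : ℂ) :
    ContDiffAt ℝ ∞ (fun p : (Cn n →L[ℝ] ℂ) × ℂ => lift p.1 p.2) (L, w) := by
  have h1 : ContDiffAt ℝ ∞ (fun p : (Cn n →L[ℝ] ℂ) × ℂ => (pfaffian p.1)⁻¹) (L, w) :=
    (contDiff_pfaffian.contDiffAt.comp (L, w) contDiffAt_fst).inv h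
  have h2 : ContDiff ℝ ∞ (fun p : (Cn n →L[ℝ] ℂ) × ℂ =>
      p.2.re • dualIm p.1 - p.2.im • dualRe p.1) :=
    ((Complex.reCLM.contDiff.comp contDiff_snd).smul (dualIm.contDiff.comp contDiff_fst)).sub
      ((Complex.imCLM.contDiff.comp contDiff_snd).smul (dualRe.contDiff.comp contDiff_fst))
  exact h1.smul h2.contDiffAt

theorem contDiffAt_liouville (z : Cn n) {L : Cn n →L[ℝ] ℂ} (h : pfaffian L ≠ 0) :
    ContDiffAt ℝ ∞ (fun p : Cn n × (Cn n →L[ℝ] ℂ) => liouville p.1 p.2) (z, L) := by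
  have h1 : ContDiff ℝ ∞ (fun p : Cn n × (Cn n →L[ℝ] ℂ) => (p.2, p.2 p.1)) :=
    contDiff_snd.prodMk (contDiff_snd.clm_apply contDiff_fst)
  have h2 := ContDiffAt.comp (z, L) (contDiffAt_lift h (L z)) h1.contDiffAt
  exact (contDiffAt_fst.sub h2).const_smul (1 / 2 : ℝ)

theorem contDiffAt_radial (z : Cn n) {L : Cn n →L[ℝ] ℂ} (h : pfaffian L ≠ 0) :
    ContDiffAt ℝ ∞ (fun p : Cn n × (Cn n →L[ℝ] ℂ) => radial p.1 p.2) (z, L) :=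
  Complex.reCLM.contDiff.contDiffAt.comp (z, L)
    (ContDiffAt.inner (E := Cn n) ℂ contDiffAt_fst (contDiffAt_liouville z h))

/-- `L` is onto with symplectic kernel, and its Liouville vector at `z` points outwards. -/
def IsConvexAt (z : Cn n) (L : Cn n →L[ℝ] ℂ) : Prop := pfaffian L ≠ 0 ∧ 0 < radial z L

theorem isOpen_isConvexAt :
    IsOpen {p : Cn n × (Cn n →L[ℝ] ℂ) | IsConvexAt p.1 p.2} := by
  rw [isOpen_iff_mem_nhds]
  rintro ⟨z, L⟩ ⟨h1, h2⟩
  filter_upwards [(isOpen_pfaffian_ne_zero.preimage continuous_snd).mem_nhds h1,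
    (contDiffAt_radial z h1).continuousAt.eventually (lt_mem_nhds h2)] with p hp1 hp2
  exact ⟨hp1, hp2⟩

/-! ### Liouville domains -/

theorem isLiouvilleDomain_of_pfaffian {h : Cn n → ℂ} {δ : ℂ} {ε : ℝ} (hh : ContDiff ℝ ∞ h)
    (h1 : ∀ z, ‖z‖ ≤ ε → h z = δ → pfaffian (fderiv ℝ h z) ≠ 0)
    (h2 : ∀ z, ‖z‖ = ε → h z = δ → 0 < radial z (fderiv ℝ h z)) : IsLiouvilleDomain h δ ε where
  smooth := ⟨Set.univ, isOpen_univ, Set.subset_univ _, hh.contDiffOn⟩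
  regular z hz := surjective_of_pfaffian (h1 z hz.1 hz.2)
  symplectic z hz v hv hw := eq_zero_of_omega_ker (h1 z hz.1 hz.2) hv hw
  outward z hz X hX hw := by
    rw [eq_liouville (h1 z hz.1.le hz.2) hX hw]
    exact h2 z hz.1 hz.2

end MilnorFibers

/-! ### Moser-type isotopies of level sets. -/

namespace MilnorFibers

variable {n : ℕ}

open SmoothFlow

/-! ### Symplectic parallel transport -/

/-- Symplectic parallel transport along the family `h + s k`, `s ∈ [0, 1]`, where `k` vanishes
outside of the ball of radius `r`. -/
theorem exists_parallelTransport {h k : Cn n → ℂ} (hh : ContDiff ℝ ∞ h) (hk : ContDiff ℝ ∞ k)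
    {r : ℝ} (hk0 : ∀ z, r ≤ ‖z‖ → k z = 0) {δ : ℂ}
    (hd : ∀ s ∈ Set.Icc (0 : ℝ) 1, ∀ z, ‖z‖ ≤ r → h z + s • k z = δ →
      pfaffian (fderiv ℝ h z + s • fderiv ℝ k z) ≠ 0) :
    ∃ (Ψ Φ : Cn n → Cn n) (G : Cn n → ℝ), ContDiff ℝ ∞ Ψ ∧ ContDiff ℝ ∞ Φ ∧ ContDiff ℝ ∞ G ∧
      (∀ z, Φ (Ψ z) = z) ∧ (∀ z, Ψ (Φ z) = z) ∧
      (∀ z, r ≤ ‖z‖ → Ψ z = z) ∧ (∀ z, r ≤ ‖z‖ → Φ z = z) ∧ (∀ z, r ≤ ‖z‖ → G z = 0) ∧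
      (∀ z, h z = δ → h (Ψ z) + k (Ψ z) = δ) ∧ (∀ z, h z + k z = δ → h (Φ z) = δ) ∧
      ∀ z, h z = δ → ∀ v, fderiv ℝ h z v = 0 →
        stdPrimitive (Ψ z) (fderiv ℝ Ψ z v) = stdPrimitive z v + fderiv ℝ G z v := by
  set D : ℝ × Cn n → Cn n →L[ℝ] ℂ := fun p => fderiv ℝ h p.2 + p.1 • fderiv ℝ k p.2 with hD
  have hDs : ContDiff ℝ ∞ D :=
    ((hh.fderiv_right (m := ∞) (by simp)).comp contDiff_snd).add
      (contDiff_fst.smul ((hk.fderiv_right (m := ∞) (by simp)).comp contDiff_snd))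
  set H : ℝ × Cn n → ℂ := fun p => h p.2 + p.1 • k p.2 with hH
  have hHs : ContDiff ℝ ∞ H :=
    (hh.comp contDiff_snd).add (contDiff_fst.smul (hk.comp contDiff_snd))
  set O : Set (ℝ × Cn n) := {p | pfaffian (D p) ≠ 0}
  have hO : IsOpen O := isOpen_pfaffian_ne_zero.preimage hDs.continuous
  set M : Set (ℝ × Cn n) := (Set.Icc 0 1 ×ˢ Metric.closedBall 0 r) ∩ H ⁻¹' {δ}
  have hM : IsCompact M := (isCompact_Icc.prod (isCompact_closedBall 0 r)).inter_right
    (isClosed_singleton.preimage hHs.continuous)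
  obtain ⟨ξ, hξ, hξc, hξO, hξ1, -⟩ := exists_cutoff hM hO
    (fun p hp => hd p.1 hp.1.1 p.2 (by simpa using hp.1.2) hp.2)
  -- Where `ξ = 1`, the field `(1, V)` keeps `h + s k` constant. The values of `V` lie in the
  -- symplectic complement of the tangent space of the level, so `omega V` vanishes on that tangent
  -- space.
  set V : ℝ × Cn n → Cn n := fun p => ξ p • lift (D p) (-k p.2) with hV
  have hVs : ContDiff ℝ ∞ V := by
    refine contDiff_smul_of_tsupport_subset hO hξ hξO fun p hp => ?_
    have h1 : ContDiff ℝ ∞ (fun p : ℝ × Cn n => (D p, -k p.2)) :=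
      hDs.prodMk (hk.comp contDiff_snd).neg
    exact (ContDiffAt.comp p (contDiffAt_lift hp (-k p.2)) h1.contDiffAt).contDiffWithinAt
  have hV0 : ∀ s z, r ≤ ‖z‖ → V (s, z) = 0 := fun s z hz => by
    simp [hV, hk0 z hz]
  have hDV : ∀ p, D p (V p) = -(ξ p • k p.2) := fun p => by
    by_cases hp : p ∈ tsupport ξ
    · rw [hV, map_smul, apply_lift (hξO hp), smul_neg]
    · simp [hV, image_eq_zero_of_notMem_tsupport hp]
  have hVω : ∀ p w, D p w = 0 → omega (V p) w = 0 := fun p w hw => by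
    rw [hV, map_smul, smul_apply, omega_lift hw, smul_zero]
  -- the flows
  have hVc : HasCompactSupport V := hξc.smul_right
  have hsm1 : ContDiff ℝ ∞ fun p => ((0 : ℝ), V p) := contDiff_const.prodMk hVs
  -- An additional coordinate integrates `θ(V)` along the orbits; its value at time `1` is the
  -- primitive `G`. Neither component of the field depends on this coordinate.
  have hsm2 : ContDiff ℝ ∞ fun p => (((0 : ℝ), V p), omega p.2 (V p) / 2) :=
    hsm1.prodMk (((omega.contDiff.comp contDiff_snd).clm_apply hVs).div_const 2)
  have hcs1 : HasCompactSupport fun p => ((0 : ℝ), V p) :=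
    hVc.mono fun p hp => by
      intro h0
      exact hp (by simp [h0])
  have hcs2 : HasCompactSupport fun p => (((0 : ℝ), V p), omega p.2 (V p) / 2) :=
    hVc.mono fun p hp => by
      intro h0
      exact hp (by simp [h0])
  obtain ⟨F, hF⟩ := exists_isFlow_const_add (ContinuousLinearMap.id ℝ (ℝ × Cn n)) hsm1 hcs1 (1, 0)
  obtain ⟨F', hF'⟩ := exists_isFlow_const_add
    (ContinuousLinearMap.fst ℝ (ℝ × Cn n) ℝ) hsm2 hcs2 ((1, 0), 0)
  have hF'F : ∀ t p g, (F' t (p, g)).1 = F t p := fun t p g => by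
    have := hF.unique (fun t => (F' t (p, g)).1) (fun t => by
      simpa using hasDerivAt_prod_fst (hF'.hasDerivAt t (p, g))) t
    rw [this, hF'.zero]
  have hF1 : ∀ t p, (F t p).1 = p.1 + t := fun t p => by
    have h1 : ∀ t, HasDerivAt (fun t => (F t p).1 - t) 0 t := fun t => by
      simpa using (hasDerivAt_prod_fst (hF.hasDerivAt t p)).fun_sub (hasDerivAt_id' t)
    have := is_const_of_deriv_eq_zero (fun t => (h1 t).differentiableAt) (fun t => (h1 t).deriv) t 0
    simp only [hF.zero, sub_zero] at this
    linarith
  set ζ : ℝ → Cn n → Cn n := fun t z => (F t (0, z)).2 with hζ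
  set Γ : ℝ → Cn n → ℝ := fun t z => (F' t ((0, z), 0)).2 with hΓ
  have hFζ : ∀ t z, F t (0, z) = (t, ζ t z) := fun t z => by
    rw [hζ, Prod.ext_iff, hF1]
    simp
  have hζs : ContDiff ℝ ∞ fun p : ℝ × Cn n => ζ p.1 p.2 :=
    contDiff_snd.comp (hF.smooth.comp
      (contDiff_fst.prodMk (contDiff_const.prodMk contDiff_snd)))
  have hΓs : ContDiff ℝ ∞ fun p : ℝ × Cn n => Γ p.1 p.2 :=
    contDiff_snd.comp (hF'.smooth.comp
      (contDiff_fst.prodMk ((contDiff_const.prodMk contDiff_snd).prodMk contDiff_const)))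
  have hζ0 : ∀ z, ζ 0 z = z := fun z => by simp [hζ, hF.zero]
  have hΓ0 : ∀ z, Γ 0 z = 0 := fun z => by simp [hΓ, hF'.zero]
  have hζd : ∀ t z, HasDerivAt (fun t => ζ t z) (V (t, ζ t z)) t := fun t z => by
    have := hasDerivAt_prod_snd (hF.hasDerivAt t (0, z))
    simp only [hFζ] at this
    simpa using this
  have hΓd : ∀ t z, HasDerivAt (fun t => Γ t z) (omega (ζ t z) (V (t, ζ t z)) / 2) t :=
    fun t z => by
      have := hasDerivAt_prod_snd (hF'.hasDerivAt t ((0, z), 0))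
      simp only [ContinuousLinearMap.coe_fst', hF'F, hFζ] at this
      simpa using this
  have hstat : ∀ t s z, r ≤ ‖z‖ → F t (s, z) = (s + t, z) := fun t s z hz => by
    have := hF.unique (fun t => (s + t, z)) (fun t => by
      simpa [hV0 _ z hz] using ((hasDerivAt_id t).const_add s).prodMk (hasDerivAt_const t z)) t
    simpa using this.symm
  -- the level sets are preserved
  have hξk : ∀ t ∈ Set.Icc (0 : ℝ) 1, ∀ z, H (t, z) = δ →
      ∀ᶠ p in 𝓝 (t, z), (1 - ξ p) • k p.2 = 0 := by
    intro t ht z hz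
    rcases le_or_gt ‖z‖ r with hzr | hzr
    · filter_upwards [hξ1 (t, z) ⟨⟨ht, by simpa using hzr⟩, hz⟩] with p hp
      rw [hp, sub_self, zero_smul]
    · filter_upwards [(isOpen_lt continuous_const
        (continuous_snd.norm : Continuous fun p : ℝ × Cn n => ‖p.2‖)).mem_nhds hzr] with p hp
      rw [hk0 p.2 (le_of_lt hp), smul_zero]
  have hHd : ∀ t z, HasFDerivAt (fun z => H (t, z)) (D (t, z)) z := fun t z =>
    (hh.differentiable (by simp) z).hasFDerivAt.add
      ((hk.differentiable (by simp) z).hasFDerivAt.const_smul t)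
  have hu : ∀ t z, HasDerivAt (fun t => H (t, ζ t z))
      ((1 - ξ (t, ζ t z)) • k (ζ t z)) t := fun t z => by
    have h1 := (hh.differentiable (by simp) (ζ t z)).hasFDerivAt.comp_hasDerivAt t (hζd t z)
    have h2 := (hk.differentiable (by simp) (ζ t z)).hasFDerivAt.comp_hasDerivAt t (hζd t z)
    have h3 := h1.add ((hasDerivAt_id t).smul h2)
    have h4 := hDV (t, ζ t z)
    simp only [hD, add_apply, smul_apply] at h4
    refine h3.congr_deriv ?_
    simp only [id, Function.comp, one_smul]
    rw [← add_assoc, h4, sub_smul, one_smul]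
    abel
  have hcont : ∀ z, Continuous fun t => (t, ζ t z) := fun z =>
    continuous_id.prodMk (continuous_iff_continuousAt.2 fun t => (hζd t z).continuousAt)
  have hloc : ∀ z, ∀ t ∈ Set.Icc (0 : ℝ) 1, H (t, ζ t z) = δ →
      ∀ᶠ s in 𝓝 t, (1 - ξ (s, ζ s z)) • k (ζ s z) = 0 := fun z t ht hz =>
    (hcont z).continuousAt.eventually (hξk t ht _ hz)
  have hfwd : ∀ z, h z = δ → ∀ t ∈ Set.Icc (0 : ℝ) 1, H (t, ζ t z) = δ := by
    intro z hz t ht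
    have := eq_zero_of_locally_const (u := fun t => H (t, ζ t z) - δ)
      (fun t => (hu t z).sub_const δ) (by simp [hH, hζ0, hz])
      (fun t ht h0 => hloc z t ht (sub_eq_zero.1 h0)) t ht
    exact sub_eq_zero.1 this
  -- The field is cut off away from the `δ`-levels, so other levels need not be preserved, and the
  -- inverse requires its own argument in reversed time.
  have hbwd : ∀ z, H (1, ζ 1 z) = δ → H (0, ζ 0 z) = δ := by
    intro z hz
    have hrev : ∀ t : ℝ, HasDerivAt (fun t => H (1 - t, ζ (1 - t) z) - δ)
        (-((1 - ξ (1 - t, ζ (1 - t) z)) • k (ζ (1 - t) z))) t := fun t => by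
      have := ((hu (1 - t) z).scomp t ((hasDerivAt_id t).const_sub 1)).sub_const δ
      simpa [Function.comp_def] using this
    have := eq_zero_of_locally_const hrev (by simp [hz]) (fun t ht h0 => by
      have h1 := hloc z (1 - t) ⟨by linarith [ht.2], by linarith [ht.1]⟩ (sub_eq_zero.1 h0)
      have h2 : Filter.Tendsto (fun s : ℝ => 1 - s) (𝓝 t) (𝓝 (1 - t)) :=
        (continuous_const.sub continuous_id).tendsto t
      filter_upwards [h2.eventually h1] with s hs
      rw [hs, neg_zero]) 1 ⟨zero_le_one, le_rfl⟩
    simpa using sub_eq_zero.1 this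
  have hinv1 : ∀ z, (F (-1) (1, ζ 1 z)).2 = z := fun z => by
    rw [← hFζ, hF.neg_apply]
  have hinv2 : ∀ z, ζ 1 (F (-1) (1, z)).2 = z := fun z => by
    have h1 : F (-1) (1, z) = (0, (F (-1) (1, z)).2) := by
      rw [Prod.ext_iff, hF1]
      simp
    rw [hζ]
    simp only
    rw [← h1, hF.apply_neg]
  have hΦs : ContDiff ℝ ∞ fun z => (F (-1) (1, z)).2 :=
    contDiff_snd.comp ((hF.contDiff_apply (-1)).comp (contDiff_const.prodMk contDiff_id))
  refine ⟨ζ 1, fun z => (F (-1) (1, z)).2, Γ 1, hζs.comp (contDiff_const.prodMk contDiff_id), hΦs,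
    hΓs.comp (contDiff_const.prodMk contDiff_id), hinv1, hinv2,
    fun z hz => by simp [hζ, hstat 1 0 z hz], fun z hz => by simp [hstat (-1) 1 z hz],
    fun z hz => ?_, fun z hz => ?_, fun z hz => ?_, fun z hz v hv => ?_⟩
  · have h1 : ∀ t, HasDerivAt (fun t => Γ t z) 0 t := fun t => by
      have h2 := hΓd t z
      have h3 : ζ t z = z := by simp [hζ, hstat t 0 z hz]
      simpa [h3, hV0 t z hz] using h2
    rw [is_const_of_deriv_eq_zero (fun t => (h1 t).differentiableAt) (fun t => (h1 t).deriv) 1 0,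
      hΓ0]
  · simpa [hH] using hfwd z hz 1 ⟨zero_le_one, le_rfl⟩
  · have := hbwd (F (-1) (1, z)).2 (by simpa [hH, hinv2] using hz)
    simpa [hH, hζ0] using this
  · have hζt : ∀ t, Differentiable ℝ (ζ t) := fun t =>
      (hζs.comp (contDiff_const.prodMk contDiff_id)).differentiable (by simp)
    have hVd : ∀ t, Differentiable ℝ fun x => V (t, ζ t x) := fun t =>
      (hVs.comp (contDiff_const.prodMk
        (hζs.comp (contDiff_const.prodMk contDiff_id)))).differentiable (by simp)
    -- the derivative of the transport maps tangent spaces to tangent spaces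
    have htan : ∀ t ∈ Set.Icc (0 : ℝ) 1, D (t, ζ t z) (fderiv ℝ (ζ t) z v) = 0 := by
      have hsm : ContDiff ℝ ∞ fun p : ℝ × Cn n => H (p.1, ζ p.1 p.2) :=
        hHs.comp (contDiff_fst.prodMk hζs)
      have h1 := fun t => hasDerivAt_fderiv_apply (Q := fun t x => H (t, ζ t x)) hsm hu t z v
      have h2 : ∀ t ∈ Set.Icc (0 : ℝ) 1,
          fderiv ℝ (fun x => (1 - ξ (t, ζ t x)) • k (ζ t x)) z v = 0 := fun t ht => by
        have hc : ContinuousAt (fun x => (t, ζ t x)) z :=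
          (continuous_const.prodMk (hζt t).continuous).continuousAt
        have : (fun x => (1 - ξ (t, ζ t x)) • k (ζ t x)) =ᶠ[𝓝 z] fun _ => 0 :=
          hc.eventually (hξk t ht _ (hfwd z hz t ht))
        rw [this.fderiv_eq]
        simp
      intro t ht
      have h3 := constant_of_has_deriv_right_zero (a := 0) (b := 1)
        (fun t _ => (h1 t).continuousAt.continuousWithinAt)
        (fun t ht => by
          have := (h1 t).hasDerivWithinAt (s := Set.Ici t)
          rwa [h2 t ⟨ht.1, ht.2.le⟩] at this) t ht
      have h4 : fderiv ℝ (fun x => H (t, ζ t x)) z = (D (t, ζ t z)).comp (fderiv ℝ (ζ t) z) :=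
        (HasFDerivAt.comp (g := fun z => H (t, z)) z (hHd t (ζ t z))
          (hζt t z).hasFDerivAt).fderiv
      have h5 : (fun x => H (0, ζ 0 x)) = h := by
        funext x
        simp [hH, hζ0]
      rw [h4, h5, hv] at h3
      exact h3
    -- Cartan's formula by hand: the derivatives of `ζ_t^* θ (v)` and `dΓ_t (v)` differ by `omega V
    -- (dζ_t v)`, which vanishes as `dζ_t v` is tangent to the level.
    have hω1 : ∀ t, HasDerivAt (fun t => omega (ζ t z) (fderiv ℝ (ζ t) z v) / 2)
        ((omega (V (t, ζ t z)) (fderiv ℝ (ζ t) z v)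
          + omega (ζ t z) (fderiv ℝ (fun x => V (t, ζ t x)) z v)) / 2) t := fun t => by
      have h1 := hasDerivAt_fderiv_apply hζs hζd t z v
      exact ((omega.hasFDerivAt.comp_hasDerivAt t (hζd t z)).clm_apply h1).div_const 2
    have hω2 : ∀ t, HasDerivAt (fun t => fderiv ℝ (Γ t) z v)
        ((omega (fderiv ℝ (ζ t) z v) (V (t, ζ t z))
          + omega (ζ t z) (fderiv ℝ (fun x => V (t, ζ t x)) z v)) / 2) t := fun t => by
      have h1 := hasDerivAt_fderiv_apply hΓs hΓd t z v
      have h2 : HasFDerivAt (fun x => omega (ζ t x)) (omega.comp (fderiv ℝ (ζ t) z)) z :=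
        omega.hasFDerivAt.comp z (hζt t z).hasFDerivAt
      have h3 := (h2.clm_apply (hVd t z).hasFDerivAt).mul_const (2⁻¹ : ℝ)
      have h4 : (fun x => omega (ζ t x) (V (t, ζ t x)) / 2)
          = fun x => omega (ζ t x) (V (t, ζ t x)) * 2⁻¹ := by
        funext x
        rw [div_eq_mul_inv]
      rw [h4, h3.fderiv] at h1
      refine h1.congr_deriv ?_
      simp
      ring
    have hq := constant_of_has_deriv_right_zero (a := 0) (b := 1)
      (f := fun t => omega (ζ t z) (fderiv ℝ (ζ t) z v) / 2 - fderiv ℝ (Γ t) z v)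
      (fun t _ => ((hω1 t).sub (hω2 t)).continuousAt.continuousWithinAt)
      (fun t ht => by
        have h1 := ((hω1 t).fun_sub (hω2 t)).hasDerivWithinAt (s := Set.Ici t)
        have h2 := hVω (t, ζ t z) _ (htan t ⟨ht.1, ht.2.le⟩)
        have h3 := omega_antisymm (fderiv ℝ (ζ t) z v) (V (t, ζ t z))
        rw [h3, h2] at h1
        simpa using h1) 1 ⟨zero_le_one, le_rfl⟩
    have h0 : ζ 0 = id := funext hζ0
    have h0' : Γ 0 = fun _ => 0 := funext hΓ0
    simp only [h0, h0', fderiv_id, id] at hq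
    simp only [stdPrimitive_eq_omega]
    simp at hq ⊢
    linarith

end MilnorFibers

/-! ### Manifold structure on subsets of a vector space. -/

namespace MilnorFibers

/-! ### Submanifolds of a vector space -/

/-- A chart of a subset `N` of `E` by `F`: the restriction of a linear map, with a smooth inverse. -/
structure LinearChart (E F : Type) [NormedAddCommGroup E] [NormedSpace ℝ E] [NormedAddCommGroup F]
    [NormedSpace ℝ F] (N : Set E) where
  proj : E →L[ℝ] F
  param : F → E
  dom : Set E
  tgt : Set F
  isOpen_dom : IsOpen dom
  isOpen_tgt : IsOpen tgt
  smooth : ContDiffOn ℝ ∞ param tgt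
  param_mem : ∀ y ∈ tgt, param y ∈ N
  param_mem_dom : ∀ y ∈ tgt, param y ∈ dom
  proj_param : ∀ y ∈ tgt, proj (param y) = y
  proj_mem : ∀ z ∈ N, z ∈ dom → proj z ∈ tgt
  param_proj : ∀ z ∈ N, z ∈ dom → param (proj z) = z

/-- A subset of `E` covered by linear charts. -/
structure Submanifold (E F : Type) [NormedAddCommGroup E] [NormedSpace ℝ E] [NormedAddCommGroup F]
    [NormedSpace ℝ F] where
  set : Set E
  chart : set → LinearChart E F set
  mem_dom : ∀ x, x.1 ∈ (chart x).dom

section Charts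

variable {E F : Type} [NormedAddCommGroup E] [NormedSpace ℝ E] [NormedAddCommGroup F]
  [NormedSpace ℝ F]

open Classical in
/-- The chart on the subtype given by a linear chart. -/
def LinearChart.toOpenPartialHomeomorph {N : Set E} (c : LinearChart E F N) (x₀ : N) :
    OpenPartialHomeomorph N F where
  toFun x := c.proj x.1
  -- The value `x₀` outside of `tgt` is irrelevant; it only makes the inverse total.
  invFun y := if h : y ∈ c.tgt then ⟨c.param y, c.param_mem y h⟩ else x₀
  source := {x | x.1 ∈ c.dom}
  target := c.tgt
  map_source' x hx := c.proj_mem x.1 x.2 hx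
  map_target' y hy := by simpa [hy] using c.param_mem_dom y hy
  left_inv' x hx := by
    simp [c.proj_mem x.1 x.2 hx, c.param_proj x.1 x.2 hx]
  right_inv' y hy := by simp [hy, c.proj_param y hy]
  open_source := c.isOpen_dom.preimage continuous_subtype_val
  open_target := c.isOpen_tgt
  continuousOn_toFun := (c.proj.continuous.comp continuous_subtype_val).continuousOn
  continuousOn_invFun := by
    rw [continuousOn_iff_continuous_domRestrict, continuous_induced_rng]
    refine (continuousOn_iff_continuous_domRestrict.1 c.smooth.continuousOn).congr fun y => ?_
    simp

theorem LinearChart.coe_symm_apply {N : Set E} (c : LinearChart E F N) (x₀ : N) {y : F}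
    (hy : y ∈ c.tgt) : ((c.toOpenPartialHomeomorph x₀).symm y : E) = c.param y := by
  simp [LinearChart.toOpenPartialHomeomorph, hy]

namespace Submanifold

variable (M : Submanifold E F)

/-- The manifold underlying a submanifold. -/
def Carrier : Type := M.set

instance : TopologicalSpace M.Carrier := inferInstanceAs (TopologicalSpace M.set)

instance : T2Space M.Carrier := inferInstanceAs (T2Space M.set)

instance [SecondCountableTopology E] : SecondCountableTopology M.Carrier :=
  inferInstanceAs (SecondCountableTopology M.set)

/-- The inclusion of a submanifold. -/
def val (x : M.Carrier) : E := Subtype.val (p := fun z => z ∈ M.set) x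

theorem val_mem (x : M.Carrier) : M.val x ∈ M.set := x.2

theorem val_injective : Function.Injective M.val := Subtype.val_injective

theorem isInducing_val : Topology.IsInducing M.val := Topology.IsInducing.subtypeVal

/-- A point of the set as a point of the manifold. -/
def point (z : E) (hz : z ∈ M.set) : M.Carrier := (⟨z, hz⟩ : M.set)

@[simp] theorem val_point (z : E) (hz : z ∈ M.set) : M.val (M.point z hz) = z := rfl

instance : ChartedSpace F M.Carrier where
  atlas := Set.range fun x => (M.chart x).toOpenPartialHomeomorph x
  chartAt x := (M.chart x).toOpenPartialHomeomorph x
  mem_chart_source x := M.mem_dom x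
  chart_mem_atlas x := ⟨x, rfl⟩

theorem val_chartAt_symm (x₀ : M.Carrier) {y : F} (hy : y ∈ (M.chart x₀).tgt) :
    M.val ((chartAt F x₀).symm y) = (M.chart x₀).param y :=
  (M.chart x₀).coe_symm_apply x₀ hy

/-- A coordinate change is a linear projection composed with a smooth parametrization. Charts are
taken to be restrictions of linear maps so that this needs no further argument. -/
instance : IsManifold 𝓘(ℝ, F) ∞ M.Carrier := by
  refine isManifold_of_contDiffOn _ _ _ ?_
  rintro _ _ ⟨x, rfl⟩ ⟨x', rfl⟩
  have : ContDiffOn ℝ ∞ (fun y => (M.chart x').proj ((M.chart x).param y)) (M.chart x).tgt :=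
    (M.chart x').proj.contDiff.comp_contDiffOn (M.chart x).smooth
  refine (this.mono fun y hy => ?_).congr fun y hy => ?_
  · exact hy.1.1
  · have hy' : y ∈ (M.chart x).tgt := hy.1.1
    change (M.chart x').proj _ = (M.chart x').proj _
    congr 1
    exact (M.chart x).coe_symm_apply x hy'

theorem contMDiff_val : ContMDiff 𝓘(ℝ, F) 𝓘(ℝ, E) ∞ M.val := by
  intro x
  have h1 : ContMDiffAt 𝓘(ℝ, F) 𝓘(ℝ, F) ∞ (chartAt F x) x :=
    contMDiffAt_of_mem_maximalAtlas (IsManifold.chart_mem_maximalAtlas x) (mem_chart_source F x)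
  have hx : chartAt F x x ∈ (M.chart x).tgt := mem_chart_target F x
  have h2 : ContMDiffAt 𝓘(ℝ, F) 𝓘(ℝ, E) ∞ (M.chart x).param (chartAt F x x) :=
    ((M.chart x).smooth.contDiffAt ((M.chart x).isOpen_tgt.mem_nhds hx)).contMDiffAt
  refine (h2.comp x h1).congr_of_eventuallyEq ?_
  filter_upwards [(chartAt F x).open_source.mem_nhds (mem_chart_source F x)] with y hy
  exact ((M.chart x).param_proj (M.val y) (M.val_mem y) hy).symm

/-- A chart is the restriction of a linear map of the ambient space, so smoothness of a map into the
submanifold can be tested after the inclusion. -/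
theorem contMDiffWithinAt_of_val {X H G : Type} [NormedAddCommGroup G] [NormedSpace ℝ G]
    [TopologicalSpace H] [TopologicalSpace X] [ChartedSpace H X] {J : ModelWithCorners ℝ G H}
    {f : X → M.Carrier} {s : Set X} {x : X}
    (h : ContMDiffWithinAt J 𝓘(ℝ, E) ∞ (fun y => M.val (f y)) s x) :
    ContMDiffWithinAt J 𝓘(ℝ, F) ∞ f s x := by
  rw [contMDiffWithinAt_iff_target]
  refine ⟨M.isInducing_val.continuousWithinAt_iff.2 h.continuousWithinAt, ?_⟩
  exact (M.chart (f x)).proj.contDiff.contMDiff.contMDiffAt.comp_contMDiffWithinAt x h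

/-- A map of submanifolds given by smooth maps of the ambient spaces, as a diffeomorphism. -/
def diffeomorph {M M' : Submanifold E F} {Ψ Φ : E → E} (hΨ : ContDiff ℝ ∞ Ψ)
    (hΦ : ContDiff ℝ ∞ Φ) (h1 : ∀ z ∈ M.set, Ψ z ∈ M'.set) (h2 : ∀ z ∈ M'.set, Φ z ∈ M.set)
    (h3 : ∀ z, Φ (Ψ z) = z) (h4 : ∀ z, Ψ (Φ z) = z) :
    Diffeomorph 𝓘(ℝ, F) 𝓘(ℝ, F) M.Carrier M'.Carrier ∞ where
  toFun x := M'.point (Ψ (M.val x)) (h1 _ (M.val_mem x))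
  invFun x := M.point (Φ (M'.val x)) (h2 _ (M'.val_mem x))
  left_inv _ := M.val_injective (h3 _)
  right_inv _ := M'.val_injective (h4 _)
  contMDiff_toFun _ := M'.contMDiffWithinAt_of_val
    (hΨ.contMDiff.contMDiffAt.comp_contMDiffWithinAt _ (M.contMDiff_val _))
  contMDiff_invFun _ := M.contMDiffWithinAt_of_val
    (hΦ.contMDiff.contMDiffAt.comp_contMDiffWithinAt _ (M'.contMDiff_val _))

theorem mdifferentiableAt_val (x : M.Carrier) : MDifferentiableAt 𝓘(ℝ, F) 𝓘(ℝ, E) M.val x :=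
  (M.contMDiff_val x).mdifferentiableAt (by simp)

/-- The derivative of a map to a submanifold, followed by the inclusion. -/
theorem mfderiv_val_comp {G : Type} [NormedAddCommGroup G] [NormedSpace ℝ G] {f : G → M.Carrier}
    {q : G → E} {x : G} (hf : MDifferentiableAt 𝓘(ℝ, G) 𝓘(ℝ, F) f x)
    (hq : (fun y => M.val (f y)) =ᶠ[𝓝 x] q) (v : G) :
    mfderiv 𝓘(ℝ, F) 𝓘(ℝ, E) M.val (f x) (mfderiv 𝓘(ℝ, G) 𝓘(ℝ, F) f x v) = fderiv ℝ q x v := by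
  rw [← hq.fderiv_eq, ← mfderiv_eq_fderiv,
    show (fun y => M.val (f y)) = M.val ∘ f from rfl,
    mfderiv_comp x (M.mdifferentiableAt_val (f x)) hf]
  rfl

theorem mdifferentiableAt_chartAt_symm (x₀ : M.Carrier) {y : F} (hy : y ∈ (M.chart x₀).tgt) :
    MDifferentiableAt 𝓘(ℝ, F) 𝓘(ℝ, F) (chartAt F x₀).symm y :=
  mdifferentiableAt_atlas_symm (chart_mem_atlas F x₀) hy

theorem mfderiv_val_chartAt_symm (x₀ : M.Carrier) {y : F} (hy : y ∈ (M.chart x₀).tgt) (v : F) :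
    mfderiv 𝓘(ℝ, F) 𝓘(ℝ, E) M.val ((chartAt F x₀).symm y)
      (mfderiv 𝓘(ℝ, F) 𝓘(ℝ, F) (chartAt F x₀).symm y v) = fderiv ℝ (M.chart x₀).param y v := by
  refine M.mfderiv_val_comp (M.mdifferentiableAt_chartAt_symm x₀ hy) ?_ v
  filter_upwards [(M.chart x₀).isOpen_tgt.mem_nhds hy] with y' hy'
  exact M.val_chartAt_symm x₀ hy'

end Submanifold

end Charts

/-! ### Restriction of a 1-form to a submanifold -/

section Forms

variable {E : Type} [NormedAddCommGroup E] [NormedSpace ℝ E] {d : ℕ}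

/-- The restriction of a 1-form of the ambient space. -/
def Submanifold.form (M : Submanifold E (EuclideanSpace ℝ (Fin d))) (θ : E → E →L[ℝ] ℝ)
    (x : M.Carrier) : TangentSpace 𝓘(ℝ, EuclideanSpace ℝ (Fin d)) x →L[ℝ] ℝ :=
  (θ (M.val x)).comp (mfderiv 𝓘(ℝ, EuclideanSpace ℝ (Fin d)) 𝓘(ℝ, E) M.val x)

theorem Submanifold.coordForm_form (M : Submanifold E (EuclideanSpace ℝ (Fin d)))
    (θ : E → E →L[ℝ] ℝ) (x₀ : M.Carrier) {y : EuclideanSpace ℝ (Fin d)}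
    (hy : y ∈ (M.chart x₀).tgt) :
    coordForm (M.form θ) x₀ y
      = (θ ((M.chart x₀).param y)).comp (fderiv ℝ (M.chart x₀).param y) := by
  ext v
  change θ (M.val _) (mfderiv _ _ M.val _ (mfderiv _ _ _ y v)) = _
  rw [M.mfderiv_val_chartAt_symm x₀ hy, M.val_chartAt_symm x₀ hy]
  rfl

theorem LinearChart.contDiffOn_pullback {F : Type} [NormedAddCommGroup F] [NormedSpace ℝ F]
    {N : Set E} (c : LinearChart E F N) {θ : E → E →L[ℝ] ℝ}
    (hθ : ∀ z ∈ N, ContDiffAt ℝ ∞ θ z) :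
    ContDiffOn ℝ ∞ (fun y => (θ (c.param y)).comp (fderiv ℝ c.param y)) c.tgt := by
  intro y hy
  have h1 : ContDiffAt ℝ ∞ c.param y := c.smooth.contDiffAt (c.isOpen_tgt.mem_nhds hy)
  exact ((ContDiffAt.comp y (hθ _ (c.param_mem y hy)) h1).clm_comp
    (h1.fderiv_right (m := ∞) (by simp))).contDiffWithinAt

/-- Pullback commutes with the exterior derivative: the terms with the second derivative of `param`
are symmetric in `v`, `w` and cancel. -/
theorem LinearChart.extDeriv_pullback {F : Type} [NormedAddCommGroup F] [NormedSpace ℝ F]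
    {N : Set E} (c : LinearChart E F N) {θ : E → E →L[ℝ] ℝ}
    (hθ : ∀ z ∈ N, ContDiffAt ℝ ∞ θ z) {y : F} (hy : y ∈ c.tgt) (v w : F) :
    fderiv ℝ (fun y => (θ (c.param y)).comp (fderiv ℝ c.param y)) y v w
      - fderiv ℝ (fun y => (θ (c.param y)).comp (fderiv ℝ c.param y)) y w v
      = fderiv ℝ θ (c.param y) (fderiv ℝ c.param y v) (fderiv ℝ c.param y w)
        - fderiv ℝ θ (c.param y) (fderiv ℝ c.param y w) (fderiv ℝ c.param y v) := by
  have h1 : ContDiffAt ℝ ∞ c.param y := c.smooth.contDiffAt (c.isOpen_tgt.mem_nhds hy)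
  have h2 : HasFDerivAt (fun y => θ (c.param y)) _ y :=
    ((hθ _ (c.param_mem y hy)).differentiableAt (by simp)).hasFDerivAt.comp y
      (h1.differentiableAt (by simp)).hasFDerivAt
  have h3 := h2.clm_comp
    ((h1.fderiv_right (m := ∞) (by simp)).differentiableAt (by simp)).hasFDerivAt
  have hs : IsSymmSndFDerivAt ℝ c.param y :=
    h1.isSymmSndFDerivAt (by simpa using ENat.LEInfty.out)
  rw [h3.fderiv]
  simp only [add_apply, ContinuousLinearMap.comp_apply, ContinuousLinearMap.compL_apply,
    ContinuousLinearMap.flip_apply]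
  rw [hs.eq v w]
  ring

/-- A submanifold with the restriction of a 1-form whose exterior derivative is nondegenerate. -/
def Submanifold.toExactSymplecticManifold [SecondCountableTopology E]
    (M : Submanifold E (EuclideanSpace ℝ (Fin d)))
    (θ : E → E →L[ℝ] ℝ) (hθ : ∀ z ∈ M.set, ContDiffAt ℝ ∞ θ z)
    (hd : ∀ x₀, ∀ y ∈ (M.chart x₀).tgt, ∀ v,
      (∀ w, fderiv ℝ θ ((M.chart x₀).param y) (fderiv ℝ (M.chart x₀).param y v)
          (fderiv ℝ (M.chart x₀).param y w)
        - fderiv ℝ θ ((M.chart x₀).param y) (fderiv ℝ (M.chart x₀).param y w)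
          (fderiv ℝ (M.chart x₀).param y v) = 0) → v = 0) :
    ExactSymplecticManifold d where
  carrier := M.Carrier
  lam := M.form θ
  lam_smooth x₀ := ((M.chart x₀).contDiffOn_pullback hθ).congr fun y hy =>
    M.coordForm_form θ x₀ hy
  symplectic x₀ y hy v hv := by
    have hev : coordForm (M.form θ) x₀ =ᶠ[𝓝 y]
        fun y => (θ ((M.chart x₀).param y)).comp (fderiv ℝ (M.chart x₀).param y) := by
      filter_upwards [(M.chart x₀).isOpen_tgt.mem_nhds hy] with y' hy'
      exact M.coordForm_form θ x₀ hy'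
    refine hd x₀ y hy v fun w => ?_
    have := hv w
    rwa [hev.fderiv_eq, (M.chart x₀).extDeriv_pullback hθ hy] at this

end Forms

end MilnorFibers

/-! ### Charts of, and retractions to, regular level sets. -/

namespace MilnorFibers

open SmoothFlow

variable {n : ℕ}

/-! ### Level sets as submanifolds -/

/-- A projection onto the `2n`-dimensional kernel of `L` completes `L` to an isomorphism. -/
theorem exists_equiv_prod {L : Cn n →L[ℝ] ℂ} (hL : Function.Surjective L) :
    ∃ (A : Cn n →L[ℝ] EuclideanSpace ℝ (Fin (2 * n)))
      (T : Cn n ≃L[ℝ] EuclideanSpace ℝ (Fin (2 * n)) × ℂ),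
      (T : Cn n →L[ℝ] EuclideanSpace ℝ (Fin (2 * n)) × ℂ) = A.prod L := by
  have hE : Module.finrank ℝ (Cn n) = 2 * (n + 1) := by
    rw [← Module.finrank_mul_finrank ℝ ℂ (Cn n), Complex.finrank_real_complex]
    simp
  have hrank := L.toLinearMap.finrank_range_add_finrank_ker
  rw [LinearMap.range_eq_top.2 hL, finrank_top, Complex.finrank_real_complex, hE] at hrank
  have hker : Module.finrank ℝ (LinearMap.ker L.toLinearMap)
      = Module.finrank ℝ (EuclideanSpace ℝ (Fin (2 * n))) := by
    rw [finrank_euclideanSpace_fin]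
    omega
  set e := ContinuousLinearEquiv.ofFinrankEq hker
  obtain ⟨p, hp⟩ := Submodule.ClosedComplemented.of_finiteDimensional
    (LinearMap.ker L.toLinearMap)
  set A := (e : _ →L[ℝ] EuclideanSpace ℝ (Fin (2 * n))).comp p
  have hinj : Function.Injective (A.prod L).toLinearMap := by
    rw [← LinearMap.ker_eq_bot, LinearMap.ker_eq_bot']
    intro z hz
    have h1 : A z = 0 := congrArg Prod.fst hz
    have h2 : L z = 0 := congrArg Prod.snd hz
    have h3 : p z = 0 := e.injective (by simpa [A] using h1)
    have h4 := hp ⟨z, h2⟩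
    rw [h3] at h4
    exact (congrArg Subtype.val h4).symm
  refine ⟨A, ((A.prod L).toLinearMap.linearEquivOfInjective hinj ?_).toContinuousLinearEquiv, ?_⟩
  · rw [Module.finrank_prod, Complex.finrank_real_complex, finrank_euclideanSpace_fin, hE]
    ring
  · ext z <;> rfl

/-- The inverse function theorem applies to `(A, h)`, with `A` completing `dh` to an isomorphism;
the chart is its slice over `h = δ`. -/
theorem exists_linearChart {h : Cn n → ℂ} (hh : ContDiff ℝ ∞ h) {S : Set (Cn n)} (hS : IsOpen S)
    {δ : ℂ} {z₀ : Cn n} (hz₀ : z₀ ∈ S) (hs : Function.Surjective (fderiv ℝ h z₀)) :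
    ∃ c : LinearChart (Cn n) (EuclideanSpace ℝ (Fin (2 * n))) {z | z ∈ S ∧ h z = δ},
      z₀ ∈ c.dom := by
  obtain ⟨A, T, hT⟩ := exists_equiv_prod hs
  set q : Cn n → EuclideanSpace ℝ (Fin (2 * n)) × ℂ := fun z => (A z, h z) with hq
  have hqs : ContDiff ℝ ∞ q := A.contDiff.prodMk hh
  have hqd : ∀ z, HasFDerivAt q (A.prod (fderiv ℝ h z)) z := fun z =>
    A.hasFDerivAt.prodMk (hh.differentiable (by simp) z).hasFDerivAt
  have hq₀ : HasFDerivAt q (T : Cn n →L[ℝ] EuclideanSpace ℝ (Fin (2 * n)) × ℂ) z₀ := by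
    rw [hT]
    exact hqd z₀
  -- The domain is shrunk to points where `dq` is invertible, so that the inverse is smooth at every
  -- point of the target and not only at the image of `z₀`.
  set S' : Set (Cn n) := S ∩ {z | fderiv ℝ q z ∈ Set.range
    ((↑) : (Cn n ≃L[ℝ] EuclideanSpace ℝ (Fin (2 * n)) × ℂ) → _)}
  have hS' : IsOpen S' := hS.inter
    (ContinuousLinearEquiv.isOpen.preimage (hqs.continuous_fderiv (by simp)))
  set Θ := (ContDiffAt.toOpenPartialHomeomorph q (hqs.contDiffAt (x := z₀)) hq₀
    (by simp)).restrOpen S' hS' with hΘ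
  have hΘq : ∀ z, Θ z = q z := fun _ => rfl
  have hz₀Θ : z₀ ∈ Θ.source :=
    ⟨ContDiffAt.mem_toOpenPartialHomeomorph_source (hqs.contDiffAt (x := z₀)) hq₀ (by simp),
      hz₀, ⟨T, hq₀.fderiv.symm⟩⟩
  have hsrc : ∀ z ∈ Θ.source, z ∈ S' := fun z hz => hz.2
  have hval : ∀ y, (y, δ) ∈ Θ.target → q (Θ.symm (y, δ)) = (y, δ) := fun y hy => by
    rw [← hΘq]
    exact Θ.right_inv hy
  refine ⟨{
    proj := A
    param := fun y => Θ.symm (y, δ)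
    dom := Θ.source
    tgt := {y | (y, δ) ∈ Θ.target}
    isOpen_dom := Θ.open_source
    isOpen_tgt := Θ.open_target.preimage (continuous_id.prodMk continuous_const)
    smooth := fun y hy => ?_
    param_mem := fun y hy => ⟨(hsrc _ (Θ.map_target hy)).1, congrArg Prod.snd (hval y hy)⟩
    param_mem_dom := fun y hy => Θ.map_target hy
    proj_param := fun y hy => congrArg Prod.fst (hval y hy)
    proj_mem := fun z hz hzd => ?_
    param_proj := fun z hz hzd => ?_ }, hz₀Θ⟩
  · obtain ⟨T', hT'⟩ := (hsrc _ (Θ.map_target hy)).2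
    have h1 : HasFDerivAt Θ (T' : Cn n →L[ℝ] EuclideanSpace ℝ (Fin (2 * n)) × ℂ)
        (Θ.symm (y, δ)) := by
      rw [hT']
      exact (hqs.differentiable (by simp) _).hasFDerivAt
    have h2 : ContDiffAt ℝ ∞ Θ.symm (y, δ) := Θ.contDiffAt_symm hy h1 hqs.contDiffAt
    have h3 : ContDiff ℝ ∞ fun y : EuclideanSpace ℝ (Fin (2 * n)) => (y, δ) :=
      contDiff_id.prodMk contDiff_const
    exact (ContDiffAt.comp y h2 h3.contDiffAt).contDiffWithinAt
  · have : Θ z = (A z, δ) := by rw [hΘq, hq, ← hz.2]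
    simpa only [Set.mem_ofPred_eq, this] using Θ.map_source hzd
  · have : Θ z = (A z, δ) := by rw [hΘq, hq, ← hz.2]
    rw [← this, Θ.left_inv hzd]

/-- The part of the level set `h⁻¹(δ)` in the open set `S`, as a submanifold. -/
def levelSubmanifold {h : Cn n → ℂ} (hh : ContDiff ℝ ∞ h) {S : Set (Cn n)} (hS : IsOpen S)
    (δ : ℂ) (hs : ∀ z ∈ S, h z = δ → Function.Surjective (fderiv ℝ h z)) :
    Submanifold (Cn n) (EuclideanSpace ℝ (Fin (2 * n))) where
  set := {z | z ∈ S ∧ h z = δ}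
  chart z := (exists_linearChart hh hS z.2.1 (hs z z.2.1 z.2.2)).choose
  mem_dom z := (exists_linearChart hh hS z.2.1 (hs z z.2.1 z.2.2)).choose_spec

/-- The differential of the inverse of a chart of a level set is injective, with image the kernel of
the differential of the function. -/
theorem LinearChart.fderiv_param {h : Cn n → ℂ} (hh : ContDiff ℝ ∞ h) {S : Set (Cn n)} {δ : ℂ}
    (c : LinearChart (Cn n) (EuclideanSpace ℝ (Fin (2 * n))) {z | z ∈ S ∧ h z = δ})
    {y : EuclideanSpace ℝ (Fin (2 * n))} (hy : y ∈ c.tgt)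
    (hs : Function.Surjective (fderiv ℝ h (c.param y))) :
    Function.Injective (fderiv ℝ c.param y) ∧
      ∀ v, fderiv ℝ h (c.param y) v = 0 ↔ ∃ w, fderiv ℝ c.param y w = v := by
  have hnhds := c.isOpen_tgt.mem_nhds hy
  have hp := ((c.smooth.contDiffAt hnhds).differentiableAt (by simp)).hasFDerivAt
  have h1 : (c.proj.comp (fderiv ℝ c.param y)) = ContinuousLinearMap.id ℝ _ := by
    have e : (fun y => c.proj (c.param y)) =ᶠ[𝓝 y] id := by
      filter_upwards [hnhds] with y' hy' using c.proj_param y' hy'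
    exact ((c.proj.hasFDerivAt.comp y hp).congr_of_eventuallyEq e.symm).unique (hasFDerivAt_id y)
  have h2 : (fderiv ℝ h (c.param y)).comp (fderiv ℝ c.param y) = 0 := by
    have e : (fun y => h (c.param y)) =ᶠ[𝓝 y] fun _ => δ := by
      filter_upwards [hnhds] with y' hy' using (c.param_mem y' hy').2
    exact (((hh.differentiable (by simp) _).hasFDerivAt.comp y hp).congr_of_eventuallyEq
      e.symm).unique (hasFDerivAt_const δ y)
  have hinj : Function.Injective (fderiv ℝ c.param y) :=
    Function.LeftInverse.injective (g := c.proj) fun v => congrArg (fun l => l v) h1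
  -- Since `(A, dh)` is injective, `A` is injective on the kernel of `dh`. This kernel contains the
  -- image of `d param`, so `A ∘ d param` is injective, hence bijective by dimension; this shows
  -- that the image is the whole kernel.
  obtain ⟨A, T, hT⟩ := exists_equiv_prod hs
  have hinj' : Function.Injective fun w => A (fderiv ℝ c.param y w) := by
    intro w w' hw
    apply hinj
    apply T.injective
    have key : ∀ v, T v = (A v, fderiv ℝ h (c.param y) v) := fun v =>
      congrArg (fun l => l v) hT
    have h2' : ∀ v, fderiv ℝ h (c.param y) (fderiv ℝ c.param y v) = 0 := fun v =>
      congrArg (fun l => l v) h2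
    rw [key, key, h2', h2']
    exact Prod.ext hw rfl
  have hsurj : Function.Surjective (A.comp (fderiv ℝ c.param y)).toLinearMap :=
    LinearMap.injective_iff_surjective.1 hinj'
  refine ⟨hinj, fun v => ⟨fun hv => ?_, ?_⟩⟩
  · obtain ⟨w, hw⟩ := hsurj (A v)
    refine ⟨w, T.injective ?_⟩
    have key : ∀ v, T v = (A v, fderiv ℝ h (c.param y) v) := fun v =>
      congrArg (fun l => l v) hT
    have h2' : fderiv ℝ h (c.param y) (fderiv ℝ c.param y w) = 0 := congrArg (fun l => l w) h2
    rw [key, key, h2', hv]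
    exact Prod.ext hw rfl
  · rintro ⟨w, rfl⟩
    exact congrArg (fun l => l w) h2

/-! ### Retraction to a level set -/

/-- With the defect `w = δ - h z` frozen as a parameter, the field `lift (dh) w` raises `h` by `w`
in unit time, and it vanishes for `w = 0`. The time-one map is the retraction. It turns maps on the
level set into smooth maps on a neighbourhood, as the definition of a completion demands. -/
theorem exists_retraction {h : Cn n → ℂ} (hh : ContDiff ℝ ∞ h) {δ : ℂ} {r R : ℝ} (hrR : r < R)
    (hd : ∀ z, ‖z‖ ≤ r → h z = δ → pfaffian (fderiv ℝ h z) ≠ 0) :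
    ∃ (U : Set (Cn n)) (ρ : Cn n → Cn n), IsOpen U ∧ fiber h δ r ⊆ U ∧ ContDiff ℝ ∞ ρ ∧
      (∀ z ∈ U, ‖ρ z‖ < R ∧ h (ρ z) = δ) ∧ (∀ z ∈ fiber h δ r, ρ z = z) ∧
      ∀ z ∈ fiber h δ r, ∀ v, fderiv ℝ h z v = 0 → fderiv ℝ ρ z v = v := by
  set O : Set (Cn n × ℂ) := {p | pfaffian (fderiv ℝ h p.1) ≠ 0}
  have hO : IsOpen O := isOpen_pfaffian_ne_zero.preimage
    ((hh.continuous_fderiv (by simp)).comp continuous_fst)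
  have hK : IsCompact (fiber h δ r) := by
    have : fiber h δ r = Metric.closedBall 0 r ∩ h ⁻¹' {δ} := by
      ext z
      simp [fiber]
    rw [this]
    exact (isCompact_closedBall 0 r).inter_right (isClosed_singleton.preimage hh.continuous)
  obtain ⟨ξ, hξ, hξc, hξO, hξ1, -⟩ := exists_cutoff (hK.prod (isCompact_singleton (x := (0 : ℂ))))
    hO (fun p hp => hd p.1 hp.1.1 hp.1.2)
  set V : Cn n × ℂ → Cn n := fun p => ξ p • lift (fderiv ℝ h p.1) p.2 with hV
  have hVs : ContDiff ℝ ∞ V := by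
    refine contDiff_smul_of_tsupport_subset hO hξ hξO fun p hp => ?_
    have h1 : ContDiff ℝ ∞ (fun p : Cn n × ℂ => (fderiv ℝ h p.1, p.2)) :=
      ((hh.fderiv_right (m := ∞) (by simp)).comp contDiff_fst).prodMk contDiff_snd
    exact (ContDiffAt.comp p (contDiffAt_lift hp p.2) h1.contDiffAt).contDiffWithinAt
  have hVc : HasCompactSupport fun p => (V p, (0 : ℂ)) :=
    (hξc.smul_right (f' := fun p => lift (fderiv ℝ h p.1) p.2)).mono fun p hp => by
      intro h0
      exact hp (by simpa [hV] using h0)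
  obtain ⟨Φ, hΦ⟩ := exists_isFlow_of_hasCompactSupport (hVs.prodMk contDiff_const) hVc
  have hsnd : ∀ t p, (Φ t p).2 = p.2 := fun t p => by
    have h1 : ∀ t, HasDerivAt (fun t => (Φ t p).2) 0 t := fun t =>
      hasDerivAt_prod_snd (hΦ.hasDerivAt t p)
    rw [is_const_of_deriv_eq_zero (fun t => (h1 t).differentiableAt) (fun t => (h1 t).deriv) t 0,
      hΦ.zero]
  have hstat : ∀ t z, Φ t (z, 0) = (z, 0) := fun t z =>
    hΦ.eq_self_of_eq_zero (by simp [hV]) t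
  have hstart : ContDiff ℝ ∞ fun z => (z, δ - h z) := contDiff_id.prodMk (contDiff_const.sub hh)
  set ρ : Cn n → Cn n := fun z => (Φ 1 (z, δ - h z)).1 with hρ
  have hρs : ContDiff ℝ ∞ ρ := contDiff_fst.comp ((hΦ.contDiff_apply 1).comp hstart)
  have hρfix : ∀ z ∈ fiber h δ r, ρ z = z := fun z hz => by simp [hρ, hz.2, hstat]
  refine ⟨interior {z | ‖ρ z‖ < R ∧ h (ρ z) = δ}, ρ, isOpen_interior, fun z hz => ?_, hρs,
    fun z hz => (interior_subset hz : z ∈ {z | ‖ρ z‖ < R ∧ h (ρ z) = δ}), hρfix, fun z hz v hv => ?_⟩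
  · rw [mem_interior_iff_mem_nhds]
    -- Points of the level are stationary, so by compactness of `[0, 1]` the orbits of nearby points
    -- stay where the cutoff equals `1`.
    have hev : ∀ᶠ y in 𝓝 z, ∀ t ∈ Set.Icc (0 : ℝ) 1, ξ (Φ t (y, δ - h y)) = 1 := by
      refine isCompact_Icc.eventually_forall_of_forall_eventually fun t _ => ?_
      have hc : Continuous fun p : Cn n × ℝ => Φ p.2 (p.1, δ - h p.1) :=
        hΦ.smooth.continuous.comp (continuous_snd.prodMk (hstart.continuous.comp continuous_fst))
      refine (hc.tendsto (z, t)).eventually (hξ1 _ ?_)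
      simp only [hz.2, sub_self, hstat]
      exact ⟨hz, rfl⟩
    have hR : ∀ᶠ y in 𝓝 z, ‖ρ y‖ < R := by
      refine (hρs.continuous.norm.tendsto z).eventually (gt_mem_nhds ?_)
      rw [hρfix z hz]
      exact hz.1.trans_lt hrR
    filter_upwards [hev, hR] with y hy hyR
    refine ⟨hyR, ?_⟩
    have hder : ∀ t ∈ Set.Icc (0 : ℝ) 1,
        HasDerivAt (fun t => h (Φ t (y, δ - h y)).1 - t • (δ - h y)) 0 t := fun t ht => by
      have h1 := (hh.differentiable (by simp) _).hasFDerivAt.comp_hasDerivAt t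
        (hasDerivAt_prod_fst (hΦ.hasDerivAt t (y, δ - h y)))
      refine (h1.fun_sub ((hasDerivAt_id t).smul_const (δ - h y))).congr_deriv ?_
      have h2 : Φ t (y, δ - h y) ∈ tsupport ξ := subset_tsupport _ (by
        rw [Function.mem_support, hy t ht]
        exact one_ne_zero)
      simp only [hV, hy t ht, one_smul]
      rw [apply_lift (hξO h2), hsnd, sub_self]
    have := constant_of_has_deriv_right_zero (a := 0) (b := 1)
      (fun t ht => (hder t ht).continuousAt.continuousWithinAt)
      (fun t ht => (hder t ⟨ht.1, ht.2.le⟩).hasDerivWithinAt) 1 ⟨zero_le_one, le_rfl⟩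
    simp only [one_smul, zero_smul, hΦ.zero, sub_zero] at this
    rw [hρ]
    simp only
    linear_combination this
  -- For `v` in the kernel of `dh` the defect does not change to first order, and for `w = 0` the
  -- flow is the identity in `z`.
  · have h1 : HasFDerivAt (Φ 1) (fderiv ℝ (Φ 1) (z, 0)) (z, δ - h z) := by
      rw [hz.2, sub_self]
      exact ((hΦ.contDiff_apply 1).differentiable (by simp) _).hasFDerivAt
    have h2 : HasFDerivAt (fun z => (z, δ - h z)) _ z :=
      (hasFDerivAt_id z).prodMk ((hh.differentiable (by simp) z).hasFDerivAt.const_sub δ)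
    have h3 : HasFDerivAt ρ _ z := (h1.comp z h2).fst
    have h4 : HasFDerivAt (fun y : Cn n => (Φ 1 (y, 0)).1) _ z :=
      (HasFDerivAt.comp z ((hΦ.contDiff_apply 1).differentiable (by simp) _).hasFDerivAt
        (hasFDerivAt_prodMk_left z (0 : ℂ))).fst
    have h5 : (fun y : Cn n => (Φ 1 (y, 0)).1) = id := by
      funext y
      simp [hstat]
    rw [h5] at h4
    have h6 := congrArg (fun l => l v) (h4.unique (hasFDerivAt_id z))
    rw [h3.fderiv]
    simpa [hv] using h6

end MilnorFibers

/-! ### A model of the Liouville completion inside the open ball of radius `R`. -/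

namespace MilnorFibers

open SmoothFlow

variable {n : ℕ}

/-! ### The weight of the completion -/

/-- The numerator of the logarithmic derivative of the weight. -/
def weightNum (r s : ℝ) : ℝ := expNegInvGlue (s - r ^ 2)

/-- The denominator of the logarithmic derivative of the weight. -/
def weightDen (R s : ℝ) : ℝ := expNegInvGlue (R ^ 2 - s)

theorem contDiff_weightNum (r : ℝ) : ContDiff ℝ ∞ (weightNum r) :=
  expNegInvGlue.contDiff.comp (contDiff_id.sub contDiff_const)

theorem contDiff_weightDen (R : ℝ) : ContDiff ℝ ∞ (weightDen R) :=
  expNegInvGlue.contDiff.comp (contDiff_const.sub contDiff_id)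

theorem weightNum_nonneg (r s : ℝ) : 0 ≤ weightNum r s := expNegInvGlue.nonneg _

theorem weightNum_eq_zero {r s : ℝ} (h : s ≤ r ^ 2) : weightNum r s = 0 :=
  expNegInvGlue.zero_of_nonpos (by linarith)

theorem weightNum_pos {r s : ℝ} (h : r ^ 2 < s) : 0 < weightNum r s :=
  expNegInvGlue.pos_of_pos (by linarith)

theorem weightDen_nonneg (R s : ℝ) : 0 ≤ weightDen R s := expNegInvGlue.nonneg _

theorem weightDen_eq_zero {R s : ℝ} (h : R ^ 2 ≤ s) : weightDen R s = 0 :=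
  expNegInvGlue.zero_of_nonpos (by linarith)

theorem weightDen_pos {R s : ℝ} (h : s < R ^ 2) : 0 < weightDen R s :=
  expNegInvGlue.pos_of_pos (by linarith)

/-- A weight which is `1` up to `r²` and is increasing up to `R²`. -/
def weight (r R s : ℝ) : ℝ := Real.exp (∫ x in (0 : ℝ)..s, weightNum r x / weightDen R x)

theorem weight_pos (r R s : ℝ) : 0 < weight r R s := Real.exp_pos _

theorem weight_eq_one {r R s : ℝ} (h : s ≤ r ^ 2) : weight r R s = 1 := by
  rw [weight, intervalIntegral.integral_congr (g := fun _ => 0), intervalIntegral.integral_zero,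
    Real.exp_zero]
  intro x hx
  have : x ≤ max 0 s := hx.2
  simp [weightNum_eq_zero (this.trans (max_le (sq_nonneg r) h))]

theorem hasDerivAt_weight (r : ℝ) {R s : ℝ} (hR : R ≠ 0) (hs : s < R ^ 2) :
    HasDerivAt (weight r R) (weight r R s * (weightNum r s / weightDen R s)) s := by
  have hc : ∀ x < R ^ 2, ContinuousAt (fun x => weightNum r x / weightDen R x) x := fun x hx =>
    (contDiff_weightNum r).continuous.continuousAt.div
      (contDiff_weightDen R).continuous.continuousAt (weightDen_pos hx).ne'
  have h := intervalIntegral.integral_hasDerivAt_right (a := 0) (b := s)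
    (ContinuousOn.intervalIntegrable fun x hx =>
      (hc x (hx.2.trans_lt (max_lt (by positivity) hs))).continuousWithinAt)
    (ContinuousOn.stronglyMeasurableAtFilter isOpen_Iio (s := Set.Iio (R ^ 2))
      (fun x hx => (hc x hx).continuousWithinAt) s hs) (hc s hs)
  exact h.exp

theorem contDiffOn_weight (r : ℝ) {R : ℝ} (hR : R ≠ 0) :
    ContDiffOn ℝ ∞ (weight r R) (Set.Iio (R ^ 2)) := by
  have hlog : ContDiffOn ℝ ∞ (fun s => ∫ x in (0 : ℝ)..s, weightNum r x / weightDen R x)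
      (Set.Iio (R ^ 2)) := by
    have hd : ∀ s ∈ Set.Iio (R ^ 2), HasDerivAt
        (fun s => ∫ x in (0 : ℝ)..s, weightNum r x / weightDen R x)
        (weightNum r s / weightDen R s) s := fun s hs => by
      have := (hasDerivAt_weight r hR hs).log (weight_pos r R s).ne'
      simpa [weight, Real.exp_ne_zero] using this
    rw [contDiffOn_infty_iff_deriv_of_isOpen isOpen_Iio]
    refine ⟨fun s hs => (hd s hs).differentiableAt.differentiableWithinAt, ?_⟩
    exact ((contDiff_weightNum r).contDiffOn.div (contDiff_weightDen R).contDiffOn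
      fun s hs => (weightDen_pos hs).ne').congr fun s hs => (hd s hs).deriv
  exact hlog.exp

/-! ### The Liouville form of the completion -/

/-- The real part of the Hermitian product as a bilinear map. -/
def reInner : Cn n →L[ℝ] Cn n →L[ℝ] ℝ :=
  omega.bilinearComp (ContinuousLinearMap.id ℝ (Cn n))
    ((ContinuousLinearMap.lsmul ℝ ℂ : ℂ →L[ℝ] Cn n →L[ℝ] Cn n) Complex.I)

theorem reInner_apply (v w : Cn n) : reInner v w = (inner ℂ v w).re := omega_I_smul v w

theorem reInner_comm (v w : Cn n) : reInner v w = reInner w v := by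
  rw [reInner_apply, reInner_apply, ← inner_conj_symm, Complex.conj_re]

theorem reInner_self (v : Cn n) : reInner v v = ‖v‖ ^ 2 := by
  rw [reInner_apply]
  exact inner_self_eq_norm_sq (𝕜 := ℂ) v

theorem hasFDerivAt_norm_sq (z : Cn n) :
    HasFDerivAt (fun z : Cn n => ‖z‖ ^ 2) ((2 : ℝ) • reInner z) z := by
  have h := (reInner (n := n)).hasFDerivAt (x := z) |>.clm_apply (hasFDerivAt_id z)
  simp only [id, reInner_self] at h
  refine h.congr_fderiv ?_
  ext v
  simp [reInner_comm v z]
  ring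

theorem contDiff_norm_sq' : ContDiff ℝ ∞ fun z : Cn n => ‖z‖ ^ 2 := contDiff_norm_sq ℂ

/-- The standard primitive, multiplied by the weight. -/
def weightedForm (r R : ℝ) (z : Cn n) : Cn n →L[ℝ] ℝ :=
  (weight r R (‖z‖ ^ 2) / 2) • omega z

theorem weightedForm_apply (r R : ℝ) (z v : Cn n) :
    weightedForm r R z v = weight r R (‖z‖ ^ 2) * stdPrimitive z v := by
  rw [weightedForm, smul_apply, stdPrimitive_eq_omega, smul_eq_mul]
  ring

theorem weightedForm_of_norm_le {r R : ℝ} {z : Cn n} (h : ‖z‖ ≤ r) (v : Cn n) :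
    weightedForm r R z v = stdPrimitive z v := by
  rw [weightedForm_apply, weight_eq_one (by gcongr), one_mul]

theorem sq_norm_lt {R : ℝ} {z : Cn n} (hz : ‖z‖ < R) : ‖z‖ ^ 2 < R ^ 2 := by gcongr

theorem contDiffAt_weightedForm (r : ℝ) {R : ℝ} {z : Cn n} (hz : ‖z‖ < R) :
    ContDiffAt ℝ ∞ (weightedForm r R) z := by
  have hR : R ≠ 0 := ((norm_nonneg z).trans_lt hz).ne'
  have h1 : ContDiffAt ℝ ∞ (fun z : Cn n => weight r R (‖z‖ ^ 2)) z :=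
    ContDiffAt.comp (g := weight r R) (f := fun z : Cn n => ‖z‖ ^ 2) z
      ((contDiffOn_weight r hR).contDiffAt (isOpen_Iio.mem_nhds (sq_norm_lt hz)))
      contDiff_norm_sq'.contDiffAt
  exact (h1.div_const 2).smul omega.contDiff.contDiffAt

theorem hasFDerivAt_weight_norm_sq (r : ℝ) {R : ℝ} {z : Cn n} (hz : ‖z‖ < R) :
    HasFDerivAt (fun z : Cn n => weight r R (‖z‖ ^ 2))
      ((weight r R (‖z‖ ^ 2) * (weightNum r (‖z‖ ^ 2) / weightDen R (‖z‖ ^ 2)))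
        • (2 : ℝ) • reInner z) z := by
  have hR : R ≠ 0 := ((norm_nonneg z).trans_lt hz).ne'
  exact HasDerivAt.comp_hasFDerivAt (h₂ := weight r R) (f := fun z : Cn n => ‖z‖ ^ 2) z
    (hasDerivAt_weight r hR (sq_norm_lt hz))
    (hasFDerivAt_norm_sq z)

theorem extDeriv_weightedForm (r : ℝ) {R : ℝ} {z : Cn n} (hz : ‖z‖ < R) (v w : Cn n) :
    fderiv ℝ (weightedForm r R) z v w - fderiv ℝ (weightedForm r R) z w v
      = weight r R (‖z‖ ^ 2) * (2 * (weightNum r (‖z‖ ^ 2) / weightDen R (‖z‖ ^ 2))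
        * (reInner z v * stdPrimitive z w - reInner z w * stdPrimitive z v) + omega v w) := by
  have h1 := ((hasFDerivAt_weight_norm_sq r hz).mul_const (2⁻¹ : ℝ)).fun_smul
    (omega.hasFDerivAt (x := z))
  have h2 : weightedForm (n := n) r R = fun z => (weight r R (‖z‖ ^ 2) * 2⁻¹) • omega z := by
    funext z
    rw [weightedForm, div_eq_mul_inv]
  rw [h2, h1.fderiv]
  simp only [stdPrimitive_eq_omega, add_apply, smul_apply, ContinuousLinearMap.smulRight_apply,
    smul_eq_mul]
  rw [omega_antisymm w v]
  ring

/-- Nondegeneracy of the exterior derivative of a weighted form on the kernel of `L`. -/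
theorem eq_zero_of_weighted {z : Cn n} {L : Cn n →L[ℝ] ℂ} (hL : pfaffian L ≠ 0) {c : ℝ}
    (hc : 0 < 1 + 2 * c * radial z L) {v : Cn n} (hv : L v = 0)
    (h : ∀ w, L w = 0 → 2 * c * (reInner z v * stdPrimitive z w - reInner z w * stdPrimitive z v)
      + omega v w = 0) : v = 0 := by
  set X := liouville z L with hX
  have hXL : L X = 0 := apply_liouville z hL
  have hr : reInner z X = radial z L := reInner_apply z X
  -- Testing with the Liouville vector `X`, where `θ(X) = 0`, gives `θ(v) = 0`. The remaining
  -- identity makes `v` a multiple of `X`, and pairing with `z` shows that this multiple is zero.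
  -- Both times the factor `1 + 2c · radial` is cancelled.
  have h1 := h X hXL
  rw [stdPrimitive_liouville z hL, hr, omega_antisymm, omega_liouville z hv] at h1
  have h2 : stdPrimitive z v = 0 := by
    have : (1 + 2 * c * radial z L) * stdPrimitive z v = 0 := by linear_combination -h1
    exact (mul_eq_zero.1 this).resolve_left hc.ne'
  have h3 : v + (2 * c * reInner z v) • X = 0 := by
    refine eq_zero_of_omega_ker hL (by rw [map_add, map_smul, hv, hXL, smul_zero, add_zero])
      fun w hw => ?_
    have := h w hw
    rw [h2] at this
    rw [map_add, map_smul, add_apply, smul_apply, omega_liouville z hw, smul_eq_mul]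
    linear_combination this
  have h4 : reInner z v = 0 := by
    have := congrArg (reInner z) h3
    rw [map_add, map_smul, map_zero, hr, smul_eq_mul] at this
    have : (1 + 2 * c * radial z L) * reInner z v = 0 := by linear_combination this
    exact (mul_eq_zero.1 this).resolve_left hc.ne'
  simpa [h4] using h3

end MilnorFibers

namespace MilnorFibers

open SmoothFlow

variable {n : ℕ}

/-! ### The Liouville flow of the completion -/

theorem isCompact_fiber {h : Cn n → ℂ} (hh : Continuous h) (δ : ℂ) (r : ℝ) :
    IsCompact (fiber h δ r) := by
  have : fiber h δ r = Metric.closedBall 0 r ∩ h ⁻¹' {δ} := by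
    ext z
    simp [fiber]
  rw [this]
  exact (isCompact_closedBall 0 r).inter_right (isClosed_singleton.preimage hh)

theorem contDiffAt_radial_fderiv {h : Cn n → ℂ} {z : Cn n} (hh : ContDiffAt ℝ ∞ (fderiv ℝ h) z)
    (hz : pfaffian (fderiv ℝ h z) ≠ 0) :
    ContDiffAt ℝ ∞ (fun z => radial z (fderiv ℝ h z)) z := by
  have h1 : ContDiffAt ℝ ∞ (fun z => (z, fderiv ℝ h z)) z := contDiffAt_id.prodMk hh
  have h2 := contDiffAt_radial z hz
  generalize hg : (fun p : Cn n × (Cn n →L[ℝ] ℂ) => radial p.1 p.2) = g at h2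
  have h3 := ContDiffAt.comp z h2 h1
  rw [← hg] at h3
  exact h3

theorem contDiffAt_liouville_fderiv {h : Cn n → ℂ} {z : Cn n} (hh : ContDiffAt ℝ ∞ (fderiv ℝ h) z)
    (hz : pfaffian (fderiv ℝ h z) ≠ 0) :
    ContDiffAt ℝ ∞ (fun z => liouville z (fderiv ℝ h z)) z := by
  have h1 : ContDiffAt ℝ ∞ (fun z => (z, fderiv ℝ h z)) z := contDiffAt_id.prodMk hh
  have h2 := contDiffAt_liouville z hz
  generalize hg : (fun p : Cn n × (Cn n →L[ℝ] ℂ) => liouville p.1 p.2) = g at h2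
  have h3 := ContDiffAt.comp z h2 h1
  rw [← hg] at h3
  exact h3

/-- The Liouville vector field of the weighted form on the level set `h⁻¹(δ)`, extended to the
ambient space. -/
theorem exists_liouvilleField {h : Cn n → ℂ} (hh : ContDiff ℝ ∞ h) {δ : ℂ} {r r₁ R : ℝ}
    (hr : 0 < r) (hr₁ : r ≤ r₁) (hR : r₁ < R)
    (hd : ∀ z, ‖z‖ ≤ R → h z = δ → pfaffian (fderiv ℝ h z) ≠ 0)
    (hm : ∀ z, r ≤ ‖z‖ → ‖z‖ ≤ R → h z = δ → 0 < radial z (fderiv ℝ h z)) :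
    ∃ Z : Cn n → Cn n, ContDiff ℝ ∞ Z ∧ HasCompactSupport Z ∧ (∀ z, R ≤ ‖z‖ → Z z = 0) ∧
      (∀ z, fderiv ℝ h z (Z z) = 0) ∧ (∀ z, stdPrimitive z (Z z) = 0) ∧
      (∀ z, r ≤ ‖z‖ → ‖z‖ < R → h z = δ → 0 < reInner z (Z z)) ∧
      ∀ z, ‖z‖ < R → h z = δ → ∀ w, fderiv ℝ h z w = 0 →
        2 * (weightNum r₁ (‖z‖ ^ 2) / weightDen R (‖z‖ ^ 2))
          * (reInner z (Z z) * stdPrimitive z w) + omega (Z z) w = stdPrimitive z w := by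
  have hR0 : 0 < R := by linarith
  -- With logarithmic derivative `num / den` of the weight, the Liouville field of the weighted form
  -- is `X / (1 + 2 (num / den) radial) = (den / D) X`. On the closed ball `D > 0`: inside because
  -- of `den`, on the sphere of radius `R` because of `num · radial`. So the field is smooth up to
  -- that sphere and vanishes there.
  set D : Cn n → ℝ := fun z => weightDen R (‖z‖ ^ 2)
    + 2 * weightNum r₁ (‖z‖ ^ 2) * radial z (fderiv ℝ h z) with hD
  set O : Set (Cn n) := {z | pfaffian (fderiv ℝ h z) ≠ 0 ∧ 0 < D z} with hOdef
  have hjet : ContDiff ℝ ∞ (fderiv ℝ h) := hh.fderiv_right (m := ∞) (by simp)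
  have hden : ContDiff ℝ ∞ fun z : Cn n => weightDen R (‖z‖ ^ 2) :=
    (contDiff_weightDen R).comp contDiff_norm_sq'
  have hnum : ContDiff ℝ ∞ fun z : Cn n => weightNum r₁ (‖z‖ ^ 2) :=
    (contDiff_weightNum r₁).comp contDiff_norm_sq'
  have hDs : ∀ z, pfaffian (fderiv ℝ h z) ≠ 0 → ContDiffAt ℝ ∞ D z := fun z hz =>
    hden.contDiffAt.add ((contDiff_const.mul hnum).contDiffAt.mul
      (contDiffAt_radial_fderiv hjet.contDiffAt hz))
  have hO : IsOpen O := by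
    rw [isOpen_iff_mem_nhds]
    rintro z ⟨h1, h2⟩
    filter_upwards [(isOpen_pfaffian_ne_zero.preimage
      (hh.continuous_fderiv (by simp))).mem_nhds h1,
      (hDs z h1).continuousAt.eventually (lt_mem_nhds h2)] with y hy1 hy2
    exact ⟨hy1, hy2⟩
  have hDpos : ∀ z, ‖z‖ ≤ R → h z = δ → 0 < D z := by
    intro z hz hzδ
    rcases hz.lt_or_eq with hlt | heq
    · refine add_pos_of_pos_of_nonneg (weightDen_pos (sq_norm_lt hlt)) ?_
      rcases le_or_gt ‖z‖ r₁ with h1 | h1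
      · rw [weightNum_eq_zero (by gcongr), mul_zero, zero_mul]
      · exact mul_nonneg (mul_nonneg zero_le_two (weightNum_nonneg _ _))
          (hm z (hr₁.trans h1.le) hz hzδ).le
    · refine add_pos_of_nonneg_of_pos (weightDen_nonneg _ _) ?_
      have h1 : 0 < weightNum r₁ (‖z‖ ^ 2) := weightNum_pos (by
        rw [heq]
        have : 0 < r₁ := by linarith
        gcongr)
      have := hm z (by linarith) hz hzδ
      positivity
  obtain ⟨ξ, hξ, hξc, hξO, hξ1, -⟩ := exists_cutoff (isCompact_fiber hh.continuous δ R) hO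
    (fun z hz => ⟨hd z hz.1 hz.2, hDpos z hz.1 hz.2⟩)
  have hξ1' : ∀ z, ‖z‖ < R → h z = δ → ξ z = 1 := fun z hz hzδ =>
    (hξ1 z ⟨hz.le, hzδ⟩).self_of_nhds
  set Z : Cn n → Cn n :=
    fun z => ξ z • (weightDen R (‖z‖ ^ 2) / D z) • liouville z (fderiv ℝ h z)
  have hZ : ∀ z, Z z = ξ z • (weightDen R (‖z‖ ^ 2) / D z) • liouville z (fderiv ℝ h z) :=
    fun _ => rfl
  refine ⟨Z, ?_, hξc.smul_right, fun z hz => ?_, fun z => ?_, fun z => ?_, fun z hrz hz hzδ => ?_,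
    fun z hz hzδ w hw => ?_⟩
  · refine contDiff_smul_of_tsupport_subset hO hξ hξO fun z hz => ?_
    exact ((hden.contDiffAt.div (hDs z hz.1) hz.2.ne').smul
      (contDiffAt_liouville_fderiv hjet.contDiffAt hz.1)).contDiffWithinAt
  · rw [hZ, weightDen_eq_zero (by gcongr), zero_div, zero_smul, smul_zero]
  · by_cases hz : z ∈ tsupport ξ
    · rw [hZ, map_smul, map_smul, apply_liouville z (hξO hz).1, smul_zero, smul_zero]
    · rw [hZ, image_eq_zero_of_notMem_tsupport hz, zero_smul, map_zero]
  · by_cases hz : z ∈ tsupport ξ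
    · have := stdPrimitive_liouville z (hξO hz).1
      rw [stdPrimitive_eq_omega] at this ⊢
      rw [hZ, map_smul, map_smul, (div_eq_zero_iff.1 this).resolve_right two_ne_zero, smul_zero,
        smul_zero, zero_div]
    · rw [hZ, image_eq_zero_of_notMem_tsupport hz, zero_smul, stdPrimitive_eq_omega,
        map_zero, zero_div]
  · rw [hZ, hξ1' z hz hzδ, one_smul, map_smul, smul_eq_mul]
    exact mul_pos (div_pos (weightDen_pos (sq_norm_lt hz)) (hDpos z hz.le hzδ))
      ((hm z hrz hz.le hzδ).trans_eq (reInner_apply _ _).symm)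
  · have hr : reInner z (liouville z (fderiv ℝ h z)) = radial z (fderiv ℝ h z) :=
      reInner_apply _ _
    have h1 := weightDen_pos (sq_norm_lt hz)
    have h2 := hDpos z hz.le hzδ
    rw [hZ, hξ1' z hz hzδ, one_smul, map_smul, map_smul, smul_apply, omega_liouville z hw,
      smul_eq_mul, smul_eq_mul, hr]
    have h3 : weightDen R (‖z‖ ^ 2)
      + 2 * weightNum r₁ (‖z‖ ^ 2) * radial z (fderiv ℝ h z) ≠ 0 := h2.ne'
    simp only [hD]
    field_simp
    ring

/-- The Liouville flow of the weighted form on the level set `h⁻¹(δ)`. -/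
structure IsLiouvilleFlow (h : Cn n → ℂ) (δ : ℂ) (r r₁ R : ℝ) (Φ : ℝ → Cn n → Cn n) : Prop where
  smooth : ContDiff ℝ ∞ fun p : ℝ × Cn n => Φ p.1 p.2
  zero : ∀ z, Φ 0 z = z
  add : ∀ s t z, Φ (s + t) z = Φ s (Φ t z)
  mem : ∀ t z, ‖z‖ < R → h z = δ → ‖Φ t z‖ < R ∧ h (Φ t z) = δ
  norm_lt : ∀ z, r ≤ ‖z‖ → ‖z‖ < R → h z = δ → ∀ t, 0 < t → ‖z‖ < ‖Φ t z‖
  exists_norm_eq : ∀ z, r ≤ ‖z‖ → ‖z‖ < R → h z = δ → ∃ t, 0 ≤ t ∧ ‖Φ (-t) z‖ = r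
  weighted : ∀ t z, ‖z‖ < R → h z = δ → ∀ v, fderiv ℝ h z v = 0 →
    weightedForm r₁ R (Φ t z) (fderiv ℝ (Φ t) z v) = Real.exp t * weightedForm r₁ R z v
  hasDerivAt : ∀ t z, ∃ w, HasDerivAt (fun t => Φ t z) w t ∧ weightedForm r₁ R (Φ t z) w = 0

-- The field is compactly supported, so its flow is complete; it vanishes from radius `R` on, so the
-- open ball is invariant. Scaling by `e^t` is `L_Z λ = λ`, a consequence of `dλ(Z, ·) = λ` and
-- `λ(Z) = 0`.
set_option maxHeartbeats 1000000 in
theorem exists_isLiouvilleFlow {h : Cn n → ℂ} (hh : ContDiff ℝ ∞ h) {δ : ℂ} {r r₁ R : ℝ}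
    (hr : 0 < r) (hr₁ : r ≤ r₁) (hR : r₁ < R)
    (hd : ∀ z, ‖z‖ ≤ R → h z = δ → pfaffian (fderiv ℝ h z) ≠ 0)
    (hm : ∀ z, r ≤ ‖z‖ → ‖z‖ ≤ R → h z = δ → 0 < radial z (fderiv ℝ h z)) :
    ∃ Φ, IsLiouvilleFlow h δ r r₁ R Φ := by
  obtain ⟨Z, hZs, hZc, hZR, hZh, hZθ, hZpos, hZω⟩ := exists_liouvilleField hh hr hr₁ hR hd hm
  obtain ⟨Φ, hΦ⟩ := exists_isFlow_of_hasCompactSupport hZs hZc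
  have hhΦ : ∀ t z, h (Φ t z) = h z := fun t z => by
    have h1 : ∀ t, HasDerivAt (fun t => h (Φ t z)) 0 t := fun t =>
      ((hh.differentiable (by simp) _).hasFDerivAt.comp_hasDerivAt t
        (hΦ.hasDerivAt t z)).congr_deriv (hZh _)
    rw [is_const_of_deriv_eq_zero (fun t => (h1 t).differentiableAt) (fun t => (h1 t).deriv) t 0,
      hΦ.zero]
  have hmem : ∀ t z, ‖z‖ < R → h z = δ → ‖Φ t z‖ < R ∧ h (Φ t z) = δ := by
    refine fun t z hz hzδ => ⟨?_, (hhΦ t z).trans hzδ⟩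
    by_contra! hc
    have h1 := hΦ.eq_self_of_eq_zero (hZR _ hc) (-t)
    rw [hΦ.neg_apply] at h1
    rw [← h1] at hc
    exact hc.not_gt hz
  have hnorm : ∀ t z, HasDerivAt (fun t => ‖Φ t z‖ ^ 2) (2 * reInner (Φ t z) (Z (Φ t z))) t :=
    fun t z => by
      have h1 := hasFDerivAt_norm_sq (Φ t z)
      exact (h1.comp_hasDerivAt t (hΦ.hasDerivAt t z)).congr_deriv rfl
  have hlt : ∀ z, r ≤ ‖z‖ → ‖z‖ < R → h z = δ → ∀ t, 0 < t → ‖z‖ < ‖Φ t z‖ := by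
    intro z hrz hz hzδ t ht
    have := lt_of_deriv_pos_above (c := r ^ 2) (fun t => hnorm t z)
      (by rw [hΦ.zero]; gcongr) (fun t _ h1 => by
        have := hmem t z hz hzδ
        have := hZpos _ (le_of_sq_le_sq h1 (norm_nonneg _)) this.1 this.2
        positivity) ht
    rw [hΦ.zero] at this
    exact lt_of_pow_lt_pow_left₀ 2 (norm_nonneg _) this
  refine ⟨Φ, hΦ.smooth, hΦ.zero, hΦ.add, hmem, hlt, fun z hrz hz hzδ => ?_,
    fun t z hz hzδ v hv => ?_, fun t z => ⟨_, hΦ.hasDerivAt t z, ?_⟩⟩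
  -- If the backward orbit never reached radius `r`, it would stay in a compact shell on which the
  -- radial speed has a positive minimum `m`. Then `|·|²` would drop by at least `m t`, which is
  -- impossible at `t = ‖z‖² / m`.
  · by_contra! hne
    have hcont : Continuous fun t => ‖Φ (-t) z‖ :=
      ((hΦ.continuous_left z).comp continuous_neg).norm
    have hgt : ∀ t, 0 ≤ t → r < ‖Φ (-t) z‖ := by
      intro t ht
      by_contra! hle
      obtain ⟨s, hs, hs'⟩ := intermediate_value_Icc' ht hcont.continuousOn
        ⟨hle, by simpa [hΦ.zero] using hrz⟩
      exact hne s hs.1 hs'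
    have hK : IsCompact (fiber h δ ‖z‖ ∩ {w | r ≤ ‖w‖}) :=
      (isCompact_fiber hh.continuous δ ‖z‖).inter_right
        (isClosed_le continuous_const continuous_norm)
    have hrate : Continuous fun w => 2 * reInner w (Z w) :=
      continuous_const.mul (reInner.continuous.clm_apply hZs.continuous)
    obtain ⟨w₀, hw₀, hmin⟩ := hK.exists_isMinOn ⟨z, ⟨le_rfl, hzδ⟩, hrz⟩ hrate.continuousOn
    have hpos : 0 < 2 * reInner w₀ (Z w₀) :=
      mul_pos two_pos (hZpos w₀ hw₀.2 (hw₀.1.1.trans_lt hz) hw₀.1.2)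
    set m := 2 * reInner w₀ (Z w₀)
    have hle : ∀ t, 0 ≤ t → m ≤ 2 * reInner (Φ (-t) z) (Z (Φ (-t) z)) := by
      intro t ht
      have h1 := hmem (-t) z hz hzδ
      refine hmin ⟨⟨?_, h1.2⟩, (hgt t ht).le⟩
      rcases ht.eq_or_lt with rfl | ht
      · rw [neg_zero, hΦ.zero]
      · have := hlt _ (hgt t ht.le).le h1.1 h1.2 t ht
        rw [hΦ.apply_neg] at this
        exact this.le
    have hder : ∀ t, HasDerivAt (fun t => ‖Φ (-t) z‖ ^ 2 + m * t)
        (-(2 * reInner (Φ (-t) z) (Z (Φ (-t) z))) + m) t := fun t => by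
      have := ((hnorm (-t) z).comp t (hasDerivAt_neg t)).add ((hasDerivAt_id t).const_mul m)
      refine this.congr_deriv ?_
      ring
    have hanti := antitoneOn_of_deriv_nonpos (convex_Ici (0 : ℝ))
      (fun t _ => (hder t).continuousAt.continuousWithinAt)
      (fun t _ => (hder t).differentiableAt.differentiableWithinAt)
      (fun t ht => by
        rw [interior_Ici] at ht
        rw [(hder t).deriv]
        linarith [hle t (le_of_lt ht)])
    have hT : 0 ≤ ‖z‖ ^ 2 / m := by positivity
    have h1 := hanti Set.self_mem_Ici hT hT
    simp only [neg_zero, hΦ.zero, mul_zero, add_zero] at h1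
    rw [mul_div_cancel₀ _ hpos.ne'] at h1
    have h2 := hgt _ hT
    have : 0 < ‖Φ (-(‖z‖ ^ 2 / m)) z‖ ^ 2 := by
      have : 0 < ‖Φ (-(‖z‖ ^ 2 / m)) z‖ := hr.trans h2
      positivity
    linarith
  · set θ := weightedForm (n := n) r₁ R with hθ
    set u : ℝ → Cn n := fun t => fderiv ℝ (Φ t) z v with hu
    have hΦd : ∀ t, HasFDerivAt (Φ t) (fderiv ℝ (Φ t) z) z := fun t =>
      ((hΦ.contDiff_apply t).differentiable (by simp) z).hasFDerivAt
    have hud : ∀ t, HasDerivAt u (fderiv ℝ Z (Φ t z) (u t)) t := fun t => by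
      have h1 := hasDerivAt_fderiv_apply hΦ.smooth hΦ.hasDerivAt t z v
      have h2 : HasFDerivAt (fun x => Z (Φ t x)) _ z :=
        (hZs.differentiable (by simp) (Φ t z)).hasFDerivAt.comp z (hΦd t)
      rwa [h2.fderiv] at h1
    have huh : ∀ t, fderiv ℝ h (Φ t z) (u t) = 0 := fun t => by
      have h1 : HasFDerivAt (fun z => h (Φ t z)) _ z :=
        (hh.differentiable (by simp) (Φ t z)).hasFDerivAt.comp z (hΦd t)
      rw [show (fun z => h (Φ t z)) = h from funext (hhΦ t)] at h1
      have h2 := h1.unique (hh.differentiable (by simp) z).hasFDerivAt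
      exact (congrArg (fun l => l v) h2).trans hv
    have hq : ∀ t, HasDerivAt (fun t => θ (Φ t z) (u t)) (θ (Φ t z) (u t)) t := fun t => by
      obtain ⟨hx, hxδ⟩ := hmem t z hz hzδ
      set x := Φ t z with hxdef
      have hθd : HasFDerivAt θ (fderiv ℝ θ x) x :=
        ((contDiffAt_weightedForm r₁ hx).differentiableAt (by simp)).hasFDerivAt
      have h1 : HasDerivAt (fun t => θ (Φ t z) (u t)) _ t :=
        (hθd.comp_hasDerivAt t (hΦ.hasDerivAt t z)).clm_apply (hud t)
      refine h1.congr_deriv ?_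
      -- This is `d(λ(Z)) = 0`; it turns the derivative along the flow into the exterior derivative
      -- evaluated on `(Z, u)`.
      have h2 : fderiv ℝ θ x (u t) (Z x) + θ x (fderiv ℝ Z x (u t)) = 0 := by
        have h3 := hθd.clm_apply (hZs.differentiable (by simp) x).hasFDerivAt
        have h4 : (fun y => θ y (Z y)) = fun _ => 0 := by
          funext y
          rw [hθ, weightedForm_apply, hZθ, mul_zero]
        rw [h4] at h3
        have := congrArg (fun l => l (u t)) (h3.unique (hasFDerivAt_const (0 : ℝ) x))
        simpa [add_comm] using this
      have h5 := extDeriv_weightedForm r₁ hx (Z x) (u t)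
      have h6 := hZω x hx hxδ (u t) (huh t)
      rw [hZθ, mul_zero, sub_zero, h6] at h5
      have h7 : θ x (u t) = _ := weightedForm_apply r₁ R x (u t)
      rw [h7, ← h5]
      simp only [← hxdef, ← hθ]
      linear_combination h2
    have := eq_exp_mul_of_deriv_eq_self hq t
    rw [this]
    have h0 : Φ 0 = id := funext hΦ.zero
    simp [hu, h0]
  · rw [weightedForm_apply, hZθ, mul_zero]

end MilnorFibers

namespace MilnorFibers

open SmoothFlow

variable {n : ℕ}

/-! ### The completion of a level set -/

theorem eq_zero_of_extDeriv_weightedForm (r₁ : ℝ) {R : ℝ} {z : Cn n} {L : Cn n →L[ℝ] ℂ}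
    (hz : ‖z‖ < R) (hL : pfaffian L ≠ 0) (hm : r₁ ≤ ‖z‖ → 0 < radial z L) {v : Cn n}
    (hv : L v = 0) (h : ∀ w, L w = 0 → fderiv ℝ (weightedForm r₁ R) z v w
      - fderiv ℝ (weightedForm r₁ R) z w v = 0) : v = 0 := by
  refine eq_zero_of_weighted (z := z) (c := weightNum r₁ (‖z‖ ^ 2) / weightDen R (‖z‖ ^ 2)) hL ?_ hv
    fun w hw => ?_
  · have h3 := weightNum_nonneg r₁ (‖z‖ ^ 2)
    have h4 := weightDen_pos (sq_norm_lt hz)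
    rcases le_or_gt ‖z‖ r₁ with h1 | h1
    · rw [weightNum_eq_zero (pow_le_pow_left₀ (norm_nonneg _) h1 2)]
      simp
    · exact add_pos_of_pos_of_nonneg one_pos
        (mul_nonneg (mul_nonneg zero_le_two (div_nonneg h3 h4.le)) (hm h1.le).le)
  · have h1 := h w hw
    rw [extDeriv_weightedForm r₁ hz] at h1
    exact (mul_eq_zero.1 h1).resolve_left (weight_pos _ _ _).ne'

/-- The part of the level set `h⁻¹(δ)` in the open ball of radius `R`, with the weighted form. -/
def weightedLevel {h : Cn n → ℂ} (hh : ContDiff ℝ ∞ h) (δ : ℂ) (r₁ R : ℝ)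
    (hd : ∀ z, ‖z‖ ≤ R → h z = δ → pfaffian (fderiv ℝ h z) ≠ 0)
    (hm : ∀ z, r₁ ≤ ‖z‖ → ‖z‖ ≤ R → h z = δ → 0 < radial z (fderiv ℝ h z)) :
    ExactSymplecticManifold (2 * n) :=
  (levelSubmanifold hh (isOpen_lt continuous_norm continuous_const : IsOpen {z | ‖z‖ < R}) δ
    fun z hz hzδ => surjective_of_pfaffian (hd z (le_of_lt hz) hzδ)).toExactSymplecticManifold
    (weightedForm r₁ R) (fun z hz => contDiffAt_weightedForm r₁ hz.1) (by
      intro x₀ y hy v hv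
      obtain ⟨hz, hzδ⟩ := LinearChart.param_mem _ y hy
      have hpf := hd _ (le_of_lt hz) hzδ
      obtain ⟨hinj, hker⟩ := LinearChart.fderiv_param hh _ hy (surjective_of_pfaffian hpf)
      refine hinj ?_
      rw [map_zero]
      refine eq_zero_of_extDeriv_weightedForm r₁ hz hpf (fun h1 => hm _ h1 (le_of_lt hz) hzδ)
        ((hker _).2 ⟨v, rfl⟩) fun w hw => ?_
      obtain ⟨w', rfl⟩ := (hker w).1 hw
      exact hv w')

/-- The end is parametrized by `κ(p, t) = Φ_t p`. Norms increase strictly along the flow from radius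
`r` on, and every point of the outer shell flows back to the sphere of radius `r`, so each such
point is reached exactly once. On the domain itself the multiplier of `θ` is `1`. -/
theorem isLiouvilleCompletion_weightedLevel {h : Cn n → ℂ} (hh : ContDiff ℝ ∞ h) {δ : ℂ}
    {r r₁ R : ℝ} (hr : 0 < r) (hr₁ : r ≤ r₁) (hR : r₁ < R)
    (hd : ∀ z, ‖z‖ ≤ R → h z = δ → pfaffian (fderiv ℝ h z) ≠ 0)
    (hm : ∀ z, r ≤ ‖z‖ → ‖z‖ ≤ R → h z = δ → 0 < radial z (fderiv ℝ h z))
    (hne : (fiber h δ r).Nonempty) :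
    IsLiouvilleCompletion h δ r
      (weightedLevel hh δ r₁ R hd fun z hz => hm z (hr₁.trans hz)) := by
  classical
  have hrR : r < R := hr₁.trans_lt hR
  obtain ⟨Φ, hΦ⟩ := exists_isLiouvilleFlow hh hr hr₁ hR hd hm
  obtain ⟨U, ρ, hU, hfU, hρ, hρU, hρf, hρd⟩ := exists_retraction hh hrR
    fun z hz => hd z (hz.trans hrR.le)
  obtain ⟨z₀, hz₀⟩ := hne
  set M := levelSubmanifold hh
    (isOpen_lt continuous_norm continuous_const : IsOpen {z : Cn n | ‖z‖ < R}) δ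
    fun z hz hzδ => surjective_of_pfaffian (hd z (le_of_lt hz) hzδ)
  have hz₀M : z₀ ∈ M.set := ⟨hz₀.1.trans_lt hrR, hz₀.2⟩
  -- The maps `ι` and `κ` of a completion are total, so a default point `z₀` is required; hence the
  -- assumption that the fiber is not empty.
  set j : Cn n → M.Carrier := fun z => if hz : z ∈ M.set then M.point z hz else M.point z₀ hz₀M
    with hj
  have hval : ∀ z ∈ M.set, M.val (j z) = z := fun z hz => by simp [hj, hz]
  have hvalj : ∀ x, j (M.val x) = x := fun x =>
    M.val_injective (hval _ (M.val_mem x))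
  have hsm : ∀ {G : Type} [NormedAddCommGroup G] [NormedSpace ℝ G] {q : G → Cn n} {S : Set G},
      ContDiff ℝ ∞ q → (∀ x ∈ S, q x ∈ M.set) →
      ContMDiffOn 𝓘(ℝ, G) 𝓘(ℝ, EuclideanSpace ℝ (Fin (2 * n))) ∞ (fun x => j (q x)) S := by
    intro G _ _ q S hq hS x hx
    refine M.contMDiffWithinAt_of_val (hq.contMDiff.contMDiffAt.contMDiffWithinAt.congr
      (fun y hy => hval _ (hS y hy)) (hval _ (hS x hx)))
  have hpull : ∀ {G : Type} [NormedAddCommGroup G] [NormedSpace ℝ G] {q : G → Cn n} {S : Set G},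
      IsOpen S → ContDiff ℝ ∞ q → (∀ x ∈ S, q x ∈ M.set) → ∀ x ∈ S, ∀ v,
      M.form (weightedForm r₁ R) (j (q x)) (mfderiv 𝓘(ℝ, G) 𝓘(ℝ, EuclideanSpace ℝ (Fin (2 * n)))
        (fun x => j (q x)) x v)
        = weightedForm r₁ R (q x) (fderiv ℝ q x v) := by
    intro G _ _ q S hSo hq hS x hx v
    have h1 : MDifferentiableAt 𝓘(ℝ, G) 𝓘(ℝ, EuclideanSpace ℝ (Fin (2 * n)))
        (fun x => j (q x)) x :=
      ((hsm hq hS).contMDiffAt (hSo.mem_nhds hx)).mdifferentiableAt (by simp)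
    have h2 := M.mfderiv_val_comp h1 (q := q)
      (by filter_upwards [hSo.mem_nhds hx] with y hy using hval _ (hS y hy)) v
    refine (congrArg (weightedForm r₁ R (M.val (j (q x)))) h2).trans ?_
    rw [hval _ (hS x hx)]
  have hρM : ∀ z ∈ U, ρ z ∈ M.set := hρU
  have hqM : ∀ p ∈ U ×ˢ (Set.univ : Set ℝ), Φ p.2 (ρ p.1) ∈ M.set := fun p hp =>
    hΦ.mem p.2 _ (hρM _ hp.1).1 (hρM _ hp.1).2
  have hqs : ContDiff ℝ ∞ fun p : Cn n × ℝ => Φ p.2 (ρ p.1) :=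
    hΦ.smooth.comp (contDiff_snd.prodMk (hρ.comp contDiff_fst))
  have hb : ∀ {p}, p ∈ fiberBoundary h δ r → p ∈ fiber h δ r := fun hp => ⟨hp.1.le, hp.2⟩
  have hbU : ∀ {p}, p ∈ fiberBoundary h δ r → ∀ t : ℝ, (p, t) ∈ U ×ˢ (Set.univ : Set ℝ) :=
    fun hp t => ⟨hfU (hb hp), trivial⟩
  have himg : ∀ x : M.Carrier, x ∈ (fun z => j (ρ z)) '' fiber h δ r ↔ ‖M.val x‖ ≤ r := by
    intro x
    constructor
    · rintro ⟨z, hz, rfl⟩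
      simp only [hρf z hz]
      rw [hval z ⟨hz.1.trans_lt hrR, hz.2⟩]
      exact hz.1
    · intro hx
      have h1 : M.val x ∈ fiber h δ r := ⟨hx, (M.val_mem x).2⟩
      exact ⟨M.val x, h1, by simp only [hρf _ h1, hvalj]⟩
  have hneg : ∀ t z, Φ (-t) (Φ t z) = z := fun t z => by
    rw [← hΦ.add, neg_add_cancel, hΦ.zero]
  have hneg' : ∀ t z, Φ t (Φ (-t) z) = z := fun t z => by
    rw [← hΦ.add, add_neg_cancel, hΦ.zero]
  have hκval : ∀ {p}, p ∈ fiberBoundary h δ r → ∀ t, M.val (j (Φ t (ρ p))) = Φ t p := by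
    intro p hp t
    rw [hval _ (hqM (p, t) (hbU hp t)), hρf p (hb hp)]
  have hlt : ∀ {p p'}, p ∈ fiberBoundary h δ r → p' ∈ fiberBoundary h δ r → ∀ t t', t < t' →
      Φ t p ≠ Φ t' p' := by
    intro p p' hp hp' t t' htt heq
    have h1 := hΦ.norm_lt p' hp'.1.ge (hp'.1.trans_lt hrR) hp'.2 (t' - t) (sub_pos.2 htt)
    rw [sub_eq_neg_add, hΦ.add, ← heq, hneg, hp.1, hp'.1] at h1
    exact h1.false
  -- The collar length `1` is arbitrary, since the flow exists for all times.
  refine ⟨fun z => j (ρ z), fun p => j (Φ p.2 (ρ p.1)), 1, U, U ×ˢ Set.univ, one_pos, hU, hfU,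
    hU.prod isOpen_univ, fun p hp => hbU hp.1 p.2, hsm hρ hρM, hsm hqs hqM, ?_, ?_,
    fun z hz v hv => ?_, fun p hp t _ v hv _ s => ?_, fun p hp => ?_, fun p hp t _ => ?_, ?_⟩
  · intro z hz z' hz' heq
    have := congrArg M.val heq
    simp only [hρf z hz, hρf z' hz'] at this
    rwa [hval z ⟨hz.1.trans_lt hrR, hz.2⟩, hval z' ⟨hz'.1.trans_lt hrR, hz'.2⟩] at this
  · rintro ⟨p, t⟩ ⟨hp, -⟩ ⟨p', t'⟩ ⟨hp', -⟩ heq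
    have h1 : Φ t p = Φ t' p' := by
      rw [← hκval hp t, ← hκval hp' t']
      exact congrArg M.val heq
    have h2 : t = t' := by
      rcases lt_trichotomy t t' with h3 | h3 | h3
      · exact (hlt hp hp' t t' h3 h1).elim
      · exact h3
      · exact (hlt hp' hp t' t h3 h1.symm).elim
    subst h2
    have h3 := congrArg (Φ (-t)) h1
    rw [hneg, hneg] at h3
    exact Prod.ext h3 rfl
  · refine (hpull hU hρ hρM z (hfU hz) v).trans ?_
    rw [hρf z hz, hρd z hz v hv, weightedForm_of_norm_le (hz.1.trans hr₁)]
  · have h1 := hpull (hU.prod isOpen_univ) hqs hqM (p, t) (hbU hp t) (v, s)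
    refine h1.trans ?_
    have hpR : ‖p‖ < R := hp.1.trans_lt hrR
    -- The retraction is the identity to first order on tangent vectors of the level. The time
    -- direction contributes the Liouville field, on which the form vanishes.
    have h2 : fderiv ℝ (fun p : Cn n × ℝ => Φ p.2 (ρ p.1)) (p, t) (v, s)
        = fderiv ℝ (Φ t) p v + s • deriv (fun t => Φ t p) t := by
      have hΦt : ContDiff ℝ ∞ (Φ t) := hΦ.smooth.comp (contDiff_const.prodMk contDiff_id)
      have hd := (hqs.differentiable (by simp) (p, t)).hasFDerivAt
      have e1 : fderiv ℝ (fun p : Cn n × ℝ => Φ p.2 (ρ p.1)) (p, t) (v, 0)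
          = fderiv ℝ (Φ t) p v := by
        have h3 : HasFDerivAt (fun y : Cn n => Φ t (ρ y)) _ p :=
          HasFDerivAt.comp (f := fun y : Cn n => (y, t)) p hd (hasFDerivAt_prodMk_left p t)
        have h4 : HasFDerivAt (fun y : Cn n => Φ t (ρ y)) _ p :=
          HasFDerivAt.comp p (hΦt.differentiable (by simp) (ρ p)).hasFDerivAt
            (hρ.differentiable (by simp) p).hasFDerivAt
        have h5 := congrArg (fun l => l v) (h3.unique h4)
        simpa [hρf p (hb hp), hρd p (hb hp) v hv] using h5
      have e2 : fderiv ℝ (fun p : Cn n × ℝ => Φ p.2 (ρ p.1)) (p, t) (0, 1)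
          = deriv (fun t => Φ t p) t := by
        have h3 : HasDerivAt (fun t => Φ t (ρ p)) _ t :=
          HasFDerivAt.comp_hasDerivAt (f := fun t => (p, t)) t hd
            ((hasDerivAt_const t p).prodMk (hasDerivAt_id t))
        rw [hρf p (hb hp)] at h3
        exact h3.deriv.symm
      have e3 : ((v, s) : Cn n × ℝ) = (v, 0) + s • ((0 : Cn n), (1 : ℝ)) := by simp
      rw [e3, map_add, map_smul, e1, e2]
    obtain ⟨w, hw, hw0⟩ := hΦ.hasDerivAt t p
    rw [h2, hw.deriv]
    simp only [hρf p (hb hp)]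
    rw [map_add, map_smul, hw0, smul_zero, add_zero, hΦ.weighted t p hpR hp.2 v hv,
      weightedForm_of_norm_le (hp.1.le.trans hr₁)]
  · exact congrArg j (hΦ.zero _)
  · refine (himg _).trans ?_
    rw [hκval hp t]
    constructor
    · intro h1
      by_contra! ht
      have h2 := hΦ.norm_lt p hp.1.ge (hp.1.trans_lt hrR) hp.2 t ht
      rw [hp.1] at h2
      exact h1.not_gt h2
    · intro ht
      by_contra! h1
      have h2 := hΦ.mem t p (hp.1.trans_lt hrR) hp.2
      rcases ht.eq_or_lt with rfl | ht
      · rw [hΦ.zero, hp.1] at h1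
        exact h1.false
      · have h3 := hΦ.norm_lt _ h1.le h2.1 h2.2 (-t) (neg_pos.2 ht)
        rw [hneg, hp.1] at h3
        exact h1.not_gt h3
  · refine Set.eq_univ_of_forall fun (x : M.Carrier) => ?_
    rcases le_or_gt ‖M.val x‖ r with hx | hx
    · exact Or.inl ((himg x).2 hx)
    · have hxM := M.val_mem x
      obtain ⟨t, ht, htr⟩ := hΦ.exists_norm_eq _ hx.le hxM.1 hxM.2
      have hp : Φ (-t) (M.val x) ∈ fiberBoundary h δ r := ⟨htr, (hΦ.mem _ _ hxM.1 hxM.2).2⟩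
      refine Or.inr ⟨(Φ (-t) (M.val x), t), ⟨hp, ht⟩, M.val_injective ?_⟩
      exact (hκval hp t).trans (hneg' t _)

end MilnorFibers

/-! ### Passing from ambient transports to fibers and completions. -/

namespace MilnorFibers

variable {n : ℕ}

/-! ### Exact symplectomorphisms between level sets -/

/-- An exact symplectomorphism of the ambient space between the level sets of `h` and `h'`, which is
the identity outside of the ball of radius `r`. -/
structure IsTransport (h h' : Cn n → ℂ) (δ : ℂ) (r : ℝ) (Ψ Φ : Cn n → Cn n) (G : Cn n → ℝ) :
    Prop where
  smooth : ContDiff ℝ ∞ Ψ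
  smooth_inv : ContDiff ℝ ∞ Φ
  smooth_primitive : ContDiff ℝ ∞ G
  left_inv : ∀ z, Φ (Ψ z) = z
  right_inv : ∀ z, Ψ (Φ z) = z
  eq_self : ∀ z, r ≤ ‖z‖ → Ψ z = z
  inv_eq_self : ∀ z, r ≤ ‖z‖ → Φ z = z
  primitive_eq_zero : ∀ z, r ≤ ‖z‖ → G z = 0
  level : ∀ z, h z = δ → h' (Ψ z) = δ
  inv_level : ∀ z, h' z = δ → h (Φ z) = δ
  exact : ∀ z, h z = δ → ∀ v, fderiv ℝ h z v = 0 →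
    stdPrimitive (Ψ z) (fderiv ℝ Ψ z v) = stdPrimitive z v + fderiv ℝ G z v

namespace IsTransport

variable {h h' : Cn n → ℂ} {δ : ℂ} {r : ℝ} {Ψ Φ : Cn n → Cn n} {G : Cn n → ℝ}
  (hT : IsTransport h h' δ r Ψ Φ G)
include hT

/-- A bijection that fixes every point outside of the ball preserves the ball. -/
theorem norm_lt {z : Cn n} (hz : ‖z‖ < r) : ‖Ψ z‖ < r := by
  by_contra! hc
  have h1 := hT.inv_eq_self _ hc
  rw [hT.left_inv] at h1
  rw [← h1] at hc
  exact hc.not_gt hz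

theorem inv_norm_lt {z : Cn n} (hz : ‖z‖ < r) : ‖Φ z‖ < r := by
  by_contra! hc
  have h1 := hT.eq_self _ hc
  rw [hT.right_inv] at h1
  rw [← h1] at hc
  exact hc.not_gt hz

theorem norm_mem {P : ℝ → Prop} (hP : ∀ s < r, P s) {z : Cn n} (hz : P ‖z‖) : P ‖Ψ z‖ := by
  rcases lt_or_ge ‖z‖ r with h1 | h1
  · exact hP _ (hT.norm_lt h1)
  · rwa [hT.eq_self z h1]

theorem inv_norm_mem {P : ℝ → Prop} (hP : ∀ s < r, P s) {z : Cn n} (hz : P ‖z‖) : P ‖Φ z‖ := by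
  rcases lt_or_ge ‖z‖ r with h1 | h1
  · exact hP _ (hT.inv_norm_lt h1)
  · rwa [hT.inv_eq_self z h1]

theorem fibersExactSymplectomorphic : FibersExactSymplectomorphic h h' δ r :=
  ⟨Ψ, Φ, G, Set.univ, Set.univ, isOpen_univ, Set.subset_univ _, isOpen_univ, Set.subset_univ _,
    hT.smooth.contDiffOn, hT.smooth_primitive.contDiffOn, hT.smooth_inv.contDiffOn,
    fun z hz => ⟨hT.norm_mem (P := (· ≤ r)) (fun _ h => le_of_lt h) hz.1, hT.level z hz.2⟩,
    fun z hz => ⟨hT.inv_norm_mem (P := (· ≤ r)) (fun _ h => le_of_lt h) hz.1, hT.inv_level z hz.2⟩,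
    ⟨fun z _ => hT.left_inv z, fun z _ => hT.right_inv z⟩,
    fun z hz v hv => hT.exact z hz.2 v hv⟩

/-- Up to radius `r` the weight is `1` at both `z` and `Ψ z`; beyond `r` the transport is locally
the identity and `G` is locally zero. The weight need not be preserved otherwise. -/
theorem weightedForm_apply {R : ℝ} {z : Cn n} (hz : h z = δ) {v : Cn n} (hv : fderiv ℝ h z v = 0) :
    weightedForm r R (Ψ z) (fderiv ℝ Ψ z v) = weightedForm r R z v + fderiv ℝ G z v := by
  rcases le_or_gt ‖z‖ r with h1 | h1
  · rw [weightedForm_of_norm_le h1, weightedForm_of_norm_le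
      (hT.norm_mem (P := (· ≤ r)) (fun _ h => le_of_lt h) h1), hT.exact z hz v hv]
  · have hn : {y : Cn n | r < ‖y‖} ∈ 𝓝 z :=
      (isOpen_lt continuous_const continuous_norm).mem_nhds h1
    have e1 : Ψ =ᶠ[𝓝 z] id := by
      filter_upwards [hn] with y hy using hT.eq_self y (le_of_lt hy)
    have e2 : G =ᶠ[𝓝 z] fun _ => 0 := by
      filter_upwards [hn] with y hy using hT.primitive_eq_zero y (le_of_lt hy)
    rw [e1.fderiv_eq, e2.fderiv_eq, hT.eq_self z h1.le]
    simp

theorem exactSymplectomorphic {R : ℝ} (hrR : r ≤ R) (hh : ContDiff ℝ ∞ h) (hh' : ContDiff ℝ ∞ h')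
    (hd : ∀ z, ‖z‖ ≤ R → h z = δ → pfaffian (fderiv ℝ h z) ≠ 0)
    (hm : ∀ z, r ≤ ‖z‖ → ‖z‖ ≤ R → h z = δ → 0 < radial z (fderiv ℝ h z))
    (hd' : ∀ z, ‖z‖ ≤ R → h' z = δ → pfaffian (fderiv ℝ h' z) ≠ 0)
    (hm' : ∀ z, r ≤ ‖z‖ → ‖z‖ ≤ R → h' z = δ → 0 < radial z (fderiv ℝ h' z)) :
    ExactSymplectomorphic (weightedLevel hh δ r R hd hm) (weightedLevel hh' δ r R hd' hm') := by
  set M := levelSubmanifold hh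
    (isOpen_lt continuous_norm continuous_const : IsOpen {z : Cn n | ‖z‖ < R}) δ
    fun z hz hzδ => surjective_of_pfaffian (hd z (le_of_lt hz) hzδ)
  set M' := levelSubmanifold hh'
    (isOpen_lt continuous_norm continuous_const : IsOpen {z : Cn n | ‖z‖ < R}) δ
    fun z hz hzδ => surjective_of_pfaffian (hd' z (le_of_lt hz) hzδ)
  have hlt : ∀ s < r, s < R := fun s hs => hs.trans_le hrR
  have hmaps : ∀ z ∈ M.set, Ψ z ∈ M'.set := fun z hz =>
    ⟨hT.norm_mem (P := (· < R)) hlt hz.1, hT.level z hz.2⟩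
  have hmaps' : ∀ z ∈ M'.set, Φ z ∈ M.set := fun z hz =>
    ⟨hT.inv_norm_mem (P := (· < R)) hlt hz.1, hT.inv_level z hz.2⟩
  set ψ := Submanifold.diffeomorph hT.smooth hT.smooth_inv hmaps hmaps' hT.left_inv hT.right_inv
  refine ⟨ψ, fun x => G (M.val x), fun x =>
    hT.smooth_primitive.contMDiff.contMDiffAt.comp x (M.contMDiff_val x), fun x v => ?_⟩
  set w : Cn n := mfderiv 𝓘(ℝ, EuclideanSpace ℝ (Fin (2 * n))) 𝓘(ℝ, Cn n) M.val x v with hw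
  have hcomp : ∀ {F : Type} [NormedAddCommGroup F] [NormedSpace ℝ F] {q : Cn n → F},
      ContDiff ℝ ∞ q → mfderiv 𝓘(ℝ, EuclideanSpace ℝ (Fin (2 * n))) 𝓘(ℝ, F)
        (fun x => q (M.val x)) x v = fderiv ℝ q (M.val x) w := by
    intro F _ _ q hq
    have h1 := mfderiv_comp (I'' := 𝓘(ℝ, F)) x (g := q)
      (hq.contMDiff.mdifferentiable (by simp) (M.val x)) (M.mdifferentiableAt_val x)
    rw [mfderiv_eq_fderiv] at h1
    exact congrArg (fun l => l v) h1
  have hker : fderiv ℝ h (M.val x) w = 0 := by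
    have h1 : (fun x => h (M.val x)) = fun _ => δ := funext fun y => (M.val_mem y).2
    have h2 := hcomp hh
    rw [h1] at h2
    have h3 : mfderiv 𝓘(ℝ, EuclideanSpace ℝ (Fin (2 * n))) 𝓘(ℝ, ℂ) (fun _ : M.Carrier => δ) x = 0 :=
      mfderiv_const
    exact h2.symm.trans (DFunLike.congr_fun h3 v)
  have hψ : mfderiv 𝓘(ℝ, EuclideanSpace ℝ (Fin (2 * n))) 𝓘(ℝ, Cn n) M'.val (ψ x)
      (mfderiv 𝓘(ℝ, EuclideanSpace ℝ (Fin (2 * n))) 𝓘(ℝ, EuclideanSpace ℝ (Fin (2 * n))) ψ x v)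
      = fderiv ℝ Ψ (M.val x) w := by
    have h1 := mfderiv_comp (I'' := 𝓘(ℝ, Cn n)) x (g := M'.val) (M'.mdifferentiableAt_val (ψ x))
      (ψ.contMDiff.mdifferentiable (by simp) x)
    rw [← hcomp hT.smooth]
    exact (congrArg (fun l => l v) h1).symm
  have hG := hcomp hT.smooth_primitive
  refine hG.trans ?_
  have h2 : weightedForm r R (Ψ (M.val x)) (fderiv ℝ Ψ (M.val x) w)
      - weightedForm r R (M.val x) w = fderiv ℝ G (M.val x) w := by
    rw [hT.weightedForm_apply (M.val_mem x).2 hker, add_sub_cancel_left]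
  rw [← h2, ← hψ]
  rfl

end IsTransport

/-! ### Dependence on the values in the ball -/

/-- Equality to first order on the closed ball. -/
def JetEqOn (h h' : Cn n → ℂ) (ε : ℝ) : Prop :=
  ∀ z, ‖z‖ ≤ ε → h z = h' z ∧ fderiv ℝ h z = fderiv ℝ h' z

/-- Equality of values and derivatives passes to the closed ball by continuity. Derivatives at
boundary points are thus covered although the functions may differ outside. -/
theorem jetEqOn_of_ball {h h' : Cn n → ℂ} {ε : ℝ} (hε : ε ≠ 0) (hh : ContDiff ℝ ∞ h)
    (hh' : ContDiff ℝ ∞ h') (heq : ∀ z, ‖z‖ < ε → h z = h' z) : JetEqOn h h' ε := by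
  have h0 : Set.EqOn h h' (Metric.ball 0 ε) := fun z hz => heq z (by simpa using hz)
  have h1 : Set.EqOn (fderiv ℝ h) (fderiv ℝ h') (Metric.ball 0 ε) := fun z hz =>
    (h0.eventuallyEq_of_mem (Metric.isOpen_ball.mem_nhds hz)).fderiv_eq
  have h2 := h0.closure hh.continuous hh'.continuous
  have h3 := h1.closure (hh.continuous_fderiv (by simp)) (hh'.continuous_fderiv (by simp))
  rw [closure_ball _ hε] at h2 h3
  exact fun z hz => ⟨h2 (by simpa using hz), h3 (by simpa using hz)⟩

namespace JetEqOn

variable {h h' : Cn n → ℂ} {ε : ℝ} (H : JetEqOn h h' ε)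
include H

theorem fiber_eq (δ : ℂ) : fiber h δ ε = fiber h' δ ε := by
  ext z
  exact and_congr_right fun hz => by rw [(H z hz).1]

theorem fiberBoundary_eq (δ : ℂ) : fiberBoundary h δ ε = fiberBoundary h' δ ε := by
  ext z
  exact and_congr_right fun hz => by rw [(H z hz.le).1]

theorem fiberTangent_eq {z : Cn n} (hz : ‖z‖ ≤ ε) : fiberTangent h z = fiberTangent h' z := by
  rw [fiberTangent, (H z hz).2, fiberTangent]

theorem fibersExactSymplectomorphic {h₁ h₁' : Cn n → ℂ} (H₁ : JetEqOn h₁ h₁' ε) {δ : ℂ}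
    (hF : FibersExactSymplectomorphic h h₁ δ ε) : FibersExactSymplectomorphic h' h₁' δ ε := by
  obtain ⟨Ψ, Φ, G, U₁, U₂, a1, a2, a3, a4, a5, a6, a7, a8, a9, a10, a11⟩ := hF
  rw [H.fiber_eq] at a2 a8 a9 a10 a11
  rw [H₁.fiber_eq] at a4 a8 a9 a10
  exact ⟨Ψ, Φ, G, U₁, U₂, a1, a2, a3, a4, a5, a6, a7, a8, a9, a10, fun z hz v hv =>
    a11 z hz v (by rwa [H.fiberTangent_eq hz.1])⟩

theorem isLiouvilleCompletion {δ : ℂ} {N : ExactSymplecticManifold (2 * n)}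
    (hN : IsLiouvilleCompletion h δ ε N) : IsLiouvilleCompletion h' δ ε N := by
  obtain ⟨ι, κ, c, U, W, a1, a2, a3, a4, a5, a6, a7, a8, a9, a10, a11, a12, a13, a14⟩ := hN
  rw [H.fiber_eq] at a3 a8 a10 a13 a14
  rw [H.fiberBoundary_eq] at a5 a9 a11 a12 a13 a14
  exact ⟨ι, κ, c, U, W, a1, a2, a3, a4, a5, a6, a7, a8, a9,
    fun z hz v hv => a10 z hz v (by rwa [H.fiberTangent_eq hz.1]),
    fun p hp t ht v hv => a11 p hp t ht v (by rwa [H.fiberTangent_eq hp.1.le]), a12, a13, a14⟩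

end JetEqOn

end MilnorFibers

/-! ### Estimates for polynomials near `f`: convexity, convergence, nonempty fibers. -/

namespace MilnorFibers

variable {n : ℕ}

/-! ### Polynomial functions -/

theorem hasFDerivAt_polyFun (p : Poly n) (z : Cn n) :
    HasFDerivAt (polyFun p)
      (∑ i, partialFun p i z • (EuclideanSpace.proj i : Cn n →L[ℂ] ℂ)) z := by
  induction p using MvPolynomial.induction_on with
  | C a =>
    have h1 : polyFun (MvPolynomial.C a : Poly n) = fun _ => a := by
      funext y
      simp [polyFun]
    rw [h1]
    refine (hasFDerivAt_const a z).congr_fderiv (ContinuousLinearMap.ext fun v => ?_)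
    simp [partialFun, polyFun, sum_apply]
  | add p q hp hq =>
    have h1 : polyFun (p + q) = fun y => polyFun p y + polyFun q y := by
      funext y
      simp [polyFun]
    rw [h1]
    refine (hp.add hq).congr_fderiv (ContinuousLinearMap.ext fun v => ?_)
    simp [partialFun, polyFun, sum_apply, add_mul, Finset.sum_add_distrib]
  | mul_X p i hp =>
    have h1 : polyFun (p * MvPolynomial.X i) = fun y => polyFun p y * y i := by
      funext y
      simp [polyFun]
    rw [h1]
    refine (hp.mul (EuclideanSpace.proj i : Cn n →L[ℂ] ℂ).hasFDerivAt).congr_fderiv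
      (ContinuousLinearMap.ext fun v => ?_)
    have h2 : ∀ j, partialFun (p * MvPolynomial.X i) j z
        = partialFun p j z * z i + polyFun p z * (Pi.single j 1 : Fin (n + 1) → ℂ) i := by
      intro j
      simp only [partialFun, polyFun, MvPolynomial.pderiv_mul, MvPolynomial.pderiv_X, map_add,
        map_mul, MvPolynomial.eval_X]
      congr 2
      rcases eq_or_ne i j with rfl | hij
      · simp
      · simp [hij]
    have h3 : ∑ j, polyFun p z * (Pi.single j 1 : Fin (n + 1) → ℂ) i * v j = polyFun p z * v i := by
      rw [Finset.sum_eq_single i (fun j _ hj => by simp [hj.symm]) (by simp)]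
      simp
    simp only [h2, add_mul, Finset.sum_add_distrib, sum_apply, add_apply, smul_apply, smul_eq_mul,
      PiLp.proj_apply, h3]
    rw [add_comm, Finset.mul_sum]
    congr 1
    exact Finset.sum_congr rfl fun j _ => by ring

theorem fderiv_polyFun_apply (p : Poly n) (z v : Cn n) :
    fderiv ℂ (polyFun p) z v = ∑ i, partialFun p i z * v i := by
  rw [(hasFDerivAt_polyFun p z).fderiv]
  simp

theorem differentiable_polyFun (p : Poly n) : Differentiable ℂ (polyFun p) := fun z =>
  (hasFDerivAt_polyFun p z).differentiableAt

theorem contDiff_polyFun (p : Poly n) : ContDiff ℝ ∞ (polyFun p) := by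
  change ContDiff ℝ ∞ fun z => polyFun p z
  induction p using MvPolynomial.induction_on with
  | C a => simpa [polyFun, Function.comp_def] using contDiff_const
  | add p q hp hq => simpa only [polyFun, map_add] using hp.add hq
  | mul_X p i hp =>
    have h1 : ContDiff ℝ ∞ fun z : Cn n => z i := by fun_prop
    simpa only [polyFun, map_mul, MvPolynomial.eval_X] using hp.mul h1

theorem fderiv_real_polyFun (p : Poly n) (z : Cn n) :
    fderiv ℝ (polyFun p) z = (fderiv ℂ (polyFun p) z).restrictScalars ℝ :=
  (differentiable_polyFun p z).fderiv_restrictScalars ℝ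

theorem pfaffian_polyFun_ne_zero {p : Poly n} {z : Cn n} (h : ∃ i, partialFun p i z ≠ 0) :
    pfaffian (fderiv ℝ (polyFun p) z) ≠ 0 := by
  obtain ⟨i, hi⟩ := h
  rw [fderiv_real_polyFun]
  refine pfaffian_complex_ne_zero (k := i) ?_
  rw [fderiv_polyFun_apply]
  simpa using hi

theorem IsMilnorRadius.isConvexAt {p : Poly n} {ε : ℝ} (hp : IsMilnorRadius p ε) {z : Cn n}
    (hz : 0 < ‖z‖) (hzε : ‖z‖ ≤ ε) (hz0 : polyFun p z = 0) :
    IsConvexAt z (fderiv ℝ (polyFun p) z) := by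
  obtain ⟨h1, v, hv, hzv⟩ := hp.2 z hz hzε hz0
  have h2 := pfaffian_polyFun_ne_zero h1
  refine ⟨h2, ?_⟩
  rw [fderiv_real_polyFun] at h2 ⊢
  exact radial_complex_pos h2 (by rw [fderiv_polyFun_apply, hv]) hzv

/-! ### Stability of convexity -/

/-- An open condition on `(z, D z)` along a compact part of a zero locus persists for nearby radii,
small values and perturbations of `D`. -/
theorem exists_forall_mem_of_near {E V : Type} [NormedAddCommGroup E] [ProperSpace E]
    [NormedAddCommGroup V] {f : E → ℂ} (hf : Continuous f) {D : E → V} (hD : Continuous D)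
    {P : Set (E × V)} (hP : IsOpen P) {ε' ε : ℝ}
    (h : ∀ z, ε' ≤ ‖z‖ → ‖z‖ ≤ ε → f z = 0 → (z, D z) ∈ P) :
    ∃ R τ : ℝ, ε < R ∧ 0 < τ ∧ ∀ z L, ε' ≤ ‖z‖ → ‖z‖ ≤ R → ‖f z‖ ≤ τ → ‖L - D z‖ ≤ τ →
      (z, L) ∈ P := by
  have hjet : Continuous fun z => (z, D z) := continuous_id.prodMk hD
  have hcl : ∀ r : ℝ, IsCompact {z : E | ‖z‖ ≤ r ∧ ε' ≤ ‖z‖} := fun r => by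
    have : {z : E | ‖z‖ ≤ r ∧ ε' ≤ ‖z‖} = Metric.closedBall 0 r ∩ {z | ε' ≤ ‖z‖} := by
      ext z
      simp
    rw [this]
    exact (isCompact_closedBall 0 r).inter_right (isClosed_le continuous_const continuous_norm)
  set K := {z : E | ‖z‖ ≤ ε ∧ ε' ≤ ‖z‖} ∩ f ⁻¹' {0}
  have hK : IsCompact K := (hcl ε).inter_right (isClosed_singleton.preimage hf)
  obtain ⟨τ, hτ, hsub⟩ := (hK.image hjet).exists_thickening_subset_open hP (by
    rintro _ ⟨z, hz, rfl⟩
    exact h z hz.1.2 hz.1.1 hz.2)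
  set O := (fun z => (z, D z)) ⁻¹'
    Metric.thickening (τ / 2) ((fun z => (z, D z)) '' K)
  have hO : IsOpen O := Metric.isOpen_thickening.preimage hjet
  -- In the shell `F ≤ 0` exactly on the compact set `K`. Away from the neighbourhood `O` of `K` it
  -- therefore has a positive lower bound `m`, and `F ≤ m / 2` forces `z ∈ O`.
  set F : E → ℝ := fun z => max (‖z‖ - ε) ‖f z‖
  have hF : Continuous F := (continuous_norm.sub continuous_const).max hf.norm
  have hK' : IsCompact ({z : E | ‖z‖ ≤ ε + 1 ∧ ε' ≤ ‖z‖} \ O) := (hcl _).diff hO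
  have hpos : ∀ z ∈ {z : E | ‖z‖ ≤ ε + 1 ∧ ε' ≤ ‖z‖} \ O, 0 < F z := by
    rintro z ⟨hz, hzO⟩
    by_contra! hle
    have h1 : ‖z‖ - ε ≤ 0 := (le_max_left _ _).trans hle
    have h2 : ‖f z‖ ≤ 0 := (le_max_right _ _).trans hle
    refine hzO (Metric.self_subset_thickening (half_pos hτ) _ ⟨z, ⟨⟨by linarith, hz.2⟩, ?_⟩, rfl⟩)
    simpa using h2
  obtain ⟨m, hm, hmin⟩ : ∃ m > 0, ∀ z ∈ {z : E | ‖z‖ ≤ ε + 1 ∧ ε' ≤ ‖z‖} \ O, m ≤ F z := by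
    rcases Set.eq_empty_or_nonempty ({z : E | ‖z‖ ≤ ε + 1 ∧ ε' ≤ ‖z‖} \ O) with he | hne
    · exact ⟨1, one_pos, fun z hz => by simp [he] at hz⟩
    · obtain ⟨z₀, hz₀, hmin⟩ := hK'.exists_isMinOn hne hF.continuousOn
      exact ⟨F z₀, hpos z₀ hz₀, fun z hz => hmin hz⟩
  -- The `m / 2` bounds give `F ≤ m / 2`; the `1` keeps `z` in the compact shell. The distance to
  -- the jet of `K` is then less than `τ / 2 + τ / 4 < τ`.
  refine ⟨ε + min 1 (m / 2), min (m / 2) (τ / 4), by simp [hm], by positivity,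
    fun z L hz hzR hfz hL => ?_⟩
  have hzO : z ∈ O := by
    by_contra hc
    have h1 := hmin z ⟨⟨hzR.trans (by gcongr; exact min_le_left _ _), hz⟩, hc⟩
    have h2 : F z ≤ m / 2 := max_le
      (by linarith [min_le_right 1 (m / 2)]) (hfz.trans (min_le_left _ _))
    linarith
  refine hsub (?_ : (z, L) ∈ _)
  obtain ⟨y, hy, hdist⟩ := Metric.mem_thickening_iff.1 hzO
  refine Metric.mem_thickening_iff.2 ⟨y, hy, ?_⟩
  have h3 : dist (z, L) (z, D z) ≤ τ / 4 := by
    rw [Prod.dist_eq, dist_self, max_eq_right dist_nonneg, dist_eq_norm]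
    exact hL.trans (min_le_right _ _)
  linarith [dist_triangle (z, L) (z, D z) y]

/-! ### Convergence of the family -/

/-- Cauchy's estimate on the unit disc in each complex line through `z`. -/
theorem norm_fderiv_le_of_norm_le {u : Cn n → ℂ} (hu : Differentiable ℂ u) {z : Cn n} {σ : ℝ}
    (h : ∀ y, ‖y - z‖ ≤ 1 → ‖u y‖ ≤ σ) : ‖fderiv ℝ u z‖ ≤ σ := by
  have hσ : 0 ≤ σ := (norm_nonneg (u z)).trans (h z (by simp))
  rw [(hu z).fderiv_restrictScalars ℝ, ContinuousLinearMap.norm_restrictScalars]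
  refine ContinuousLinearMap.opNorm_le_of_unit_norm (𝕜 := ℂ) hσ fun v hv => ?_
  have h1 : ∀ ζ : ℂ, HasDerivAt (fun ζ : ℂ => u (z + ζ • v)) (fderiv ℂ u (z + ζ • v) v) ζ :=
    fun ζ => by
      have h2 : HasDerivAt (fun ζ : ℂ => z + ζ • v) v ζ := by
        simpa using ((hasDerivAt_id ζ).smul_const v).const_add z
      exact (hu _).hasFDerivAt.comp_hasDerivAt ζ h2
  have h3 := Complex.norm_deriv_le_of_forall_mem_sphere_norm_le (c := 0) (R := 1) (C := σ)
    (f := fun ζ : ℂ => u (z + ζ • v)) one_pos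
    (Differentiable.diffContOnCl fun ζ => (h1 ζ).differentiableAt) fun ζ hζ => by
      refine h _ ?_
      have h4 : ‖ζ‖ = 1 := by simpa using hζ
      simp [norm_smul, h4, hv]
  rw [(h1 0).deriv] at h3
  simpa using h3

/-- Joint continuity at parameter `0` and compactness give uniform closeness of the values on the
ball of radius `R + 1`; the unit margin is spent on Cauchy's estimate for the derivatives. -/
theorem IsAdjacency.exists_near {f : ℝ → Poly n} (hf : IsAdjacency f) (R : ℝ) {σ : ℝ}
    (hσ : 0 < σ) : ∃ η₀ > 0, ∀ η, 0 < η → η < η₀ → η ≤ 1 → ∀ z : Cn n, ‖z‖ ≤ R →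
      ‖polyFun (f η) z - polyFun (f 0) z‖ ≤ σ ∧
      ‖fderiv ℝ (polyFun (f η)) z - fderiv ℝ (polyFun (f 0)) z‖ ≤ σ := by
  have hev : ∀ᶠ η : ℝ in 𝓝 0, ∀ z ∈ Metric.closedBall (0 : Cn n) (R + 1),
      η ∈ Set.Icc (0 : ℝ) 1 → ‖polyFun (f η) z - polyFun (f 0) z‖ < σ := by
    refine (isCompact_closedBall (0 : Cn n) (R + 1)).eventually_forall_of_forall_eventually
      fun z _ => ?_
    have h0 : ((0 : ℝ), z) ∈ Set.Icc (0 : ℝ) 1 ×ˢ (Set.univ : Set (Cn n)) :=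
      ⟨⟨le_rfl, zero_le_one⟩, trivial⟩
    have h1 : Filter.Tendsto
        (fun x : ℝ × Cn n => ‖polyFun (f x.1) x.2 - polyFun (f 0) x.2‖)
        (𝓝[Set.Icc (0 : ℝ) 1 ×ˢ (Set.univ : Set (Cn n))] (0, z))
        (𝓝 ‖polyFun (f 0) z - polyFun (f 0) z‖) :=
      ((hf.continuousOn _ h0).sub (((differentiable_polyFun (f 0)).continuous.comp
        continuous_snd).continuousAt.continuousWithinAt)).norm
    rw [sub_self, norm_zero] at h1
    filter_upwards [eventually_nhdsWithin_iff.1 (h1.eventually (gt_mem_nhds hσ))] with x hx hx1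
    exact hx ⟨hx1, trivial⟩
  obtain ⟨η₀, hη₀, hball⟩ := Metric.eventually_nhds_iff.1 hev
  refine ⟨η₀, hη₀, fun η h1 h2 h3 z hz => ?_⟩
  have h4 : ∀ y : Cn n, ‖y‖ ≤ R + 1 → ‖polyFun (f η) y - polyFun (f 0) y‖ ≤ σ := fun y hy =>
    (hball (by simpa [abs_of_pos h1] using h2) y (by simpa using hy) ⟨h1.le, h3⟩).le
  refine ⟨h4 z (by linarith), ?_⟩
  have h5 := norm_fderiv_le_of_norm_le (z := z)
    ((differentiable_polyFun (f η)).sub (differentiable_polyFun (f 0)))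
    (fun y hy => h4 y (by
      have := norm_add_le (y - z) z
      rw [sub_add_cancel] at this
      linarith))
  rwa [fderiv_sub ((contDiff_polyFun _).differentiable (by simp) z)
    ((contDiff_polyFun _).differentiable (by simp) z)] at h5

/-! ### Non-empty fibers -/

theorem HasIsolatedSingularity.exists_ne_zero {p : Poly n} (hp : HasIsolatedSingularity p) {r : ℝ}
    (hr : 0 < r) : ∃ z : Cn n, ‖z‖ ≤ r ∧ polyFun p z ≠ 0 := by
  by_contra! hc
  have h1 : ∀ z : Cn n, ‖z‖ < r → ∀ i, partialFun p i z = 0 := by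
    intro z hz i
    have h2 : polyFun p =ᶠ[𝓝 z] fun _ => 0 := by
      filter_upwards [(isOpen_lt continuous_norm continuous_const).mem_nhds hz] with y hy
        using hc y (le_of_lt hy)
    have h3 := fderiv_polyFun_apply p z (EuclideanSpace.single i 1)
    rw [h2.fderiv_eq] at h3
    simpa using h3.symm
  have h4 : ∀ᶠ z in 𝓝[≠] (0 : Cn n), ‖z‖ < r :=
    nhdsWithin_le_nhds ((isOpen_lt continuous_norm continuous_const).mem_nhds (by simpa using hr))
  obtain ⟨z, hz1, hz2⟩ := (hp.2.2.and h4).exists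
  obtain ⟨i, hi⟩ := hz1 (hc z hz2.le)
  exact hi (h1 z hz2 i)

/-- Polynomials close to a given one take all small values in a given ball. -/
theorem HasIsolatedSingularity.exists_fiber_nonempty {p : Poly n} (hp : HasIsolatedSingularity p)
    {r : ℝ} (hr : 0 < r) : ∃ m > 0, ∀ q : Poly n, polyFun q 0 = 0 →
      (∀ z : Cn n, ‖z‖ ≤ r → ‖polyFun q z - polyFun p z‖ ≤ m) →
      ∀ δ : ℂ, ‖δ‖ < m → (fiber (polyFun q) δ r).Nonempty := by
  -- The problem is reduced to one variable on the complex line through a point `z₁` with `p(z₁) ≠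
  -- 0`, where the quantitative open mapping theorem applies.
  obtain ⟨z₁, hz₁, hpz₁⟩ := hp.exists_ne_zero hr
  have hline : ∀ q : Poly n, Differentiable ℂ fun ζ : ℂ => polyFun q (ζ • z₁) := fun q =>
    (differentiable_polyFun q).comp (differentiable_id.smul_const z₁)
  have hident : ∀ q : Poly n, (∃ ζ : ℂ, polyFun q (ζ • z₁) ≠ 0) →
      ¬ ∀ᶠ ζ in 𝓝 (0 : ℂ), polyFun q (ζ • z₁) = 0 := by
    rintro q ⟨ζ, hζ⟩ hev
    exact hζ (((hline q).differentiableOn.analyticOnNhd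
      isOpen_univ).eqOn_zero_of_preconnected_of_eventuallyEq_zero isPreconnected_univ
      (Set.mem_univ 0) hev (Set.mem_univ ζ))
  have hiso : ∀ᶠ ζ in 𝓝[≠] (0 : ℂ), polyFun p (ζ • z₁) ≠ 0 :=
    ((hline p).analyticAt 0).eventually_eq_zero_or_eventually_ne_zero.resolve_left
      (hident p ⟨1, by simpa using hpz₁⟩)
  obtain ⟨s, hs, hball⟩ := Metric.eventually_nhds_iff.1 (eventually_nhdsWithin_iff.1 hiso)
  set ρ := min (s / 2) 1
  have hρ : 0 < ρ := by positivity
  have hρs : ρ < s := (min_le_left _ _).trans_lt (half_lt_self hs)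
  have hne : ∀ ζ ∈ Metric.sphere (0 : ℂ) ρ, 0 < ‖polyFun p (ζ • z₁)‖ := fun ζ hζ =>
    norm_pos_iff.2 (hball (by rwa [Metric.mem_sphere.1 hζ]) (by
      rintro rfl
      simp [hρ.ne] at hζ))
  obtain ⟨ζ₀, hζ₀, hmin⟩ := (isCompact_sphere (0 : ℂ) ρ).exists_isMinOn
    (NormedSpace.sphere_nonempty.2 hρ.le) (hline p).continuous.norm.continuousOn
  set m := ‖polyFun p (ζ₀ • z₁)‖ with hm
  have hm0 : 0 < m := hne ζ₀ hζ₀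
  -- On the circle `|p| ≥ m` and `|q - p| ≤ m / 4`, so `|q| ≥ m / 2`. With `q(0) = 0` the open
  -- mapping theorem then covers the disc of half that radius, `m / 4`.
  refine ⟨m / 4, by positivity, fun q hq0 hq δ hδ => ?_⟩
  have hζr : ∀ ζ : ℂ, ‖ζ‖ ≤ ρ → ‖ζ • z₁‖ ≤ r := fun ζ hζ => by
    rw [norm_smul]
    have : ‖ζ‖ ≤ 1 := hζ.trans (min_le_right _ _)
    nlinarith [norm_nonneg z₁, norm_nonneg ζ]
  have hq' : ∀ ζ ∈ Metric.sphere (0 : ℂ) ρ, m / 2 ≤ ‖polyFun q (ζ • z₁)‖ := fun ζ hζ => by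
    have h1 := hq (ζ • z₁) (hζr ζ (by simpa using (Metric.mem_sphere.1 hζ).le))
    have h2 : m ≤ ‖polyFun p (ζ • z₁)‖ := hmin hζ
    have h3 := norm_sub_norm_le (polyFun p (ζ • z₁)) (polyFun q (ζ • z₁))
    rw [norm_sub_rev] at h3
    linarith
  have hsub := DiffContOnCl.ball_subset_image_closedBall (f := fun ζ : ℂ => polyFun q (ζ • z₁))
    (z₀ := 0) (ε := m / 2) (hline q).diffContOnCl hρ
    (fun ζ hζ => by simpa [hq0] using hq' ζ hζ) (by
      have h1 := hident q ⟨ζ₀, norm_pos_iff.1 (by linarith [hq' ζ₀ hζ₀])⟩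
      refine (Filter.not_eventually.1 h1).mono fun ζ hζ => ?_
      simpa [hq0] using hζ)
  obtain ⟨ζ, hζ, hζδ⟩ := hsub (show δ ∈ _ by simp [hq0]; linarith)
  exact ⟨ζ • z₁, hζr ζ (by simpa using hζ), hζδ⟩

end MilnorFibers

/-! ### Global weights, the modified functions and the main theorem. -/

namespace MilnorFibers

open SmoothFlow

variable {n : ℕ}

/-! ### Weights interpolating between two polynomials -/

/-- Smooth functions with values in `[0, 1]` which vanish on the ball of radius `ε'`, with
derivative bounded by `C`. -/
structure IsWeight (ε' C : ℝ) (γ : Cn n → ℝ) : Prop where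
  smooth : ContDiff ℝ ∞ γ
  mem_Icc : ∀ z, γ z ∈ Set.Icc (0 : ℝ) 1
  eq_zero : ∀ z, ‖z‖ ≤ ε' → γ z = 0
  bound : ∀ z, ‖fderiv ℝ γ z‖ ≤ C

theorem isWeight_zero (ε' : ℝ) {C : ℝ} (hC : 0 ≤ C) : IsWeight ε' C fun _ : Cn n => (0 : ℝ) where
  smooth := contDiff_const
  mem_Icc _ := ⟨le_rfl, zero_le_one⟩
  eq_zero _ _ := rfl
  bound z := by simpa using hC

theorem IsWeight.interpolate {ε' C : ℝ} {γ₁ γ₂ : Cn n → ℝ} (h₁ : IsWeight ε' C γ₁)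
    (h₂ : IsWeight ε' C γ₂) {s : ℝ} (hs : s ∈ Set.Icc (0 : ℝ) 1) :
    IsWeight ε' C fun z => (1 - s) * γ₁ z + s * γ₂ z where
  smooth := (contDiff_const.mul h₁.smooth).add (contDiff_const.mul h₂.smooth)
  mem_Icc z := by
    have := convex_Icc (0 : ℝ) 1 (h₁.mem_Icc z) (h₂.mem_Icc z) (sub_nonneg.2 hs.2) hs.1
      (sub_add_cancel 1 s)
    simpa using this
  eq_zero z hz := by simp [h₁.eq_zero z hz, h₂.eq_zero z hz]
  bound z := by
    have h3 := ((h₁.smooth.differentiable (by simp) z).hasFDerivAt.const_mul (1 - s)).add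
      ((h₂.smooth.differentiable (by simp) z).hasFDerivAt.const_mul s)
    have h4 := convex_closedBall (0 : Cn n →L[ℝ] ℝ) C (mem_closedBall_zero_iff.2 (h₁.bound z))
      (mem_closedBall_zero_iff.2 (h₂.bound z)) (sub_nonneg.2 hs.2) hs.1 (sub_add_cancel 1 s)
    exact (congrArg norm h3.fderiv).trans_le (mem_closedBall_zero_iff.1 h4)

/-- Bump functions on a ball extend to weights which all agree outside of the ball and have support
in a slightly larger ball. -/
theorem exists_isWeight_extension (n : ℕ) {ε' ε R : ℝ} (hε : ε' < ε) (hR : ε < R)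
    (C : ℝ) : ∃ (C₁ : ℝ) (χ : Cn n → ℝ), 0 ≤ C₁ ∧ (∀ z, R ≤ ‖z‖ → χ z = 0) ∧
      ∀ β, IsBump ε ε' C β → ∃ γ, IsWeight ε' C₁ γ ∧ (∀ z, ‖z‖ < ε → γ z = β z) ∧
        ∀ z, ε ≤ ‖z‖ → γ z = χ z := by
  classical
  obtain ⟨χ, hχ, hχc, hχO, hχ1, hχI⟩ := exists_cutoff (isCompact_closedBall (0 : Cn n) ε)
    (Metric.isOpen_ball (x := 0) (ε := R)) (Metric.closedBall_subset_ball hR)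
  obtain ⟨Cχ, hCχ⟩ := (hχc.fderiv (𝕜 := ℝ)).exists_bound_of_continuous
    (hχ.continuous_fderiv (by simp))
  -- The bound depends on `C` and on the fixed cutoff `χ`, not on `β`, which makes the later
  -- constants uniform in `β`.
  refine ⟨max C Cχ, χ, ((norm_nonneg _).trans (hCχ 0)).trans (le_max_right _ _), fun z hz => ?_,
    fun β hβ => ?_⟩
  · refine image_eq_zero_of_notMem_tsupport fun hz' => ?_
    have := hχO hz'
    rw [mem_ball_zero_iff] at this
    exact hz.not_gt this
  set γ : Cn n → ℝ := fun z => if ‖z‖ < ε then β z else χ z with hγ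
  have hlt : ∀ z, ‖z‖ < ε → γ z = β z := fun z hz => if_pos hz
  have hge : ∀ z, ε ≤ ‖z‖ → γ z = χ z := fun z hz => if_neg hz.not_gt
  have e1 : ∀ z, ‖z‖ < ε → γ =ᶠ[𝓝 z] β := fun z hz => by
    filter_upwards [(isOpen_lt continuous_norm continuous_const).mem_nhds hz] with y hy
      using hlt y hy
  have e2 : ∀ z, ε < ‖z‖ → γ =ᶠ[𝓝 z] χ := fun z hz => by
    filter_upwards [(isOpen_lt continuous_const continuous_norm).mem_nhds hz] with y hy
      using hge y (le_of_lt hy)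
  -- The two pieces fit smoothly because near the sphere both are `1`: `β` on its inner side, and
  -- `χ` on a neighbourhood of the closed ball.
  have e3 : ∀ z, ‖z‖ = ε → γ =ᶠ[𝓝 z] fun _ => 1 := fun z hz => by
    have h1 : (ε' + ε) / 2 < ‖z‖ := by linarith
    filter_upwards [(isOpen_lt continuous_const continuous_norm).mem_nhds h1,
      hχ1 z (by simp [hz])] with y hy hy'
    rcases lt_or_ge ‖y‖ ε with hyε | hyε
    · rw [hlt y hyε, hβ.eq_one y hy hyε.le]
    · rw [hge y hyε, hy']
  refine ⟨γ, ⟨contDiff_iff_contDiffAt.2 fun z => ?_, fun z => ?_, fun z hz => ?_, fun z => ?_⟩,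
    hlt, hge⟩
  · rcases lt_trichotomy ‖z‖ ε with hz | hz | hz
    · exact hβ.smooth.contDiffAt.congr_of_eventuallyEq (e1 z hz)
    · exact contDiffAt_const.congr_of_eventuallyEq (e3 z hz)
    · exact hχ.contDiffAt.congr_of_eventuallyEq (e2 z hz)
  · rcases lt_or_ge ‖z‖ ε with hz | hz
    · exact hlt z hz ▸ hβ.mem_Icc z
    · exact hge z hz ▸ hχI z
  · rw [hlt z (hz.trans_lt hε), hβ.eq_zero z hz]
  · rcases lt_trichotomy ‖z‖ ε with hz | hz | hz
    · rw [(e1 z hz).fderiv_eq]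
      exact (hβ.bound z hz.le).trans (le_max_left _ _)
    · rw [(e3 z hz).fderiv_eq, fderiv_fun_const, Pi.zero_apply, norm_zero]
      exact ((norm_nonneg _).trans (hCχ 0)).trans (le_max_right _ _)
    · rw [(e2 z hz).fderiv_eq]
      exact (hCχ z).trans (le_max_right _ _)

/-! ### The modified functions -/

theorem contDiff_modified (f g : Poly n) {γ : Cn n → ℝ} (hγ : ContDiff ℝ ∞ γ) :
    ContDiff ℝ ∞ (modified f g γ) :=
  (contDiff_polyFun g).add (((contDiff_polyFun f).sub (contDiff_polyFun g)).mul
    (Complex.ofRealCLM.contDiff.comp hγ))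

theorem modified_zero (f g : Poly n) : modified f g (fun _ => 0) = polyFun g := by
  funext z
  simp [modified]

theorem fderiv_modified (f g : Poly n) {γ : Cn n → ℝ} (hγ : ContDiff ℝ ∞ γ) (z : Cn n) :
    fderiv ℝ (modified f g γ) z = fderiv ℝ (polyFun g) z
      + (γ z • (fderiv ℝ (polyFun f) z - fderiv ℝ (polyFun g) z)
        + (fderiv ℝ γ z).smulRight (polyFun f z - polyFun g z)) := by
  have hd : ∀ p : Poly n, HasFDerivAt (polyFun p) (fderiv ℝ (polyFun p) z) z := fun p =>
    ((contDiff_polyFun p).differentiable (by simp) z).hasFDerivAt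
  have h1 := (hd g).add
    ((hγ.differentiable (by simp) z).hasFDerivAt.fun_smul ((hd f).sub (hd g)))
  refine HasFDerivAt.fderiv (h1.congr_of_eventuallyEq (Filter.Eventually.of_forall fun y => ?_))
  simp [modified, mul_comm]

theorem norm_modified_sub_le {f g : Poly n} {γ : Cn n → ℝ} {z : Cn n}
    (hγ : γ z ∈ Set.Icc (0 : ℝ) 1) {σ : ℝ} (h : ‖polyFun g z - polyFun f z‖ ≤ σ) :
    ‖modified f g γ z - polyFun f z‖ ≤ σ := by
  have h1 : modified f g γ z - polyFun f z = (1 - γ z) • (polyFun g z - polyFun f z) := by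
    simp only [modified, Complex.real_smul]
    push_cast
    ring
  rw [h1, norm_smul, Real.norm_of_nonneg (sub_nonneg.2 hγ.2)]
  nlinarith [hγ.1, norm_nonneg (polyFun g z - polyFun f z)]

theorem norm_fderiv_modified_sub_le {f g : Poly n} {ε' C : ℝ} {γ : Cn n → ℝ}
    (hγ : IsWeight ε' C γ) {z : Cn n} {σ : ℝ} (h : ‖polyFun g z - polyFun f z‖ ≤ σ)
    (h' : ‖fderiv ℝ (polyFun g) z - fderiv ℝ (polyFun f) z‖ ≤ σ) :
    ‖fderiv ℝ (modified f g γ) z - fderiv ℝ (polyFun f) z‖ ≤ (1 + C) * σ := by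
  have hI := hγ.mem_Icc z
  have h1 : fderiv ℝ (modified f g γ) z - fderiv ℝ (polyFun f) z
      = (1 - γ z) • (fderiv ℝ (polyFun g) z - fderiv ℝ (polyFun f) z)
        + (fderiv ℝ γ z).smulRight (polyFun f z - polyFun g z) := by
    rw [fderiv_modified f g hγ.smooth]
    module
  have h2 : ‖(1 - γ z) • (fderiv ℝ (polyFun g) z - fderiv ℝ (polyFun f) z)‖ ≤ σ := by
    rw [norm_smul, Real.norm_of_nonneg (sub_nonneg.2 hI.2)]
    nlinarith [hI.1, norm_nonneg (fderiv ℝ (polyFun g) z - fderiv ℝ (polyFun f) z)]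
  have h3 : ‖(fderiv ℝ γ z).smulRight (polyFun f z - polyFun g z)‖ ≤ C * σ := by
    rw [ContinuousLinearMap.norm_smulRight_apply, norm_sub_rev]
    exact mul_le_mul (hγ.bound z) h (norm_nonneg _) ((norm_nonneg _).trans (hγ.bound z))
  rw [h1, one_add_mul]
  exact (norm_add_le _ _).trans (add_le_add h2 h3)

/-- The modified function and its derivative are close to those of `f`, with constants depending
only on the bound `C` of the weight. The radius `R` is chosen before `C`, because the bound for
extended bump functions itself depends on `R`. -/
theorem IsAdjacency.exists_isConvexAt {f : ℝ → Poly n} (hf : IsAdjacency f) {ε ε' : ℝ}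
    (hε : IsMilnorRadius (f 0) ε) (hε' : 0 < ε') (hε'ε : ε' < ε) :
    ∃ R > ε, ∀ C ≥ 0, ∃ δ₀ > 0, ∃ η₀ > 0, ∀ η, 0 < η → η < η₀ → η ≤ 1 → ∀ δ : ℂ, ‖δ‖ < δ₀ →
      (fiber (polyFun (f η)) δ ε').Nonempty ∧
      ∀ γ : Cn n → ℝ, IsWeight ε' C γ → ∀ z, ε' ≤ ‖z‖ → ‖z‖ ≤ R →
        modified (f 0) (f η) γ z = δ → IsConvexAt z (fderiv ℝ (modified (f 0) (f η) γ) z) := by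
  have hf0 := contDiff_polyFun (f 0)
  obtain ⟨R, τ, hR, hτ, hconv⟩ := exists_forall_mem_of_near hf0.continuous
    (hf0.continuous_fderiv (by simp)) isOpen_isConvexAt (ε' := ε') (ε := ε)
    fun z hz hzε hz0 => hε.isConvexAt (hε'.trans_le hz) hzε hz0
  refine ⟨R, hR, fun C hC => ?_⟩
  obtain ⟨m, hm, hne⟩ := (hf.isolated 0 ⟨le_rfl, zero_le_one⟩).exists_fiber_nonempty hε'
  -- The three bounds serve for nonempty fibers, for `|f z| ≤ τ` (the other half of `τ` is left to
  -- `δ`), and for the derivative, whose error is at most `(1 + C) σ`.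
  set σ := min m (min (τ / 2) (τ / (1 + C)))
  have hσ : 0 < σ := by positivity
  obtain ⟨η₀, hη₀, hnear⟩ := hf.exists_near R hσ
  refine ⟨min m (τ / 2), by positivity, η₀, hη₀, fun η h1 h2 h3 δ hδ =>
    ⟨?_, fun γ hγ z hz hzR hzδ => ?_⟩⟩
  · exact hne (f η) (hf.isolated η ⟨h1.le, h3⟩).1
      (fun z hz => (hnear η h1 h2 h3 z (by linarith)).1.trans (min_le_left _ _)) δ
      (hδ.trans_le (min_le_left _ _))
  · obtain ⟨h4, h5⟩ := hnear η h1 h2 h3 z hzR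
    refine hconv z _ hz hzR ?_ ?_
    · have h6 := norm_modified_sub_le (hγ.mem_Icc z) h4
      rw [hzδ, norm_sub_rev] at h6
      have h7 := norm_sub_norm_le (polyFun (f 0) z) δ
      have h8 : σ ≤ τ / 2 := (min_le_right _ _).trans (min_le_left _ _)
      linarith [hδ.trans_le (min_le_right m (τ / 2))]
    · refine (norm_fderiv_modified_sub_le hγ h4 h5).trans ?_
      have h8 : σ ≤ τ / (1 + C) := (min_le_right _ _).trans (min_le_right _ _)
      rw [mul_comm]
      exact (le_div_iff₀ (by linarith)).1 h8

/-- The regularity of the fibers inside the ball where the weight vanishes. -/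
theorem pfaffian_modified_ne_zero {f g : Poly n} {ε ε' C : ℝ} (hε : ε' ≤ ε) {γ : Cn n → ℝ}
    (hγ : IsWeight ε' C γ) {δ : ℂ} (hreg : IsRegularLevel g δ ε) {z : Cn n} (hz : ‖z‖ < ε')
    (hzδ : modified f g γ z = δ) : pfaffian (fderiv ℝ (modified f g γ) z) ≠ 0 := by
  have h1 : ∀ y : Cn n, ‖y‖ < ε' → modified f g γ y = polyFun g y := fun y hy => by
    simp [modified, hγ.eq_zero y hy.le]
  have h2 : modified f g γ =ᶠ[𝓝 z] polyFun g := by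
    filter_upwards [(isOpen_lt continuous_norm continuous_const).mem_nhds hz] with y hy
      using h1 y hy
  rw [h2.fderiv_eq]
  exact pfaffian_polyFun_ne_zero (hreg z (hz.le.trans hε) (by rw [← h1 z hz, hzδ]))

/-- Weights form a convex set and the modified function is affine in the weight. So the segment
between two modified functions consists of modified functions, to which the nondegeneracy assumption
applies. -/
theorem exists_isTransport_modified {f g : Poly n} {δ : ℂ} {ε' C r : ℝ} {γ₁ γ₂ : Cn n → ℝ}
    (h₁ : IsWeight ε' C γ₁) (h₂ : IsWeight ε' C γ₂) (heq : ∀ z, r ≤ ‖z‖ → γ₁ z = γ₂ z)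
    (hd : ∀ γ, IsWeight ε' C γ → ∀ z, ‖z‖ ≤ r → modified f g γ z = δ →
      pfaffian (fderiv ℝ (modified f g γ) z) ≠ 0) :
    ∃ Ψ Φ G, IsTransport (modified f g γ₁) (modified f g γ₂) δ r Ψ Φ G := by
  have hs₁ := contDiff_modified f g h₁.smooth
  have hs₂ := contDiff_modified f g h₂.smooth
  set k : Cn n → ℂ := fun z => modified f g γ₂ z - modified f g γ₁ z with hk
  obtain ⟨Ψ, Φ, G, a1, a2, a3, a4, a5, a6, a7, a8, a9, a10, a11⟩ :=
    exists_parallelTransport (r := r) (δ := δ) hs₁ (hs₂.sub hs₁ : ContDiff ℝ ∞ k)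
      (fun z hz => by simp [modified, heq z hz]) (fun s hs z hz hzδ => by
        have e1 : modified f g (fun z => (1 - s) * γ₁ z + s * γ₂ z)
            = fun z => modified f g γ₁ z + s • k z := by
          funext y
          simp only [hk, modified, Complex.real_smul]
          push_cast
          ring
        have e2 := ((hs₁.differentiable (by simp) z).hasFDerivAt.add
          (((hs₂.sub hs₁ : ContDiff ℝ ∞ k).differentiable (by simp) z).hasFDerivAt.const_smul
            s)).fderiv
        have h3 := hd _ (h₁.interpolate h₂ hs) z hz
        rw [e1] at h3
        have h4 := h3 hzδ
        rwa [← e2])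
  refine ⟨Ψ, Φ, G, a1, a2, a3, a4, a5, a6, a7, a8, fun z hz => ?_, fun z hz => a10 z ?_, a11⟩
  · have := a9 z hz
    simpa [hk] using this
  · simpa [hk] using hz

end MilnorFibers

theorem mainTheorem8 (n : ℕ) (f : ℝ → MilnorFibers.Poly n) (hf : MilnorFibers.IsAdjacency f)
    (ε ε' C : ℝ) (hε : MilnorFibers.IsMilnorRadius (f 0) ε) (hε'_pos : 0 < ε') (hε'_lt : ε' < ε) :
    ∃ δ₀ : ℝ, 0 < δ₀ ∧ ∃ η₀ : ℝ, 0 < η₀ ∧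
      ∀ η : ℝ, 0 < η → η < η₀ → η ≤ 1 →
      ∀ δ : ℂ, 0 < ‖δ‖ → ‖δ‖ < δ₀ → MilnorFibers.IsRegularLevel (f η) δ ε →
        MilnorFibers.IsLiouvilleDomain (MilnorFibers.polyFun (f η)) δ ε ∧
        (∀ β : MilnorFibers.Cn n → ℝ, MilnorFibers.IsBump ε ε' C β →
          MilnorFibers.IsLiouvilleDomain (MilnorFibers.modified (f 0) (f η) β) δ ε) ∧
        (∀ β₁ β₂ : MilnorFibers.Cn n → ℝ,
          MilnorFibers.IsBump ε ε' C β₁ → MilnorFibers.IsBump ε ε' C β₂ →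
          MilnorFibers.FibersExactSymplectomorphic (MilnorFibers.modified (f 0) (f η) β₁)
            (MilnorFibers.modified (f 0) (f η) β₂) δ ε) ∧
        (∀ β : MilnorFibers.Cn n → ℝ, MilnorFibers.IsBump ε ε' C β →
          ∃ N N' : MilnorFibers.ExactSymplecticManifold (2 * n),
            MilnorFibers.IsLiouvilleCompletion (MilnorFibers.modified (f 0) (f η) β) δ ε N ∧
            MilnorFibers.IsLiouvilleCompletion (MilnorFibers.polyFun (f η)) δ ε N' ∧
            MilnorFibers.ExactSymplectomorphic N N') := by
  open MilnorFibers in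
  obtain ⟨R, hR, hmain⟩ := hf.exists_isConvexAt hε hε'_pos hε'_lt
  -- At radius `(ε + R) / 2` all extended weights have become zero, and there the factor in front of
  -- `θ` starts to grow. The shell from there to `R` remains for the completion.
  obtain ⟨C₁, χ, hC₁, hχ, hext⟩ := exists_isWeight_extension n hε'_lt
    (show ε < (ε + R) / 2 by linarith) C
  obtain ⟨δ₀, hδ₀, η₀, hη₀, hconv⟩ := hmain C₁ hC₁
  refine ⟨δ₀, hδ₀, η₀, hη₀, fun η h1 h2 h3 δ _ hδ hreg => ?_⟩
  obtain ⟨hne, hconv⟩ := hconv η h1 h2 h3 δ hδ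
  have hε0 : 0 < ε := hε.1
  have hm : ∀ γ, IsWeight ε' C₁ γ → ∀ z, ε ≤ ‖z‖ → ‖z‖ ≤ R → modified (f 0) (f η) γ z = δ →
      0 < radial z (fderiv ℝ (modified (f 0) (f η) γ) z) := fun γ hγ z hz hzR hzδ =>
    (hconv γ hγ z (hε'_lt.le.trans hz) hzR hzδ).2
  have hd : ∀ γ, IsWeight ε' C₁ γ → ∀ z, ‖z‖ ≤ R → modified (f 0) (f η) γ z = δ →
      pfaffian (fderiv ℝ (modified (f 0) (f η) γ) z) ≠ 0 := fun γ hγ z hzR hzδ => by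
    rcases lt_or_ge ‖z‖ ε' with hz | hz
    · exact pfaffian_modified_ne_zero hε'_lt.le hγ hreg hz hzδ
    · exact (hconv γ hγ z hz hzR hzδ).1
  have hdom : ∀ γ, IsWeight ε' C₁ γ → ∀ h : Cn n → ℂ, ContDiff ℝ ∞ h →
      JetEqOn (modified (f 0) (f η) γ) h ε → IsLiouvilleDomain h δ ε := fun γ hγ h hh hj =>
    isLiouvilleDomain_of_pfaffian hh
      (fun z hz hzδ => (hj z hz).2 ▸ hd γ hγ z (hz.trans hR.le) ((hj z hz).1.trans hzδ))
      (fun z hz hzδ => (hj z hz.le).2 ▸ hm γ hγ z hz.ge (hz.le.trans hR.le)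
        ((hj z hz.le).1.trans hzδ))
  have hcomp : ∀ γ (hγ : IsWeight ε' C₁ γ), IsLiouvilleCompletion (modified (f 0) (f η) γ) δ ε
      (weightedLevel (contDiff_modified (f 0) (f η) hγ.smooth) δ ((ε + R) / 2) R (hd γ hγ)
        fun z hz => hm γ hγ z (le_trans (by linarith) hz)) := fun γ hγ => by
    refine isLiouvilleCompletion_weightedLevel _ hε0 (by linarith) (by linarith) (hd γ hγ)
      (hm γ hγ) ?_
    obtain ⟨z, hz, hzδ⟩ := hne
    exact ⟨z, hz.trans hε'_lt.le, by simp [modified, hγ.eq_zero z hz, hzδ]⟩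
  have hjet : ∀ β γ, IsBump ε ε' C β → IsWeight ε' C₁ γ → (∀ z, ‖z‖ < ε → γ z = β z) →
      JetEqOn (modified (f 0) (f η) γ) (modified (f 0) (f η) β) ε := fun β γ hβ hγ hγβ =>
    jetEqOn_of_ball hε0.ne' (contDiff_modified _ _ hγ.smooth) (contDiff_modified _ _ hβ.smooth)
      fun z hz => by simp [modified, hγβ z hz]
  have h0 := isWeight_zero (n := n) ε' hC₁
  have hj0 : JetEqOn (modified (f 0) (f η) fun _ => 0) (polyFun (f η)) ε := fun z _ => by
    rw [modified_zero]
    exact ⟨rfl, rfl⟩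
  refine ⟨?_, fun β hβ => ?_, fun β₁ β₂ hβ₁ hβ₂ => ?_, fun β hβ => ?_⟩
  · exact hdom _ h0 _ (contDiff_polyFun _) hj0
  · obtain ⟨γ, hγ, hγβ, -⟩ := hext β hβ
    exact hdom γ hγ _ (contDiff_modified _ _ hβ.smooth) (hjet β γ hβ hγ hγβ)
  · obtain ⟨γ₁, hγ₁, hγβ₁, hγχ₁⟩ := hext β₁ hβ₁
    obtain ⟨γ₂, hγ₂, hγβ₂, hγχ₂⟩ := hext β₂ hβ₂
    -- Both extensions equal `χ` from radius `ε` on, so the transport fixes the boundary of the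
    -- fibers.
    obtain ⟨Ψ, Φ, G, hT⟩ := exists_isTransport_modified hγ₁ hγ₂
      (fun z hz => (hγχ₁ z hz).trans (hγχ₂ z hz).symm)
      fun γ hγ z hz => hd γ hγ z (hz.trans hR.le)
    exact (hjet β₁ γ₁ hβ₁ hγ₁ hγβ₁).fibersExactSymplectomorphic (hjet β₂ γ₂ hβ₂ hγ₂ hγβ₂)
      hT.fibersExactSymplectomorphic
  · obtain ⟨γ, hγ, hγβ, hγχ⟩ := hext β hβ
    -- The weights `γ` and `0` differ on the sphere of radius `ε` but agree from `(ε + R) / 2` on.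
    -- The transport therefore need not preserve `B_ε`, but it does act on the models of the
    -- completions.
    obtain ⟨Ψ, Φ, G, hT⟩ := exists_isTransport_modified (r := (ε + R) / 2) hγ h0
      (fun z hz => (hγχ z (le_trans (by linarith) hz)).trans (hχ z hz))
      fun γ hγ z hz => hd γ hγ z (hz.trans (by linarith))
    exact ⟨_, _, (hjet β γ hβ hγ hγβ).isLiouvilleCompletion (hcomp γ hγ),
      hj0.isLiouvilleCompletion (hcomp _ h0),
      hT.exactSymplectomorphic (by linarith) _ _ _ _ _ _⟩
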